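/- Let $k\ge 1$ and let $\mathcal W,\mathcal Z$ be integer-valued random variables with values in $\{0,1,\dots,k\}$ (not necessarily independent of each other), with means $\mu_{\mathcal W},\mu_{\mathcal Z}$, such that $\mu_{\mathcal W}+\mu_{\mathcal Z}<2k$. Consider the balanced, tenable two-colour Pólya process with random replacement matrix $\begin{pmatrix}\mathcal W & k-\mathcal W\\ k-\mathcal Z & \mathcal Z\end{pmatrix}$. It starts at time $0$ with $W_0$ white and $B_0$ blue balls, where $\tau_0=W_0+B_0\ge 1$. Each ball carries an independent $\mathrm{Exp}(1)$ clock. When the clock of a ball rings, the ball is picked and a fresh independent copy of $(\mathcal W,\mathcal Z)$ is taken: $\mathcal W$ white and $k-\mathcal W$ blue balls are added if the picked ball is white, and $k-\mathcal Z$ white and $\mathcal Z$ blue balls are added if it is blue. The picked ball is put back with a fresh $\mathrm{Exp}(1)$ clock, and every new ball gets its own fresh independent $\mathrm{Exp}(1)$ clock. Let $W(t)$ and $B(t)$ be the numbers of white and blue balls at time $t$. (a) For all integers $i,j\ge 0$, the mixed moments $\mathbb E[W(t)^iB(t)^j]$ are finite for all $t\ge 0$ and, as $t\to\infty$, $$\mathbb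 E[W(t)^iB(t)^j]=M_{i,j}\,e^{k(i+j)t}+O\!\left(e^{[k(i+j)-(2k-\mu_{\mathcal W}-\mu_{\mathcal Z})]t}\right)+O\!\left(e^{k(i+j-1)t}\right),$$ where $$M_{i,j}=\frac{(k-\mu_{\mathcal W})^{j}(k-\mu_{\mathcal Z})^{i}}{(2k-\mu_{\mathcal W}-\mu_{\mathcal Z})^{i+j}}\,k^{i+j}\left\langle\frac{\tau_0}{k}\right\rangle_{i+j},\qquad \langle x\rangle_n=x(x+1)\cdots(x+n-1),\quad 0^0=1.$$ In particular $e^{-k(i+j)t}\,\mathbb E[W(t)^iB(t)^j]\to M_{i,j}$. (b) As $t\to\infty$, $$e^{-kt}\begin{pmatrix}W(t)\\B(t)\end{pmatrix}\ \xrightarrow{\ d\ }\ G\begin{pmatrix}\frac{k-\mu_{\mathcal Z}}{2k-\mu_{\mathcal W}-\mu_{\mathcal Z}}\\[2pt] \frac{k-\mu_{\mathcal W}}{2k-\mu_{\mathcal W}-\mu_{\mathcal Z}}\end{pmatrix},\qquad G\sim\mathrm{Gamma}\!\left(\frac{\tau_0}{k},k\right),$$ where $\mathrm{Gamma}(a,\theta)$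 is the gamma distribution with shape $a$ and scale $\theta$ (mean $a\theta$). (c) In particular, for the randomized Play-the-Winner scheme, i.e. $k=1$, $\mathcal W\sim\mathrm{Bernoulli}(p_1)$, $\mathcal Z\sim\mathrm{Bernoulli}(p_2)$, with $q_1=1-p_1$, $q_2=1-p_2$ and $q_1+q_2>0$, $$e^{-t}\begin{pmatrix}W(t)\\B(t)\end{pmatrix}\ \xrightarrow{\ d\ }\ G'\begin{pmatrix}\frac{q_2}{q_1+q_2}\\[2pt] \frac{q_1}{q_1+q_2}\end{pmatrix},\qquad G'\sim\mathrm{Gamma}(\tau_0,1).$$ -/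

import Mathlib

open MeasureTheory ProbabilityTheory Filter Topology Asymptotics

noncomputable section

namespace Polya

/-- The state of a two-colour urn right after a renewal. The balls carry the labels
`0, …, balls - 1`; `white` is the set of labels of the white balls, every other ball is blue.
`clock m` is the remaining time until the clock of ball `m` rings, and `time` is the time of
the latest renewal (`0` at the start). -/
structure UrnState where
  balls : ℕ
  white : Finset ℕ
  clock : ℕ → ℝ
  time : ℝ

namespace UrnState

/-- The number of white balls. -/
def whiteCount (S : UrnState) : ℕ := S.white.card

/-- The number of blue balls. -/
def blueCount (S : UrnState) : ℕ := (Finset.range S.balls \ S.white).card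

/-- The ball whose clock rings first. (Ties have probability zero; the smallest label wins.) -/
def ringing (S : UrnState) : ℕ :=
  sInf {m | m < S.balls ∧ ∀ l < S.balls, S.clock m ≤ S.clock l}

/-- One renewal of the urn with balance factor `k` and replacement matrix
`((w, k - w), (k - z, z))`. The first clock rings and its ball is picked. If the ball is white,
`w` white and `k - w` blue balls are added; if it is blue, `k - z` white and `z` blue balls are
added. The picked ball returns to the urn with the fresh clock `ξ m` (`m` its label), each new
ball `m` gets the fresh clock `ξ m`, and the clocks of all the other balls run on. -/
def step (k w z : ℕ) (ξ : ℕ → ℝ) (S : UrnState) : UrnState where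
  balls := S.balls + k
  white := S.white ∪
    Finset.Ico S.balls (S.balls + if S.ringing ∈ S.white then w else k - z)
  clock := fun m =>
    if m < S.balls ∧ m ≠ S.ringing then S.clock m - S.clock S.ringing else ξ m
  time := S.time + S.clock S.ringing

end UrnState

/-- The urn after `n` renewals, started with `W₀` white and `B₀` blue balls. The clock that
ball `m` receives at the `n`-th renewal (at the start, for `n = 0`) is `ξ n m`, and
`𝒲 n`, `𝒵 n` are the entries of the copy of the replacement matrix that is used at the
`(n + 1)`-st renewal. -/
def urn (W₀ B₀ k : ℕ) (ξ : ℕ → ℕ → ℝ) (𝒲 𝒵 : ℕ → ℕ) : ℕ → UrnState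
  | 0 => ⟨W₀ + B₀, Finset.range W₀, ξ 0, 0⟩
  | n + 1 => (urn W₀ B₀ k ξ 𝒲 𝒵 n).step k (𝒲 n) (𝒵 n) (ξ (n + 1))

/-- The number of renewals up to time `t`. -/
def renewals (W₀ B₀ k : ℕ) (ξ : ℕ → ℕ → ℝ) (𝒲 𝒵 : ℕ → ℕ) (t : ℝ) : ℕ :=
  Set.ncard {n : ℕ | (urn W₀ B₀ k ξ 𝒲 𝒵 (n + 1)).time ≤ t}

/-- The urn at time `t`. -/
def urnAt (W₀ B₀ k : ℕ) (ξ : ℕ → ℕ → ℝ) (𝒲 𝒵 : ℕ → ℕ) (t : ℝ) : UrnState :=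
  urn W₀ B₀ k ξ 𝒲 𝒵 (renewals W₀ B₀ k ξ 𝒲 𝒵 t)

variable {Ω : Type*} [MeasurableSpace Ω]

/-- `W(t)`, the number of white balls in the Pólya process at time `t`. -/
def W (W₀ B₀ k : ℕ) (ξ : ℕ → ℕ → Ω → ℝ) (𝒲 𝒵 : ℕ → Ω → ℕ) (t : ℝ) (ω : Ω) : ℝ :=
  ((urnAt W₀ B₀ k (fun n m => ξ n m ω) (fun n => 𝒲 n ω) (fun n => 𝒵 n ω) t).whiteCount : ℝ)

/-- `B(t)`, the number of blue balls in the Pólya process at time `t`. -/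
def B (W₀ B₀ k : ℕ) (ξ : ℕ → ℕ → Ω → ℝ) (𝒲 𝒵 : ℕ → Ω → ℕ) (t : ℝ) (ω : Ω) : ℝ :=
  ((urnAt W₀ B₀ k (fun n m => ξ n m ω) (fun n => 𝒲 n ω) (fun n => 𝒵 n ω) t).blueCount : ℝ)

/-- The randomness that drives a Pólya process: independent `Exp(1)` clocks `ξ n m`, and,
independently of them, independent copies `(𝒲 n, 𝒵 n)` of the pair of random entries of the
replacement matrix, with joint law `ρ`. (The two entries of one copy may depend on each other.) -/
structure IsDriving (ρ : Measure (ℕ × ℕ)) (ξ : ℕ → ℕ → Ω → ℝ) (𝒲 𝒵 : ℕ → Ω → ℕ)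
    (P : Measure Ω) : Prop where
  measurable_clock : ∀ n m, Measurable (ξ n m)
  measurable_white : ∀ n, Measurable (𝒲 n)
  measurable_blue : ∀ n, Measurable (𝒵 n)
  law_clock : ∀ n m, HasLaw (ξ n m) (expMeasure 1) P
  law_entries : ∀ n, HasLaw (fun ω => (𝒲 n ω, 𝒵 n ω)) ρ P
  indep_clocks : iIndepFun (fun (q : ℕ × ℕ) ω => ξ q.1 q.2 ω) P
  indep_entries : iIndepFun (fun n ω => (𝒲 n ω, 𝒵 n ω)) P
  indep_clocks_entries :
    IndepFun (fun ω (q : ℕ × ℕ) => ξ q.1 q.2 ω) (fun ω n => (𝒲 n ω, 𝒵 n ω)) P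

/-- The mean `μ_𝒲` of the first entry under the joint law `ρ` of `(𝒲, 𝒵)`. -/
def meanW (ρ : Measure (ℕ × ℕ)) : ℝ := ∫ p, (p.1 : ℝ) ∂ρ

/-- The mean `μ_𝒵` of the second entry under the joint law `ρ` of `(𝒲, 𝒵)`. -/
def meanZ (ρ : Measure (ℕ × ℕ)) : ℝ := ∫ p, (p.2 : ℝ) ∂ρ

/-- The coefficient `M_{i,j}`; `(ascPochhammer ℝ n).eval x` is the rising factorial
`x (x + 1) ⋯ (x + n - 1)`. -/
def momentCoeff (τ₀ k : ℕ) (μW μZ : ℝ) (i j : ℕ) : ℝ :=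
  (k - μW) ^ j * (k - μZ) ^ i / (2 * k - μW - μZ) ^ (i + j) *
    (k : ℝ) ^ (i + j) * (ascPochhammer ℝ (i + j)).eval ((τ₀ : ℝ) / k)

/-- The gamma distribution `Gamma(a, θ)` with shape `a` and scale `θ`, hence with mean `a θ`.
(The second parameter of `gammaMeasure` is the rate.) -/
def gammaLaw (a θ : ℝ) (ha : 0 < a) (hθ : 0 < θ) : ProbabilityMeasure ℝ :=
  ⟨gammaMeasure a θ⁻¹, isProbabilityMeasure_gammaMeasure ha (inv_pos.2 hθ)⟩

end Polya

end

/-!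
The number of balls grows by `k` at every renewal, so an urn with `m` balls waits an `Exp(m)` time
for its next renewal, whatever the colours are. After a renewal all clocks are again independent
`Exp(1)` clocks, independent of the past (`map_renewClocks`, `IsDriving.map_stateOf`). Hence the
number of renewals up to time `t` has the negative binomial law `renewalProb` and is independent of
the chain of the colours (`lintegral_noRing_stateLaw`), and with `τ_n = τ₀ + k n`
`E f(N(t), colours) = ∑ n, renewalProb n t * E f(n, colours after n renewals)`
(`IsDriving.hasSum_integral_renewalCount`). The probabilities sum to one, so the urn does not
explode.

Write `a = k - μ_𝒲`, `c = k - μ_𝒵` and `Δ = a + c`. The coordinate `v = a w - c b = Δ w - c τ`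
satisfies `E v_{n+1} = (1 + (k - Δ) / τ_n) E v_n`, and
`E v_{n+1}² ≤ (1 + 2 (k - Δ) / τ_n) E v_n² + const`. Therefore `E v_n` is a multiple of the ratio
`⟨x + s⟩_n / ⟨x⟩_n` of rising factorials with `x = τ₀ / k` and `s = (k - Δ) / k`, and `E v_n²` is
bounded by such a ratio with `s = 1 + max (k - Δ) 0 / k`. By the binomial series, these ratios
average to exponentials under the negative binomial law: multiplied by `τ_n ^ p` they give
`k ^ p ⟨x + s⟩_p exp (k (s + p) t) + O(exp (k (s + p - 1) t))`
(`exists_tsum_risingRatio_pow`).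

Moments: since `Δ w = c τ + v` and `Δ b = a τ - v`, the product `Δ ^ N w ^ i b ^ j`, `N = i + j`,
is `c ^ i a ^ j τ ^ N + g τ ^ (N - 1) v + O(τ ^ (N - 2) v²)`. The three terms average to the leading
term, to `O(exp ((k N - Δ) t))`, and to the sum of the two error terms
(`exists_abs_average_sub_le`).

Limit law: `exp (-k t) v` tends to zero in mean square. The characteristic function of
`exp (-k t) τ(t)` is computed in closed form from the binomial series and tends to
`(1 - i u k) ^ (-x)`, the characteristic function of the gamma distribution
(`charFun_gammaMeasure`). Lévy's continuity theorem and Slutsky's theorem finish the proof. The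
Play-the-Winner scheme is the case `k = 1`.
-/

noncomputable section

namespace Polya

open scoped ENNReal

/-! ### The renewal of finitely many exponential clocks -/

section

/-- The label of the smallest of the numbers `c 0, …, c (m - 1)`, the least one in case of ties.
For the clocks of an urn this is `UrnState.ringing`. -/
def ringIdx (m : ℕ) (c : ℕ → ℝ) : ℕ := sInf {i | i < m ∧ ∀ l < m, c i ≤ c l}

/-- The remaining times of the clocks after the first of `c 0, …, c (m - 1)` has rung, if the
clocks with the labels `ringIdx m c` and `m, m + 1, …` are replaced by those of `x`. -/
def renewClocks (m : ℕ) (c x : ℕ → ℝ) : ℕ → ℝ := fun i =>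
  if i < m ∧ i ≠ ringIdx m c then c i - c (ringIdx m c) else x i

/-- The law of a sequence of independent `Exp(1)` clocks. -/
def clockLaw : Measure (ℕ → ℝ) := Measure.infinitePi fun _ => expMeasure 1

instance : IsProbabilityMeasure (expMeasure 1) := isProbabilityMeasure_expMeasure one_pos

instance : IsProbabilityMeasure clockLaw := by unfold clockLaw; infer_instance

lemma ringIdx_mem {m : ℕ} (hm : 0 < m) (c : ℕ → ℝ) :
    ringIdx m c < m ∧ ∀ l < m, c (ringIdx m c) ≤ c l := by
  have hne : {i | i < m ∧ ∀ l < m, c i ≤ c l}.Nonempty := by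
    obtain ⟨i, hi, h⟩ := Finset.exists_min_image (Finset.range m) c ⟨0, by simpa using hm⟩
    exact ⟨i, by simpa using hi, fun l hl => h l (by simpa using hl)⟩
  exact Nat.sInf_mem hne

/-- Ball `j` rings first; the strict inequalities come from the choice of the least label in case
of ties. -/
lemma ringIdx_eq_iff {m j : ℕ} (hj : j < m) (c : ℕ → ℝ) :
    ringIdx m c = j ↔ ∀ l ∈ (Finset.range m).erase j, if l < j then c j < c l else c j ≤ c l := by
  constructor
  · rintro rfl l hl
    simp only [Finset.mem_erase, Finset.mem_range] at hl
    have hmem := ringIdx_mem (lt_of_le_of_lt (Nat.zero_le _) hj) c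
    split_ifs with h
    · have := Nat.notMem_of_lt_sInf h
      simp only [Set.mem_ofPred_eq, not_and, not_forall, not_le] at this
      obtain ⟨l', hl', h'⟩ := this hl.2
      exact (hmem.2 l' hl').trans_lt h'
    · exact hmem.2 l hl.2
  · intro h
    have hmem := ringIdx_mem (lt_of_le_of_lt (Nat.zero_le _) hj) c
    have hle : ∀ l < m, c j ≤ c l := by
      intro l hl
      by_cases hlj : l = j
      · rw [hlj]
      have := h l (by simp [hlj, hl])
      split_ifs at this
      exacts [this.le, this]
    refine le_antisymm (Nat.sInf_le ⟨hj, hle⟩) ?_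
    by_contra! hlt
    have := h (ringIdx m c) (by simp [hlt.ne, hmem.1])
    rw [if_pos hlt] at this
    exact absurd (hmem.2 j hj) (not_le.2 this)

lemma measurable_ringIdx (m : ℕ) : Measurable (ringIdx m) := by
  rcases Nat.eq_zero_or_pos m with rfl | hm
  · have : ringIdx 0 = fun _ => 0 := by funext c; simp [ringIdx]
    rw [this]; exact measurable_const
  refine measurable_to_countable' fun j => ?_
  by_cases hj : j < m
  · have : ringIdx m ⁻¹' {j} = ⋂ l ∈ (Finset.range m).erase j,
        {c : ℕ → ℝ | if l < j then c j < c l else c j ≤ c l} := by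
      ext c
      simp only [Set.mem_preimage, Set.mem_singleton_iff, ringIdx_eq_iff hj, Set.mem_iInter]
      rfl
    rw [this]
    refine Finset.measurableSet_biInter _ fun l _ => ?_
    split_ifs
    · exact measurableSet_lt (measurable_pi_apply _) (measurable_pi_apply _)
    · exact measurableSet_le (measurable_pi_apply _) (measurable_pi_apply _)
  · convert! MeasurableSet.empty
    ext c
    simp only [Set.mem_preimage, Set.mem_singleton_iff, Set.mem_empty_iff_false, iff_false]
    rintro rfl
    exact hj (ringIdx_mem hm c).1

lemma measurable_clock_ringIdx (m : ℕ) : Measurable fun c : ℕ → ℝ => c (ringIdx m c) := by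
  have h : Measurable fun p : (ℕ → ℝ) × ℕ => p.1 p.2 :=
    measurable_from_prod_countable_left fun n => measurable_pi_apply n
  exact h.comp (measurable_id.prodMk (measurable_ringIdx m))

lemma measurable_renewClocks (m : ℕ) :
    Measurable fun p : (ℕ → ℝ) × (ℕ → ℝ) => renewClocks m p.1 p.2 := by
  refine measurable_pi_lambda _ fun i => ?_
  unfold renewClocks
  have h1 : MeasurableSet {p : (ℕ → ℝ) × (ℕ → ℝ) | i < m ∧ i ≠ ringIdx m p.1} := by
    have : Measurable fun p : (ℕ → ℝ) × (ℕ → ℝ) => ringIdx m p.1 :=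
      (measurable_ringIdx m).comp measurable_fst
    exact (MeasurableSet.const _).inter (measurableSet_eq_fun measurable_const this).compl
  refine Measurable.ite h1 ?_ ?_
  · exact ((measurable_pi_apply i).comp measurable_fst).sub
      ((measurable_clock_ringIdx m).comp measurable_fst)
  · exact (measurable_pi_apply i).comp measurable_snd

lemma expMeasure_one_eq :
    expMeasure 1 = (volume.restrict (Set.Ioi 0)).withDensity
      fun y : ℝ => ENNReal.ofReal (Real.exp (-y)) := by
  have h1 : expMeasure 1 = volume.withDensity
      ((Set.Ici (0:ℝ)).indicator fun y : ℝ => ENNReal.ofReal (Real.exp (-y))) := by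
    unfold expMeasure gammaMeasure
    congr 1
    funext y
    change exponentialPDF 1 y = _
    rw [exponentialPDF_eq, Set.indicator_apply]
    by_cases hy : 0 ≤ y
    · simp [hy]
    · simp [hy]
  rw [h1, withDensity_indicator measurableSet_Ici, restrict_Ioi_eq_restrict_Ici]

lemma lintegral_expMeasure_one {f : ℝ → ℝ≥0∞} (hf : Measurable f) :
    ∫⁻ y, f y ∂(expMeasure 1) = ∫⁻ y in Set.Ioi 0, ENNReal.ofReal (Real.exp (-y)) * f y := by
  rw [expMeasure_one_eq, lintegral_withDensity_eq_lintegral_mul _ (by fun_prop) hf]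
  rfl

/-- The exponential distribution has no memory. -/
lemma expMeasure_one_shift {y : ℝ} (hy : 0 ≤ y) {B : Set ℝ} (hB : MeasurableSet B) :
    expMeasure 1 {x | y < x ∧ x - y ∈ B} = ENNReal.ofReal (Real.exp (-y)) * expMeasure 1 B := by
  have hm : MeasurableSet {x | y < x ∧ x - y ∈ B} :=
    (measurableSet_lt measurable_const measurable_id).inter
      ((measurable_id.sub_const y) hB)
  rw [← lintegral_indicator_one hm, ← lintegral_indicator_one hB,
    lintegral_expMeasure_one (measurable_one.indicator hm),
    lintegral_expMeasure_one (measurable_one.indicator hB),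
    ← lintegral_const_mul _ (by
      exact (Measurable.mul (by fun_prop) (measurable_one.indicator hB))),
    ← lintegral_indicator measurableSet_Ioi, ← lintegral_indicator measurableSet_Ioi,
    ← lintegral_add_right_eq_self _ y]
  refine lintegral_congr fun x => ?_
  have hB' : Set.indicator {x | y < x ∧ x - y ∈ B} (1 : ℝ → ℝ≥0∞) (x + y) =
      (Set.Ioi 0).indicator 1 x * B.indicator 1 x := by
    by_cases h0 : 0 < x <;> by_cases h1 : x ∈ B <;> simp [Set.indicator, h0, h1]
  by_cases hx : 0 < x
  · have : 0 < x + y := by linarith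
    rw [Set.indicator_of_mem (Set.mem_Ioi.2 this), Set.indicator_of_mem (Set.mem_Ioi.2 hx), hB',
      Set.indicator_of_mem (Set.mem_Ioi.2 hx), neg_add, Real.exp_add,
      ENNReal.ofReal_mul (Real.exp_pos _).le, Pi.one_apply]
    ring
  · rw [Set.indicator_of_notMem (s := Set.Ioi 0) (a := x) (by simpa using hx)]
    rw [Set.indicator_apply]
    split_ifs
    · rw [hB', Set.indicator_of_notMem (by simpa using hx)]; simp
    · rfl

lemma expMeasure_one_shift' {y : ℝ} (hy : 0 ≤ y) {B : Set ℝ} (hB : MeasurableSet B) :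
    expMeasure 1 {x | y ≤ x ∧ x - y ∈ B} = ENNReal.ofReal (Real.exp (-y)) * expMeasure 1 B := by
  rw [← expMeasure_one_shift hy hB]
  refine measure_congr ?_
  have h0 : expMeasure 1 {y} = 0 := by
    rw [expMeasure_one_eq]
    exact (withDensity_absolutelyContinuous _ _) (by simp)
  have : ∀ᵐ x ∂(expMeasure 1), x ≠ y := by
    rw [ae_iff]; simpa using h0
  filter_upwards [this] with x hx
  apply propext
  change (y ≤ x ∧ x - y ∈ B) ↔ (y < x ∧ x - y ∈ B)
  rw [le_iff_lt_or_eq]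
  simp [hx.symm]

/-- The measure `e^{-m y} dy` on `(0, ∞)`. -/
def expDens (m : ℕ) : Measure ℝ :=
  (volume.restrict (Set.Ioi 0)).withDensity fun y => ENNReal.ofReal (Real.exp (-(m * y)))

lemma expDens_Ioi {m : ℕ} (hm : 0 < m) {x : ℝ} (hx : 0 ≤ x) :
    expDens m (Set.Ioi x) = ENNReal.ofReal (Real.exp (-(m * x)) / m) := by
  have hm' : (0:ℝ) < m := Nat.cast_pos.2 hm
  rw [expDens, withDensity_apply _ measurableSet_Ioi, Measure.restrict_restrict measurableSet_Ioi,
    Set.Ioi_inter_Ioi, max_eq_left hx, ← ofReal_integral_eq_lintegral_ofReal]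
  · have h := integral_exp_mul_Ioi (neg_lt_zero.2 hm') x
    simp only [neg_mul] at h
    rw [h, neg_div_neg_eq]
  · simpa only [neg_mul, IntegrableOn] using integrableOn_exp_mul_Ioi (neg_lt_zero.2 hm') x
  · exact Eventually.of_forall fun _ => (Real.exp_pos _).le

instance (m : ℕ) : SFinite (expDens m) := by unfold expDens; infer_instance

lemma expDens_apply (m : ℕ) {H : Set ℝ} (hH : MeasurableSet H) :
    expDens m H = ∫⁻ y in Set.Ioi 0, ENNReal.ofReal (Real.exp (-(m * y))) * H.indicator 1 y := by
  rw [← lintegral_indicator_one hH, expDens,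
    lintegral_withDensity_eq_lintegral_mul _ (by fun_prop) (measurable_one.indicator hH)]
  rfl

/-- The ringing clock `j`, its waiting time and the residual times of the other clocks are
independent: condition on the clock `j` and use that the others have no memory. -/
lemma clockLaw_ring_event {m j : ℕ} (hj : j < m) {H : Set ℝ} (hH : MeasurableSet H)
    {U : ℕ → Set ℝ} (hU : ∀ i, MeasurableSet (U i)) :
    clockLaw {c | c j ∈ H ∧ ∀ l ∈ (Finset.range m).erase j,
        (if l < j then c j < c l else c j ≤ c l) ∧ c l - c j ∈ U l} =
      expDens m H * ∏ l ∈ (Finset.range m).erase j, expMeasure 1 (U l) := by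
  set I := (Finset.range m).erase j with hI
  have hind : iIndepFun (fun i (c : ℕ → ℝ) => c i) clockLaw :=
    iIndepFun_infinitePi (X := fun _ x => x) fun _ => measurable_id
  have hpair : IndepFun (fun c : ℕ → ℝ => c j) (fun c : ℕ → ℝ => I.restrict c) clockLaw := by
    have := hind.indepFun_finset {j} I (by simp [hI]) fun i => measurable_pi_apply i
    exact this.comp (φ := fun x : ({j} : Finset ℕ) → ℝ => x ⟨j, by simp⟩) (ψ := id)
      (measurable_pi_apply _) measurable_id
  have hlaw : clockLaw.map (fun c => (c j, I.restrict c)) =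
      (expMeasure 1).prod (Measure.pi fun _ : I => expMeasure 1) := by
    rw [(indepFun_iff_map_prod_eq_prod_map_map (measurable_pi_apply j).aemeasurable
      (by fun_prop)).1 hpair]
    congr 1
    · exact Measure.infinitePi_map_eval _ j
    · exact Measure.infinitePi_map_restrict _
  let D : ℕ → ℝ → Set ℝ := fun l y => {x | (if l < j then y < x else y ≤ x) ∧ x - y ∈ U l}
  let E : Set (ℝ × (I → ℝ)) := {p | p.1 ∈ H ∧ ∀ l : I, p.2 l ∈ D l p.1}
  have hE : MeasurableSet E := by
    refine (measurable_fst hH).inter ?_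
    have : {p : ℝ × (I → ℝ) | ∀ l : I, p.2 l ∈ D l p.1} =
        ⋂ l : I, {p : ℝ × (I → ℝ) | p.2 l ∈ D l p.1} := by ext; simp
    change MeasurableSet {p : ℝ × (I → ℝ) | ∀ l : I, p.2 l ∈ D l p.1}
    rw [this]
    refine MeasurableSet.iInter fun l => ?_
    have hl : Measurable fun p : ℝ × (I → ℝ) => p.2 l :=
      (measurable_pi_apply l).comp measurable_snd
    refine MeasurableSet.inter ?_ ((hl.sub measurable_fst) (hU l))
    change MeasurableSet {p : ℝ × (I → ℝ) | if (l : ℕ) < j then p.1 < p.2 l else p.1 ≤ p.2 l}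
    split_ifs
    · exact measurableSet_lt measurable_fst hl
    · exact measurableSet_le measurable_fst hl
  have hset : {c : ℕ → ℝ | c j ∈ H ∧ ∀ l ∈ I,
      (if l < j then c j < c l else c j ≤ c l) ∧ c l - c j ∈ U l} =
      (fun c : ℕ → ℝ => (c j, I.restrict c)) ⁻¹' E := by
    ext c
    simp [E, D, Finset.restrict]
  have hD : ∀ l, ∀ y : ℝ, 0 < y →
      expMeasure 1 (D l y) = ENNReal.ofReal (Real.exp (-y)) * expMeasure 1 (U l) := by
    intro l y hy
    by_cases h : l < j
    · simpa [D, h] using expMeasure_one_shift hy.le (hU l)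
    · simpa [D, h] using expMeasure_one_shift' hy.le (hU l)
  have hcard : I.card + 1 = m := by
    rw [hI, Finset.card_erase_of_mem (by simpa using hj), Finset.card_range]
    omega
  have hsec : ∀ y : ℝ, Measure.pi (fun _ : I => expMeasure 1) (Prod.mk y ⁻¹' E) =
      H.indicator 1 y * ∏ l ∈ I, expMeasure 1 (D l y) := by
    intro y
    by_cases hy : y ∈ H
    · have : Prod.mk y ⁻¹' E = Set.univ.pi fun l : I => D l y := by
        ext z; simp [E, hy]
      rw [this, Measure.pi_pi, Set.indicator_of_mem hy, Pi.one_apply, one_mul,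
        Finset.prod_coe_sort I fun l => expMeasure 1 (D l y)]
    · have : Prod.mk y ⁻¹' E = ∅ := by
        ext z; simp [E, hy]
      rw [this, measure_empty, Set.indicator_of_notMem hy, zero_mul]
  have hmeas := measurable_measure_prodMk_left (ν := Measure.pi fun _ : I => expMeasure 1) hE
  rw [hset, ← Measure.map_apply (by fun_prop) hE, hlaw, Measure.prod_apply hE,
    lintegral_expMeasure_one hmeas, expDens_apply m hH, ← lintegral_mul_const _ (by
      exact (Measurable.mul (by fun_prop) (measurable_one.indicator hH)))]
  refine setLIntegral_congr_fun measurableSet_Ioi fun y hy => ?_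
  rw [hsec, Finset.prod_congr rfl fun l _ => hD l y hy, Finset.prod_mul_distrib,
    Finset.prod_const, ← ENNReal.ofReal_pow (Real.exp_pos _).le, ← Real.exp_nat_mul]
  have : Real.exp (-(m * y)) = Real.exp (-y) * Real.exp (I.card * -y) := by
    rw [← Real.exp_add, ← hcard]; congr 1; push_cast; ring
  rw [this, ENNReal.ofReal_mul (Real.exp_pos _).le]
  ring

/-- The joint law of the label of the ringing clock and of the waiting time until it rings,
for `m` independent `Exp(1)` clocks. -/
def ringLaw (m : ℕ) : Measure (ℕ × ℝ) :=
  ∑ j ∈ Finset.range m, (expDens m).map (Prod.mk j)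

lemma ringLaw_apply (m : ℕ) {S : Set (ℕ × ℝ)} (hS : MeasurableSet S) :
    ringLaw m S = ∑ j ∈ Finset.range m, expDens m (Prod.mk j ⁻¹' S) := by
  rw [ringLaw, Measure.finsetSum_apply]
  exact Finset.sum_congr rfl fun j _ => Measure.map_apply measurable_prodMk_left hS

lemma lintegral_ringLaw (m : ℕ) {f : ℕ × ℝ → ℝ≥0∞} (hf : Measurable f) :
    ∫⁻ q, f q ∂(ringLaw m) = ∑ j ∈ Finset.range m, ∫⁻ y, f (j, y) ∂(expDens m) := by
  rw [ringLaw, lintegral_finsetSum_measure]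
  exact Finset.sum_congr rfl fun j _ => lintegral_map hf measurable_prodMk_left

lemma lintegral_expDens (m : ℕ) {f : ℝ → ℝ≥0∞} (hf : Measurable f) :
    ∫⁻ y, f y ∂(expDens m) =
      ∫⁻ y in Set.Ioi 0, ENNReal.ofReal (Real.exp (-(m * y))) * f y := by
  rw [expDens, lintegral_withDensity_eq_lintegral_mul _ (by fun_prop) hf]
  rfl

lemma expDens_univ {m : ℕ} (hm : 0 < m) : expDens m Set.univ = ENNReal.ofReal (1 / m) := by
  have h : expDens m (Set.Iic 0) = 0 := by
    refine (withDensity_absolutelyContinuous _ _) ?_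
    rw [Measure.restrict_apply measurableSet_Iic, Set.Iic_inter_Ioi, Set.Ioc_self, measure_empty]
  have h2 := measure_union (μ := expDens m) (Set.Iic_disjoint_Ioi (le_refl (0:ℝ))) measurableSet_Ioi
  rw [Set.Iic_union_Ioi, h, expDens_Ioi hm le_rfl, zero_add] at h2
  simpa using h2

lemma ringLaw_univ {m : ℕ} (hm : 0 < m) : ringLaw m Set.univ = 1 := by
  have hm' : (0:ℝ) < m := Nat.cast_pos.2 hm
  rw [ringLaw_apply m MeasurableSet.univ]
  have h : ∀ j : ℕ, Prod.mk j ⁻¹' (Set.univ : Set (ℕ × ℝ)) = Set.univ := fun _ => rfl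
  simp only [h, expDens_univ hm, Finset.sum_const, Finset.card_range, nsmul_eq_mul]
  rw [← ENNReal.ofReal_natCast, ← ENNReal.ofReal_mul hm'.le, mul_one_div_cancel hm'.ne',
    ENNReal.ofReal_one]

lemma isProbabilityMeasure_ringLaw {m : ℕ} (hm : 0 < m) : IsProbabilityMeasure (ringLaw m) :=
  ⟨ringLaw_univ hm⟩

/-- The renewed clocks on a measurable rectangle: the coordinates in `I` are residual times of
old clocks, all the others are fresh. -/
lemma clockLaw_renew_event {m j : ℕ} (hj : j < m) {H : Set ℝ} (hH : MeasurableSet H)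
    (s : Finset ℕ) {t : ℕ → Set ℝ} (ht : ∀ i, MeasurableSet (t i)) :
    (clockLaw.prod clockLaw) {p | ringIdx m p.1 = j ∧ p.1 j ∈ H ∧
        renewClocks m p.1 p.2 ∈ (s : Set ℕ).pi t} =
      expDens m H * clockLaw ((s : Set ℕ).pi t) := by
  classical
  let U : ℕ → Set ℝ := fun i => if i ∈ s then t i else Set.univ
  have hU : ∀ i, MeasurableSet (U i) := fun i => by
    by_cases h : i ∈ s
    · simpa [U, h] using ht i
    · simp [U, h]
  let I := (Finset.range m).erase j
  let s' := s \ I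
  have hset : {p : (ℕ → ℝ) × (ℕ → ℝ) | ringIdx m p.1 = j ∧ p.1 j ∈ H ∧
        renewClocks m p.1 p.2 ∈ (s : Set ℕ).pi t} =
      {c | c j ∈ H ∧ ∀ l ∈ I, (if l < j then c j < c l else c j ≤ c l) ∧ c l - c j ∈ U l} ×ˢ
        ((s' : Set ℕ).pi t) := by
    ext ⟨c, x⟩
    simp only [Set.mem_ofPred_eq, Set.mem_prod]
    constructor
    · rintro ⟨h1, h2, h3⟩
      have h1' := (ringIdx_eq_iff hj c).1 h1
      refine ⟨⟨h2, fun l hl => ⟨h1' l hl, ?_⟩⟩, fun l hl => ?_⟩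
      · by_cases hls : l ∈ s
        · have := h3 l hls
          simp only [I, Finset.mem_erase, Finset.mem_range] at hl
          simpa [U, hls, renewClocks, h1, hl.1, hl.2] using this
        · simp [U, hls]
      · simp only [s', Finset.coe_sdiff, Set.mem_sdiff, Finset.mem_coe] at hl
        have := h3 l hl.1
        have hn : ¬ (l < m ∧ l ≠ j) := fun h => hl.2 (by simp [I, h.1, h.2])
        rwa [renewClocks, h1, if_neg hn] at this
    · rintro ⟨⟨h2, h4⟩, h3⟩
      have h1 := (ringIdx_eq_iff hj c).2 fun l hl => (h4 l hl).1
      refine ⟨h1, h2, fun l hl => ?_⟩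
      have hl' : l ∈ s := hl
      rw [renewClocks, h1]
      split_ifs with h
      · have := (h4 l (by simp [I, h.1, h.2])).2
        simpa [U, hl'] using this
      · exact h3 l (by
          simp only [s', Finset.coe_sdiff, Set.mem_sdiff, Finset.mem_coe]
          exact ⟨hl', fun hI => h (by simpa [I, and_comm] using hI)⟩)
  rw [hset, Measure.prod_prod, clockLaw_ring_event hj hH hU, mul_assoc, clockLaw,
    Measure.infinitePi_pi _ (fun i _ => ht i), Measure.infinitePi_pi _ (fun i _ => ht i)]
  congr 1
  have e1 : ∏ i ∈ s', expMeasure 1 (t i) = ∏ i ∈ s', expMeasure 1 (U i) :=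
    Finset.prod_congr rfl fun i hi => by simp [U, (Finset.mem_sdiff.1 hi).1]
  have e2 : ∏ i ∈ s, expMeasure 1 (t i) = ∏ i ∈ s, expMeasure 1 (U i) :=
    Finset.prod_congr rfl fun i hi => by simp [U, hi]
  rw [e1, e2, mul_comm, ← Finset.prod_union Finset.sdiff_disjoint, Finset.sdiff_union_self_eq_union]
  refine (Finset.prod_subset Finset.subset_union_left fun i _ hi => ?_).symm
  simp [U, hi]

/-- When the first of `m` independent `Exp(1)` clocks rings and is replaced by a fresh one, the
clocks are again independent and `Exp(1)`, and they are independent of the label of the clock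
that rang and of the waiting time. -/
theorem map_renewClocks {m : ℕ} (hm : 0 < m) :
    (clockLaw.prod clockLaw).map
        (fun p => ((ringIdx m p.1, p.1 (ringIdx m p.1)), renewClocks m p.1 p.2)) =
      (ringLaw m).prod clockLaw := by
  have := isProbabilityMeasure_ringLaw hm
  have hmeas : Measurable fun p : (ℕ → ℝ) × (ℕ → ℝ) =>
      ((ringIdx m p.1, p.1 (ringIdx m p.1)), renewClocks m p.1 p.2) :=
    ((((measurable_ringIdx m).comp measurable_fst).prodMk
      ((measurable_clock_ringIdx m).comp measurable_fst))).prodMk (measurable_renewClocks m)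
  symm
  refine Measure.prod_eq_generateFrom (C := {s | MeasurableSet s})
    (D := squareCylinders fun _ : ℕ => {s : Set ℝ | MeasurableSet s})
    MeasurableSpace.generateFrom_measurableSet generateFrom_squareCylinders
    MeasurableSpace.isPiSystem_measurableSet
    (isPiSystem_squareCylinders (fun _ => MeasurableSpace.isPiSystem_measurableSet)
      fun _ => by simp)
    ⟨fun _ => Set.univ, fun _ => by simp, fun _ => measure_lt_top _ _, Set.iUnion_const _⟩
    ⟨fun _ => Set.univ, fun _ => ⟨∅, fun _ => Set.univ, fun _ _ => by simp, by simp⟩,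
      fun _ => measure_lt_top _ _, Set.iUnion_const _⟩ ?_
  rintro S hS _ ⟨s, t, ht, rfl⟩
  have hS : MeasurableSet S := hS
  have ht : ∀ i, MeasurableSet (t i) := fun i => ht i (Set.mem_univ i)
  have hcyl : MeasurableSet ((s : Set ℕ).pi t) :=
    MeasurableSet.pi s.countable_toSet fun i _ => ht i
  rw [Measure.map_apply hmeas (hS.prod hcyl), ringLaw_apply m hS, Finset.sum_mul]
  have hH : ∀ j : ℕ, MeasurableSet (Prod.mk j ⁻¹' S) := fun j => measurable_prodMk_left hS
  have hset : (fun p : (ℕ → ℝ) × (ℕ → ℝ) =>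
        ((ringIdx m p.1, p.1 (ringIdx m p.1)), renewClocks m p.1 p.2)) ⁻¹' S ×ˢ (s : Set ℕ).pi t =
      ⋃ j ∈ Finset.range m, {p | ringIdx m p.1 = j ∧ p.1 j ∈ Prod.mk j ⁻¹' S ∧
        renewClocks m p.1 p.2 ∈ (s : Set ℕ).pi t} := by
    ext p
    simp only [Set.mem_preimage, Set.mem_prod, Set.mem_iUnion, Finset.mem_range, exists_prop,
      Set.mem_ofPred_eq]
    constructor
    · rintro ⟨h1, h2⟩
      exact ⟨_, (ringIdx_mem hm p.1).1, rfl, h1, h2⟩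
    · rintro ⟨j, _, rfl, h1, h2⟩
      exact ⟨h1, h2⟩
  rw [hset, measure_biUnion_finset]
  · exact Finset.sum_congr rfl fun j hj =>
      clockLaw_renew_event (Finset.mem_range.1 hj) (hH j) s ht
  · intro i _ j _ hij
    rw [Function.onFun, Set.disjoint_left]
    rintro p ⟨h1, -⟩ ⟨h2, -⟩
    exact hij (h1.symm.trans h2)
  · intro j _
    refine MeasurableSet.inter (((measurable_ringIdx m).comp measurable_fst)
      (measurableSet_singleton j)) (MeasurableSet.inter ?_ (measurable_renewClocks m hcyl))
    have hj : Measurable fun p : (ℕ → ℝ) × (ℕ → ℝ) => p.1 j :=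
      (measurable_pi_apply j).comp measurable_fst
    exact hj (hH j)

lemma map_ring {m : ℕ} (hm : 0 < m) :
    clockLaw.map (fun c => (ringIdx m c, c (ringIdx m c))) = ringLaw m := by
  have h := congrArg (Measure.map Prod.fst) (map_renewClocks hm)
  have := isProbabilityMeasure_ringLaw hm
  have hr : Measurable fun c : ℕ → ℝ => (ringIdx m c, c (ringIdx m c)) :=
    (measurable_ringIdx m).prodMk (measurable_clock_ringIdx m)
  have hmeas : Measurable fun p : (ℕ → ℝ) × (ℕ → ℝ) =>
      ((ringIdx m p.1, p.1 (ringIdx m p.1)), renewClocks m p.1 p.2) :=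
    (hr.comp measurable_fst).prodMk (measurable_renewClocks m)
  rw [Measure.map_map measurable_fst hmeas, Measure.map_fst_prod, measure_univ, one_smul] at h
  rw [← h]
  change _ = Measure.map ((fun c : ℕ → ℝ => (ringIdx m c, c (ringIdx m c))) ∘ Prod.fst) _
  rw [← Measure.map_map hr measurable_fst, Measure.map_fst_prod, measure_univ, one_smul]

/-- The first of `m` independent `Exp(1)` clocks rings after an `Exp(m)` time. -/
lemma clockLaw_waiting {m : ℕ} (hm : 0 < m) {x : ℝ} (hx : 0 ≤ x) :
    clockLaw {c | x < c (ringIdx m c)} = ENNReal.ofReal (Real.exp (-(m * x))) := by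
  have hm' : (0:ℝ) < m := Nat.cast_pos.2 hm
  have hr : Measurable fun c : ℕ → ℝ => (ringIdx m c, c (ringIdx m c)) :=
    (measurable_ringIdx m).prodMk (measurable_clock_ringIdx m)
  have hS : MeasurableSet (Prod.snd ⁻¹' Set.Ioi x : Set (ℕ × ℝ)) := measurable_snd measurableSet_Ioi
  change clockLaw ((fun c : ℕ → ℝ => (ringIdx m c, c (ringIdx m c))) ⁻¹'
    (Prod.snd ⁻¹' Set.Ioi x)) = _
  rw [← Measure.map_apply hr hS, map_ring hm, ringLaw_apply m hS]
  have : ∀ j : ℕ, Prod.mk j ⁻¹' (Prod.snd ⁻¹' Set.Ioi x : Set (ℕ × ℝ)) = Set.Ioi x := fun j => rfl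
  simp only [this, expDens_Ioi hm hx, Finset.sum_const, Finset.card_range, nsmul_eq_mul]
  rw [← ENNReal.ofReal_natCast, ← ENNReal.ofReal_mul hm'.le, mul_div_cancel₀ _ hm'.ne']

end

/-! ### The law of the urn after `n` renewals -/

section

/-- The countably many finite sets of labels carry the discrete σ-algebra. -/
instance : MeasurableSpace (Finset ℕ) := ⊤

instance : DiscreteMeasurableSpace (Finset ℕ) := ⟨fun _ => trivial⟩

/-- The labels of the white balls after a renewal of an urn with `m` balls whose white balls have
the labels in `A`, if ball `j` is picked and `e` is the pair of random entries that is drawn. -/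
def addWhite (k m : ℕ) (A : Finset ℕ) (e : ℕ × ℕ) (j : ℕ) : Finset ℕ :=
  A ∪ Finset.Ico m (m + if j ∈ A then e.1 else k - e.2)

/-- The effect of a renewal on the time of the latest renewal and on the labels of the white
balls; `q` consists of the label of the picked ball and the waiting time. -/
def nextState (k m : ℕ) (z : (ℝ × Finset ℕ) × (ℕ × ℕ)) (q : ℕ × ℝ) : ℝ × Finset ℕ :=
  (z.1.1 + q.2, addWhite k m z.1.2 z.2 q.1)

lemma measurable_nextState (k m : ℕ) : Measurable (Function.uncurry (nextState k m)) := by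
  have h1 : Measurable fun x : ((ℝ × Finset ℕ) × (ℕ × ℕ)) × (ℕ × ℝ) => x.1.1.1 + x.2.2 := by
    fun_prop
  have h2 : Measurable fun x : ((ℝ × Finset ℕ) × (ℕ × ℕ)) × (ℕ × ℝ) => x.1.1.2 := by fun_prop
  have h3 : Measurable fun x : ((ℝ × Finset ℕ) × (ℕ × ℕ)) × (ℕ × ℝ) => x.1.2 := by fun_prop
  have h4 : Measurable fun x : ((ℝ × Finset ℕ) × (ℕ × ℕ)) × (ℕ × ℝ) => x.2.1 := by fun_prop
  have h5 : Measurable fun y : Finset ℕ × ((ℕ × ℕ) × ℕ) => addWhite k m y.1 y.2.1 y.2.2 :=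
    Measurable.of_discrete
  have h6 := h5.comp (h2.prodMk (h3.prodMk h4))
  exact h1.prodMk h6

/-- The joint law of the time of the `n`-th renewal and of the set of white balls after it. -/
def stateLaw (W₀ B₀ k : ℕ) (ρ : Measure (ℕ × ℕ)) : ℕ → Measure (ℝ × Finset ℕ)
  | 0 => Measure.dirac (0, Finset.range W₀)
  | n + 1 => (((stateLaw W₀ B₀ k ρ n).prod ρ).prod (ringLaw (W₀ + B₀ + k * n))).map
      (Function.uncurry (nextState k (W₀ + B₀ + k * n)))

variable {W₀ B₀ k : ℕ}

lemma isProbabilityMeasure_stateLaw (hτ : 0 < W₀ + B₀) (ρ : Measure (ℕ × ℕ))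
    [IsProbabilityMeasure ρ] (n : ℕ) : IsProbabilityMeasure (stateLaw W₀ B₀ k ρ n) := by
  induction n with
  | zero => unfold stateLaw; infer_instance
  | succ n ih =>
    have := isProbabilityMeasure_ringLaw (m := W₀ + B₀ + k * n) (by omega)
    exact Measure.isProbabilityMeasure_map (measurable_nextState _ _).aemeasurable

lemma balls_urn (W₀ B₀ k : ℕ) (ξ : ℕ → ℕ → ℝ) (𝒲 𝒵 : ℕ → ℕ) (n : ℕ) :
    (urn W₀ B₀ k ξ 𝒲 𝒵 n).balls = W₀ + B₀ + k * n := by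
  induction n with
  | zero => simp [urn]
  | succ n ih => simp only [urn, UrnState.step, ih]; ring

/-- The time of the latest renewal, the white balls and the clocks of an urn. -/
def stateOf (S : UrnState) : (ℝ × Finset ℕ) × (ℕ → ℝ) := ((S.time, S.white), S.clock)

/-- One renewal of an urn with `m` balls, in terms of `stateOf`. -/
def renewMap (k m : ℕ) (p : ((ℝ × Finset ℕ) × (ℕ → ℝ)) × ((ℕ → ℝ) × (ℕ × ℕ))) :
    (ℝ × Finset ℕ) × (ℕ → ℝ) :=
  (nextState k m (p.1.1, p.2.2) (ringIdx m p.1.2, p.1.2 (ringIdx m p.1.2)),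
    renewClocks m p.1.2 p.2.1)

lemma measurable_renewMap (k m : ℕ) : Measurable (renewMap k m) := by
  have hr : Measurable fun c : ℕ → ℝ => (ringIdx m c, c (ringIdx m c)) :=
    (measurable_ringIdx m).prodMk (measurable_clock_ringIdx m)
  refine Measurable.prodMk ?_ ?_
  · exact (measurable_nextState k m).comp (((measurable_fst.comp measurable_fst).prodMk
      (measurable_snd.comp measurable_snd)).prodMk
        (hr.comp (measurable_snd.comp measurable_fst)))
  · exact (measurable_renewClocks m).comp ((measurable_snd.comp measurable_fst).prodMk
      (measurable_fst.comp measurable_snd))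

lemma stateOf_urn_succ (ξ : ℕ → ℕ → ℝ) (𝒲 𝒵 : ℕ → ℕ) (n : ℕ) :
    stateOf (urn W₀ B₀ k ξ 𝒲 𝒵 (n + 1)) = renewMap k (W₀ + B₀ + k * n)
      (stateOf (urn W₀ B₀ k ξ 𝒲 𝒵 n), (ξ (n + 1), (𝒲 n, 𝒵 n))) := by
  rw [← balls_urn W₀ B₀ k ξ 𝒲 𝒵 n]
  rfl

section Tonelli

variable {α β γ δ : Type*} [MeasurableSpace α] [MeasurableSpace β] [MeasurableSpace γ]
  [MeasurableSpace δ]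

lemma lintegral_prod_prod (A : Measure α) (B : Measure β) (C : Measure γ) (D : Measure δ)
    [SFinite A] [SFinite B] [SFinite C] [SFinite D] {F : (α × β) × (γ × δ) → ℝ≥0∞}
    (hF : Measurable F) :
    ∫⁻ z, F z ∂((A.prod B).prod (C.prod D)) = ∫⁻ a, ∫⁻ b, ∫⁻ c, ∫⁻ d, F ((a, b), (c, d)) ∂D ∂C ∂B ∂A := by
  rw [lintegral_prod _ hF.aemeasurable, lintegral_prod _ (hF.lintegral_prod_right').aemeasurable]
  refine lintegral_congr fun a => lintegral_congr fun b => ?_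
  exact lintegral_prod _ (hF.comp measurable_prodMk_left).aemeasurable

/-- Product measures are invariant under the permutation of the factors that brings the clocks of
the urn next to the fresh ones. -/
lemma map_prod_perm (A : Measure α) (B : Measure β) (C : Measure γ) (D : Measure δ)
    [SFinite A] [SFinite B] [SFinite C] [SFinite D] :
    ((A.prod D).prod (B.prod C)).map (fun y => ((y.1.1, y.2.1), (y.2.2, y.1.2))) =
      (A.prod B).prod (C.prod D) := by
  have hp : Measurable fun y : (α × δ) × (β × γ) => ((y.1.1, y.2.1), (y.2.2, y.1.2)) := by fun_prop
  refine Measure.ext_of_lintegral _ fun F hF => ?_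
  have hFp := hF.comp hp
  rw [lintegral_map hF hp, lintegral_prod_prod A B C D hF]
  refine (lintegral_prod_prod A D B C hFp).trans (lintegral_congr fun a => ?_)
  simp only [Function.comp_apply]
  have h1 : Measurable fun x : (δ × β) × γ => F ((a, x.1.2), (x.2, x.1.1)) :=
    hF.comp (by fun_prop)
  have h2 : Measurable fun x : (β × δ) × γ => F ((a, x.1.1), (x.2, x.1.2)) :=
    hF.comp (by fun_prop)
  rw [lintegral_lintegral_swap (h1.lintegral_prod_right').aemeasurable]
  refine lintegral_congr fun b => ?_
  exact lintegral_lintegral_swap (f := fun d c => F ((a, b), (c, d)))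
    (hF.comp (by fun_prop)).aemeasurable

end Tonelli

/-- One renewal maps independent clocks to independent clocks and moves the state by `nextState`
with the law `ringLaw m` of the ringing clock. -/
lemma map_renewMap {m : ℕ} (hm : 0 < m) (L : Measure (ℝ × Finset ℕ)) [IsProbabilityMeasure L]
    (ρ : Measure (ℕ × ℕ)) [IsProbabilityMeasure ρ] :
    ((L.prod clockLaw).prod (clockLaw.prod ρ)).map (renewMap k m) =
      (((L.prod ρ).prod (ringLaw m)).map (Function.uncurry (nextState k m))).prod clockLaw := by
  have := isProbabilityMeasure_ringLaw hm
  have hn := measurable_nextState k m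
  have hR : Measurable fun p : (ℕ → ℝ) × (ℕ → ℝ) =>
      ((ringIdx m p.1, p.1 (ringIdx m p.1)), renewClocks m p.1 p.2) :=
    (((measurable_ringIdx m).prodMk (measurable_clock_ringIdx m)).comp measurable_fst).prodMk
      (measurable_renewClocks m)
  have hp : Measurable fun y : ((ℝ × Finset ℕ) × (ℕ × ℕ)) × ((ℕ → ℝ) × (ℕ → ℝ)) =>
      ((y.1.1, y.2.1), (y.2.2, y.1.2)) := by fun_prop
  have hassoc : ((L.prod ρ).prod (ringLaw m)).prod clockLaw =
      (((L.prod ρ).prod (clockLaw.prod clockLaw)).map (Prod.map id fun p : (ℕ → ℝ) × (ℕ → ℝ) =>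
        ((ringIdx m p.1, p.1 (ringIdx m p.1)), renewClocks m p.1 p.2))).map
          MeasurableEquiv.prodAssoc.symm := by
    rw [← Measure.map_prod_map _ _ measurable_id hR, map_renewClocks hm, Measure.map_id,
      ← Measure.prodAssoc_prod, MeasurableEquiv.map_symm_map]
  have hlast : (((L.prod ρ).prod (ringLaw m)).map (Function.uncurry (nextState k m))).prod clockLaw
      = (((L.prod ρ).prod (ringLaw m)).prod clockLaw).map
          (Prod.map (Function.uncurry (nextState k m)) id) := by
    rw [← Measure.map_prod_map _ _ hn measurable_id, Measure.map_id]
  rw [hlast, hassoc, ← map_prod_perm L clockLaw clockLaw ρ,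
    Measure.map_map (measurable_renewMap k m) hp,
    Measure.map_map MeasurableEquiv.prodAssoc.symm.measurable (measurable_id.prodMap hR),
    Measure.map_map (hn.prodMap measurable_id)
      (MeasurableEquiv.prodAssoc.symm.measurable.comp (measurable_id.prodMap hR))]
  rfl

section Driving

variable {Ω : Type*} [MeasurableSpace Ω] {P : Measure Ω}

lemma measurable_stateOf_urn {ξ : ℕ → ℕ → Ω → ℝ} {𝒲 𝒵 : ℕ → Ω → ℕ}
    (hξ : ∀ n m, Measurable (ξ n m)) (hW : ∀ n, Measurable (𝒲 n)) (hZ : ∀ n, Measurable (𝒵 n))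
    (n : ℕ) : Measurable fun ω => stateOf
      (urn W₀ B₀ k (fun n m => ξ n m ω) (fun n => 𝒲 n ω) (fun n => 𝒵 n ω) n) := by
  induction n with
  | zero =>
    change Measurable fun ω => (((0 : ℝ), Finset.range W₀), fun m => ξ 0 m ω)
    exact measurable_const.prodMk (measurable_pi_lambda _ fun m => hξ 0 m)
  | succ n ih =>
    simp only [stateOf_urn_succ]
    exact (measurable_renewMap k _).comp (ih.prodMk
      ((measurable_pi_lambda _ fun m => hξ (n + 1) m).prodMk ((hW n).prodMk (hZ n))))

/-- The urn after `n` renewals depends only on the clocks `0, …, n` and on the first `n` copies of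
the replacement matrix. -/
lemma urn_congr {ξ ξ' : ℕ → ℕ → ℝ} {𝒲 𝒵 𝒲' 𝒵' : ℕ → ℕ} {n : ℕ} (h1 : ∀ i ≤ n, ξ i = ξ' i)
    (h2 : ∀ i < n, 𝒲 i = 𝒲' i) (h3 : ∀ i < n, 𝒵 i = 𝒵' i) :
    urn W₀ B₀ k ξ 𝒲 𝒵 n = urn W₀ B₀ k ξ' 𝒲' 𝒵' n := by
  induction n with
  | zero => simp only [urn, h1 0 le_rfl]
  | succ n ih =>
    simp only [urn]
    rw [ih (fun i hi => h1 i (by omega)) (fun i hi => h2 i (by omega)) (fun i hi => h3 i (by omega)),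
      h1 (n + 1) le_rfl, h2 n (by omega), h3 n (by omega)]

/-- If `(X₁, X₂)` is independent of `(Y₁, Y₂)` and the entries of each pair are independent, then
the past `(X₁, Y₁)` is independent of the future `(X₂, Y₂)`. -/
lemma indepFun_prodMk_prodMk {β₁ β₂ γ₁ γ₂ : Type*} [MeasurableSpace β₁] [MeasurableSpace β₂]
    [MeasurableSpace γ₁] [MeasurableSpace γ₂] [IsProbabilityMeasure P] {X₁ : Ω → β₁} {X₂ : Ω → β₂}
    {Y₁ : Ω → γ₁} {Y₂ : Ω → γ₂} (hX₁ : Measurable X₁) (hX₂ : Measurable X₂) (hY₁ : Measurable Y₁)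
    (hY₂ : Measurable Y₂) (hX : IndepFun X₁ X₂ P) (hY : IndepFun Y₁ Y₂ P)
    (hXY : IndepFun (fun ω => (X₁ ω, X₂ ω)) (fun ω => (Y₁ ω, Y₂ ω)) P) :
    IndepFun (fun ω => (X₁ ω, Y₁ ω)) (fun ω => (X₂ ω, Y₂ ω)) P := by
  have h1 : IndepFun X₁ Y₁ P := hXY.comp measurable_fst measurable_fst
  have h2 : IndepFun X₂ Y₂ P := hXY.comp measurable_snd measurable_snd
  rw [indepFun_iff_map_prod_eq_prod_map_map (by fun_prop) (by fun_prop)] at hX hY hXY h1 h2 ⊢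
  have := Measure.isProbabilityMeasure_map (μ := P) hX₁.aemeasurable
  have := Measure.isProbabilityMeasure_map (μ := P) hX₂.aemeasurable
  have := Measure.isProbabilityMeasure_map (μ := P) hY₁.aemeasurable
  have := Measure.isProbabilityMeasure_map (μ := P) hY₂.aemeasurable
  rw [h1, h2]
  have e : (fun ω => ((X₁ ω, Y₁ ω), (X₂ ω, Y₂ ω))) =
      (fun y : (β₁ × β₂) × (γ₁ × γ₂) => ((y.1.1, y.2.1), (y.1.2, y.2.2))) ∘
        fun ω => ((X₁ ω, X₂ ω), (Y₁ ω, Y₂ ω)) := rfl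
  have hp : Measurable fun y : (β₁ × β₂) × (γ₁ × γ₂) => ((y.1.1, y.2.1), (y.1.2, y.2.2)) := by
    fun_prop
  have hq : Measurable fun y : (β₁ × β₂) × (γ₁ × γ₂) => ((y.1.1, y.2.1), (y.2.2, y.1.2)) := by
    fun_prop
  have hr : Measurable fun y : (β₁ × γ₁) × (γ₂ × β₂) => (y.1, y.2.swap) := by fun_prop
  rw [e, ← Measure.map_map hp (by fun_prop), hXY, hX, hY]
  have key := congrArg (Measure.map fun y : (β₁ × γ₁) × (γ₂ × β₂) => (y.1, y.2.swap))
    (map_prod_perm (P.map X₁) (P.map Y₁) (P.map Y₂) (P.map X₂))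
  rw [Measure.map_map hr hq] at key
  refine key.trans ?_
  have := Measure.map_prod_map ((P.map X₁).prod (P.map Y₁)) ((P.map Y₂).prod (P.map X₂))
    measurable_id measurable_swap
  rw [Measure.map_id, Measure.prod_swap] at this
  exact this.symm

namespace IsDriving

variable {ρ : Measure (ℕ × ℕ)} {ξ : ℕ → ℕ → Ω → ℝ} {𝒲 𝒵 : ℕ → Ω → ℕ}
  (h : IsDriving ρ ξ 𝒲 𝒵 P)

include h

lemma map_clock (n : ℕ) : P.map (fun ω m => ξ n m ω) = clockLaw := by
  have h1 := h.indep_clocks.precomp (g := fun m : ℕ => (n, m)) (fun a b hab => by simpa using hab)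
  exact (h1.hasLaw_infinitePi (fun m => h.law_clock n m)
    (measurable_pi_lambda _ fun m => h.measurable_clock n m).aemeasurable).map_eq

lemma iIndepFun_clock [IsProbabilityMeasure P] : iIndepFun (fun n ω => fun m => ξ n m ω) P := by
  have hm := fun n => measurable_pi_lambda (fun ω m => ξ n m ω) fun m => h.measurable_clock n m
  rw [iIndepFun_iff_map_fun_eq_infinitePi_map hm]
  simp only [h.map_clock]
  have h1 := (h.indep_clocks.hasLaw_infinitePi (fun q : ℕ × ℕ => h.law_clock q.1 q.2)
    (measurable_pi_lambda _ fun q : ℕ × ℕ => h.measurable_clock q.1 q.2).aemeasurable).map_eq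
  have h2 := Measure.infinitePi_map_curry (ι := ℕ) (κ := ℕ) fun _ _ => expMeasure 1
  rw [← h1, Measure.map_map (MeasurableEquiv.measurable _)
    (measurable_pi_lambda _ fun q : ℕ × ℕ => h.measurable_clock q.1 q.2)] at h2
  exact h2

lemma measurable_entries (n : ℕ) : Measurable fun ω => (𝒲 n ω, 𝒵 n ω) :=
  (h.measurable_white n).prodMk (h.measurable_blue n)

lemma measurable_stateOf (n : ℕ) : Measurable fun ω => stateOf
    (urn W₀ B₀ k (fun n m => ξ n m ω) (fun n => 𝒲 n ω) (fun n => 𝒵 n ω) n) :=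
  measurable_stateOf_urn h.measurable_clock h.measurable_white h.measurable_blue n

/-- The urn after `n` renewals is independent of the clocks and entries of the next renewal. -/
lemma indepFun_state [IsProbabilityMeasure P] (n : ℕ) : IndepFun
    (fun ω => stateOf (urn W₀ B₀ k (fun n m => ξ n m ω) (fun n => 𝒲 n ω) (fun n => 𝒵 n ω) n))
    (fun ω => ((fun m => ξ (n + 1) m ω), (𝒲 n ω, 𝒵 n ω))) P := by
  have hζ := fun n => measurable_pi_lambda (fun ω m => ξ n m ω) fun m => h.measurable_clock n m
  have hm1 : Measurable fun x : ({n + 1} : Finset ℕ) → ℕ → ℝ => x ⟨n + 1, by simp⟩ :=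
    measurable_pi_apply _
  have hm2 : Measurable fun x : ({n} : Finset ℕ) → ℕ × ℕ => x ⟨n, by simp⟩ :=
    measurable_pi_apply _
  have hm3 : Measurable fun y : ℕ → ℕ × ℕ => ((fun i : Finset.range n => y i), y n) := by fun_prop
  have hX := (h.iIndepFun_clock.indepFun_finset (Finset.range (n + 1)) {n + 1} (by simp) hζ).comp
    measurable_id hm1
  have hY := (h.indep_entries.indepFun_finset (Finset.range n) {n} (by simp)
    h.measurable_entries).comp
    measurable_id hm2
  have hXY := h.indep_clocks_entries.comp
    (φ := fun x : ℕ × ℕ → ℝ => ((fun (i : Finset.range (n + 1)) m => x (i, m)), fun m => x (n + 1, m)))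
    (by fun_prop) hm3
  have key := indepFun_prodMk_prodMk (P := P)
    (X₁ := fun ω (i : Finset.range (n + 1)) m => ξ i m ω) (X₂ := fun ω m => ξ (n + 1) m ω)
    (Y₁ := fun ω (i : Finset.range n) => (𝒲 i ω, 𝒵 i ω)) (Y₂ := fun ω => (𝒲 n ω, 𝒵 n ω))
    (measurable_pi_lambda _ fun i => hζ i) (hζ _)
    (measurable_pi_lambda _ fun i => h.measurable_entries i) (h.measurable_entries n) hX hY hXY
  -- the urn after `n` renewals as a function of the randomness used so far
  let ex : (Finset.range (n + 1) → ℕ → ℝ) → ℕ → ℕ → ℝ := fun x i m =>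
    if hi : i ∈ Finset.range (n + 1) then x ⟨i, hi⟩ m else 0
  let ey : (Finset.range n → ℕ × ℕ) → ℕ → ℕ × ℕ := fun y i =>
    if hi : i ∈ Finset.range n then y ⟨i, hi⟩ else 0
  have hex : ∀ i m, Measurable fun x => ex x i m := fun i m => by
    by_cases hi : i ∈ Finset.range (n + 1)
    · simp only [ex, hi, dif_pos]; fun_prop
    · simp only [ex, hi, dif_neg, not_false_eq_true]; fun_prop
  have hey : ∀ i, Measurable fun y => ey y i := fun i => by
    by_cases hi : i ∈ Finset.range n
    · simp only [ey, hi, dif_pos]; fun_prop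
    · simp only [ey, hi, dif_neg, not_false_eq_true]; fun_prop
  have hG := measurable_stateOf_urn (W₀ := W₀) (B₀ := B₀) (k := k)
    (Ω := (Finset.range (n + 1) → ℕ → ℝ) × (Finset.range n → ℕ × ℕ))
    (ξ := fun i m z => ex z.1 i m) (𝒲 := fun i z => (ey z.2 i).1) (𝒵 := fun i z => (ey z.2 i).2)
    (fun i m => (hex i m).comp measurable_fst)
    (fun i => measurable_fst.comp ((hey i).comp measurable_snd))
    (fun i => measurable_snd.comp ((hey i).comp measurable_snd)) n
  have := key.comp hG measurable_id
  convert this using 1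
  swap
  · rfl
  funext ω
  simp only [Function.comp_apply]
  congr 1
  refine urn_congr (fun i hi => ?_) (fun i hi => ?_) fun i hi => ?_
  · funext m
    have : i ∈ Finset.range (n + 1) := by simp; omega
    simp only [ex, this, dif_pos]
  · have : i ∈ Finset.range n := by simpa using hi
    simp only [ey, this, dif_pos]
  · have : i ∈ Finset.range n := by simpa using hi
    simp only [ey, this, dif_pos]

lemma map_fresh [IsProbabilityMeasure P] (n : ℕ) :
    P.map (fun ω => ((fun m => ξ (n + 1) m ω), (𝒲 n ω, 𝒵 n ω))) = clockLaw.prod ρ := by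
  have hm : Measurable fun y : ℕ → ℕ × ℕ => y n := measurable_pi_apply n
  have hXY := h.indep_clocks_entries.comp (φ := fun (x : ℕ × ℕ → ℝ) m => x (n + 1, m))
    (by fun_prop) hm
  have hζ := measurable_pi_lambda (fun ω m => ξ (n + 1) m ω) fun m => h.measurable_clock (n + 1) m
  have := (indepFun_iff_map_prod_eq_prod_map_map (by exact hζ.aemeasurable)
    (by exact (h.measurable_entries n).aemeasurable)).1 hXY
  refine this.trans ?_
  congr 1
  · exact h.map_clock (n + 1)
  · exact (h.law_entries n).map_eq

/-- After every renewal the clocks are independent `Exp(1)` clocks, independent of the past. -/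
theorem map_stateOf [IsProbabilityMeasure P] [IsProbabilityMeasure ρ] (hτ : 0 < W₀ + B₀) (n : ℕ) :
    P.map (fun ω => stateOf
      (urn W₀ B₀ k (fun n m => ξ n m ω) (fun n => 𝒲 n ω) (fun n => 𝒵 n ω) n)) =
    (stateLaw W₀ B₀ k ρ n).prod clockLaw := by
  induction n with
  | zero =>
    have e : (fun ω => stateOf
        (urn W₀ B₀ k (fun n m => ξ n m ω) (fun n => 𝒲 n ω) (fun n => 𝒵 n ω) 0)) =
        Prod.mk ((0 : ℝ), Finset.range W₀) ∘ fun ω m => ξ 0 m ω := rfl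
    rw [e, ← Measure.map_map measurable_prodMk_left
      (measurable_pi_lambda _ fun m => h.measurable_clock 0 m), h.map_clock 0]
    simp only [stateLaw]
    rw [Measure.dirac_prod]
  | succ n ih =>
    have := isProbabilityMeasure_stateLaw (k := k) hτ ρ n
    have hpair := (indepFun_iff_map_prod_eq_prod_map_map
      (h.measurable_stateOf (W₀ := W₀) (B₀ := B₀) (k := k) n).aemeasurable
      (Measurable.aemeasurable ((measurable_pi_lambda _ fun m => h.measurable_clock (n + 1) m).prodMk
        (h.measurable_entries n)))).1 (h.indepFun_state n)
    rw [ih, h.map_fresh n] at hpair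
    simp only [stateOf_urn_succ]
    rw [stateLaw, ← map_renewMap (by omega), ← hpair, Measure.map_map (measurable_renewMap k _)
      ((h.measurable_stateOf n).prodMk ((measurable_pi_lambda _ fun m =>
        h.measurable_clock (n + 1) m).prodMk (h.measurable_entries n)))]
    rfl

end IsDriving

end Driving

end

/-! ### The number of renewals -/

section

/-- The rising factorial `x (x + 1) ⋯ (x + n - 1)`. -/
def rising (x : ℝ) (n : ℕ) : ℝ := (ascPochhammer ℝ n).eval x

@[simp] lemma rising_zero (x : ℝ) : rising x 0 = 1 := by simp [rising]

lemma rising_succ (x : ℝ) (n : ℕ) : rising x (n + 1) = rising x n * (x + n) := by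
  simp [rising, ascPochhammer_succ_eval]

lemma rising_pos {x : ℝ} (hx : 0 < x) (n : ℕ) : 0 < rising x n := ascPochhammer_pos n x hx

lemma rising_nonneg {x : ℝ} (hx : 0 ≤ x) (n : ℕ) : 0 ≤ rising x n := by
  induction n with
  | zero => simp
  | succ n ih => rw [rising_succ]; positivity

/-- The probability of `n` renewals up to time `t ≥ 0` of an urn that starts with `τ` balls. -/
def renewalProb (τ k n : ℕ) (t : ℝ) : ℝ :=
  rising (τ / k) n / n.factorial * (Real.exp (-(τ * t)) * (1 - Real.exp (-(k * t))) ^ n)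

variable {τ k : ℕ}

lemma renewalProb_nonneg (n : ℕ) {t : ℝ} (ht : 0 ≤ t) : 0 ≤ renewalProb τ k n t := by
  unfold renewalProb
  have h1 : 0 ≤ rising ((τ : ℝ) / k) n := rising_nonneg (by positivity) n
  have h2 : 0 ≤ 1 - Real.exp (-(k * t)) := by
    rw [sub_nonneg, Real.exp_le_one_iff]; nlinarith [Nat.cast_nonneg (α := ℝ) k]
  positivity

lemma continuous_renewalProb (n : ℕ) : Continuous (renewalProb τ k n) := by
  unfold renewalProb; fun_prop

/-- The forward equation of the renewal process: the `(n + 1)`-st renewal up to time `t` is the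
last one before `t`, and it happens at time `u` at the rate `τ + k n` if it was preceded by `n`
renewals. -/
lemma integral_renewalProb (hk : 0 < k) (n : ℕ) (t : ℝ) :
    ∫ u in (0 : ℝ)..t, Real.exp (-((τ + k * (n + 1) : ℕ) * (t - u))) *
      ((τ + k * n : ℕ) * renewalProb τ k n u) = renewalProb τ k (n + 1) t := by
  have hk' : (0 : ℝ) < k := Nat.cast_pos.2 hk
  have hder : ∀ u : ℝ, HasDerivAt (fun u => Real.exp (-((τ + k * (n + 1) : ℕ) * (t - u))) *
      renewalProb τ k (n + 1) u) (Real.exp (-((τ + k * (n + 1) : ℕ) * (t - u))) *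
      ((τ + k * n : ℕ) * renewalProb τ k n u)) u := by
    intro u
    have h1 : HasDerivAt (fun u : ℝ => Real.exp (-((τ + k * (n + 1) : ℕ) * (t - u))))
        (Real.exp (-((τ + k * (n + 1) : ℕ) * (t - u))) * (τ + k * (n + 1) : ℕ)) u := by
      have := ((((hasDerivAt_id u).const_sub t).const_mul ((τ + k * (n + 1) : ℕ) : ℝ)).fun_neg).exp
      simpa using this
    have h2 : HasDerivAt (fun u : ℝ => Real.exp (-(τ * u))) (Real.exp (-(τ * u)) * (-τ)) u := by
      have := ((hasDerivAt_id u).const_mul (τ : ℝ)).fun_neg.exp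
      simpa using this
    have h3 : HasDerivAt (fun u : ℝ => 1 - Real.exp (-(k * u))) (Real.exp (-(k * u)) * k) u := by
      have := (((hasDerivAt_id u).const_mul (k : ℝ)).fun_neg.exp).const_sub 1
      simpa using this
    have h4 := h1.mul (((h2.mul (h3.pow (n + 1))).const_mul
      (rising (τ / k) (n + 1) / (n + 1).factorial)))
    refine h4.congr_deriv ?_
    simp only [renewalProb, rising_succ, Nat.factorial_succ, Pi.mul_apply, Pi.pow_apply,
      Nat.add_sub_cancel]
    have hf : (n.factorial : ℝ) ≠ 0 := by positivity
    push_cast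
    field_simp
    generalize Real.exp (-(k * u)) = y
    ring
  have hint := intervalIntegral.integral_eq_sub_of_hasDerivAt (a := 0) (b := t)
    (fun u _ => hder u) (by
      have := continuous_renewalProb (τ := τ) (k := k) n
      exact Continuous.intervalIntegrable (by fun_prop) _ _)
  rw [hint]
  simp [renewalProb]

/-- `renewalProb` for all real times; before time `0` there is no urn. -/
def renewalProb' (τ k n : ℕ) (t : ℝ) : ℝ≥0∞ :=
  if 0 ≤ t then ENNReal.ofReal (renewalProb τ k n t) else 0

lemma measurable_renewalProb' (n : ℕ) : Measurable (renewalProb' τ k n) :=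
  Measurable.ite measurableSet_Ici
    (continuous_renewalProb n).measurable.ennreal_ofReal measurable_const

/-- The probability that an urn with `m` balls has no renewal between `s` and `t`, if `s ≤ t`. -/
def noRing (m : ℕ) (t s : ℝ) : ℝ≥0∞ :=
  if s ≤ t then ENNReal.ofReal (Real.exp (-(m * (t - s)))) else 0

lemma measurable_noRing (m : ℕ) : Measurable fun p : ℝ × ℝ => noRing m p.1 p.2 := by
  refine Measurable.ite (measurableSet_le measurable_snd measurable_fst) ?_ measurable_const
  fun_prop

/-- The forward equation `integral_renewalProb` on the whole time axis. -/
lemma lintegral_renewalProb' (hk : 0 < k) (n : ℕ) (t : ℝ) :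
    ∫⁻ u, noRing (τ + k * (n + 1)) t u * ((τ + k * n : ℕ) * renewalProb' τ k n u) =
      renewalProb' τ k (n + 1) t := by
  by_cases ht : 0 ≤ t
  · have h1 : ∀ u, noRing (τ + k * (n + 1)) t u * ((τ + k * n : ℕ) * renewalProb' τ k n u) =
        (Set.Icc 0 t).indicator (fun u => ENNReal.ofReal
          (Real.exp (-((τ + k * (n + 1) : ℕ) * (t - u))) *
            ((τ + k * n : ℕ) * renewalProb τ k n u))) u := by
      intro u
      by_cases hu : u ∈ Set.Icc 0 t
      · rw [Set.indicator_of_mem hu, noRing, renewalProb', if_pos hu.1, if_pos hu.2,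
          ENNReal.ofReal_mul (Real.exp_pos _).le, ENNReal.ofReal_mul (Nat.cast_nonneg _),
          ENNReal.ofReal_natCast]
      · rw [Set.indicator_of_notMem hu, noRing, renewalProb']
        by_cases h0 : 0 ≤ u
        · rw [if_neg (fun h => hu ⟨h0, h⟩), zero_mul]
        · rw [if_neg h0, mul_zero, mul_zero]
    have hc := continuous_renewalProb (τ := τ) (k := k) n
    rw [lintegral_congr h1, lintegral_indicator measurableSet_Icc,
      ← ofReal_integral_eq_lintegral_ofReal, integral_Icc_eq_integral_Ioc,
      ← intervalIntegral.integral_of_le ht, integral_renewalProb hk, renewalProb', if_pos ht]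
    · exact (Continuous.continuousOn (by fun_prop)).integrableOn_compact isCompact_Icc
    · refine (ae_restrict_iff' measurableSet_Icc).2 (Eventually.of_forall fun u hu => ?_)
      have := renewalProb_nonneg (τ := τ) (k := k) n hu.1
      simp only [Pi.zero_apply]
      positivity
  · have h1 : ∀ u, noRing (τ + k * (n + 1)) t u * ((τ + k * n : ℕ) * renewalProb' τ k n u) = 0 := by
      intro u
      rw [noRing, renewalProb']
      by_cases h0 : 0 ≤ u
      · rw [if_neg (fun h => ht (h0.trans h)), zero_mul]
      · rw [if_neg h0, mul_zero, mul_zero]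
    rw [lintegral_congr h1, lintegral_zero, renewalProb', if_neg ht]

variable {W₀ B₀ : ℕ} {ρ : Measure (ℕ × ℕ)}

lemma measurable_comp_addWhite (k m j : ℕ) (f : Finset ℕ → ℝ≥0∞) :
    Measurable fun x : (ℝ × Finset ℕ) × (ℕ × ℕ) => f (addWhite k m x.1.2 x.2 j) := by
  have h2 : Measurable fun x : (ℝ × Finset ℕ) × (ℕ × ℕ) => x.1.2 := by fun_prop
  have h3 : Measurable fun x : (ℝ × Finset ℕ) × (ℕ × ℕ) => x.2 := by fun_prop
  have h5 : Measurable fun y : Finset ℕ × (ℕ × ℕ) => f (addWhite k m y.1 y.2 j) :=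
    Measurable.of_discrete
  have h6 := h5.comp (h2.prodMk h3)
  exact h6

/-- The sum of the expectations of `f` over the `m` possible choices of the picked ball. -/
def pickSum (k m : ℕ) (ρ : Measure (ℕ × ℕ)) (f : Finset ℕ → ℝ≥0∞) (A : Finset ℕ) : ℝ≥0∞ :=
  ∫⁻ e, ∑ j ∈ Finset.range m, f (addWhite k m A e j) ∂ρ

/-- One step of the chain: the waiting time and the picked ball are independent, with joint
density `exp (-m y)` for each of the `m` balls. -/
lemma lintegral_stateLaw_succ [IsProbabilityMeasure ρ] (hτ : 0 < W₀ + B₀) (n : ℕ)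
    {g : ℝ → ℝ≥0∞} (hg : Measurable g) (f : Finset ℕ → ℝ≥0∞) :
    ∫⁻ z, g z.1 * f z.2 ∂(stateLaw W₀ B₀ k ρ (n + 1)) =
      ∫⁻ z, (∫⁻ y in Set.Ioi 0, ENNReal.ofReal (Real.exp (-((W₀ + B₀ + k * n : ℕ) * y))) *
        g (z.1 + y)) * pickSum k (W₀ + B₀ + k * n) ρ f z.2 ∂(stateLaw W₀ B₀ k ρ n) := by
  have := isProbabilityMeasure_stateLaw (k := k) hτ ρ n
  have := isProbabilityMeasure_ringLaw (m := W₀ + B₀ + k * n) (by omega)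
  have hF : Measurable fun z : ℝ × Finset ℕ => g z.1 * f z.2 :=
    (hg.comp measurable_fst).mul ((Measurable.of_discrete (f := f)).comp measurable_snd)
  rw [stateLaw]
  generalize W₀ + B₀ + k * n = m at *
  generalize stateLaw W₀ B₀ k ρ n = L at *
  have hFm := hF.comp (measurable_nextState k m)
  have hG : Measurable fun s : ℝ => ∫⁻ y in Set.Ioi 0, ENNReal.ofReal (Real.exp (-(m * y))) *
      g (s + y) := by
    refine Measurable.lintegral_prod_right' (ν := volume.restrict (Set.Ioi 0))
      (f := fun p : ℝ × ℝ => ENNReal.ofReal (Real.exp (-(m * p.2))) * g (p.1 + p.2)) ?_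
    exact Measurable.mul (by fun_prop) (hg.comp (by fun_prop))
  have hsum : Measurable fun x : (ℝ × Finset ℕ) × (ℕ × ℕ) =>
      ∑ j ∈ Finset.range m, f (addWhite k m x.1.2 x.2 j) :=
    Finset.measurable_fun_sum _ fun j _ => measurable_comp_addWhite k m j f
  have hx : ∀ x : (ℝ × Finset ℕ) × (ℕ × ℕ),
      ∫⁻ q, g (Function.uncurry (nextState k m) (x, q)).1 *
        f (Function.uncurry (nextState k m) (x, q)).2 ∂(ringLaw m) =
      (∫⁻ y in Set.Ioi 0, ENNReal.ofReal (Real.exp (-(m * y))) * g (x.1.1 + y)) *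
        ∑ j ∈ Finset.range m, f (addWhite k m x.1.2 x.2 j) := by
    intro x
    refine (lintegral_ringLaw _ (hFm.comp measurable_prodMk_left)).trans ?_
    rw [Finset.mul_sum]
    refine Finset.sum_congr rfl fun j _ => ?_
    refine (lintegral_expDens _ ((hFm.comp measurable_prodMk_left).comp
      measurable_prodMk_left)).trans ?_
    have hm2 : Measurable fun y : ℝ => ENNReal.ofReal (Real.exp (-(m * y))) * g (x.1.1 + y) :=
      Measurable.mul (by fun_prop) (hg.comp (by fun_prop))
    rw [← lintegral_mul_const _ hm2]
    exact lintegral_congr fun y => (mul_assoc _ _ _).symm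
  rw [lintegral_map hF (measurable_nextState _ _)]
  refine (lintegral_prod _ hFm.aemeasurable).trans ((lintegral_congr hx).trans ?_)
  have hprod : Measurable fun x : (ℝ × Finset ℕ) × (ℕ × ℕ) =>
      (∫⁻ y in Set.Ioi 0, ENNReal.ofReal (Real.exp (-(m * y))) * g (x.1.1 + y)) *
        ∑ j ∈ Finset.range m, f (addWhite k m x.1.2 x.2 j) :=
    (hG.comp (measurable_fst.comp measurable_fst)).mul hsum
  refine (lintegral_prod _ hprod.aemeasurable).trans (lintegral_congr fun z => ?_)
  have hz : Measurable fun e => ∑ j ∈ Finset.range m, f (addWhite k m z.2 e j) :=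
    Measurable.of_discrete
  exact lintegral_const_mul (μ := ρ)
    (∫⁻ y in Set.Ioi 0, ENNReal.ofReal (Real.exp (-(m * y))) * g (z.1 + y)) hz

lemma lintegral_exp_neg_Ioi {m : ℕ} (hm : 0 < m) :
    ∫⁻ y in Set.Ioi (0 : ℝ), ENNReal.ofReal (Real.exp (-(m * y))) = (m : ℝ≥0∞)⁻¹ := by
  have h := lintegral_expDens m (measurable_const (a := (1 : ℝ≥0∞)))
  simp only [lintegral_const, one_mul, mul_one, expDens_univ hm] at h
  rw [← h, one_div, ENNReal.ofReal_inv_of_pos (Nat.cast_pos.2 hm), ENNReal.ofReal_natCast]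

lemma lintegral_noRing_shift (m m' : ℕ) (t s : ℝ) :
    ∫⁻ y in Set.Ioi 0, ENNReal.ofReal (Real.exp (-(m * y))) * noRing m' t (s + y) =
      ∫⁻ u, noRing m' t u * noRing m u s := by
  rw [← lintegral_indicator measurableSet_Ioi]
  conv_rhs => rw [← lintegral_add_left_eq_self _ s]
  refine lintegral_congr_ae ?_
  have h0 : ∀ᵐ y : ℝ, y ≠ 0 := by simp [ae_iff]
  filter_upwards [h0] with y hy0
  by_cases hy : 0 < y
  · rw [Set.indicator_of_mem (Set.mem_Ioi.2 hy), noRing, noRing,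
      if_pos (by linarith : s ≤ s + y), add_sub_cancel_left, mul_comm]
  · have : ¬ s ≤ s + y := by
      have := lt_of_le_of_ne (not_lt.1 hy) hy0
      linarith
    rw [Set.indicator_of_notMem (by simpa using hy), noRing, noRing, if_neg this, mul_zero]

/-- The number of renewals is independent of the balls that are added: the chance that the urn
has exactly `n` renewals up to time `t` does not depend on the white balls after `n` renewals. -/
lemma lintegral_noRing_stateLaw [IsProbabilityMeasure ρ] (hk : 0 < k) (hτ : 0 < W₀ + B₀) (n : ℕ) :
    ∀ (t : ℝ) (f : Finset ℕ → ℝ≥0∞),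
    ∫⁻ z, noRing (W₀ + B₀ + k * n) t z.1 * f z.2 ∂(stateLaw W₀ B₀ k ρ n) =
      renewalProb' (W₀ + B₀) k n t * ∫⁻ z, f z.2 ∂(stateLaw W₀ B₀ k ρ n) := by
  induction n with
  | zero =>
    intro t f
    have hf : Measurable fun z : ℝ × Finset ℕ => f z.2 :=
      (Measurable.of_discrete (f := f)).comp measurable_snd
    have h1 : Measurable fun z : ℝ × Finset ℕ => noRing (W₀ + B₀ + k * 0) t z.1 :=
      (measurable_noRing _).comp (measurable_const.prodMk measurable_fst)
    have h2 : Measurable fun z : ℝ × Finset ℕ => noRing (W₀ + B₀ + k * 0) t z.1 * f z.2 := h1.mul hf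
    rw [stateLaw, lintegral_dirac' _ h2, lintegral_dirac' _ hf]
    simp [noRing, renewalProb', renewalProb]
  | succ n ih =>
    intro t f
    have := isProbabilityMeasure_stateLaw (k := k) hτ ρ n
    have hg : Measurable (noRing (W₀ + B₀ + k * (n + 1)) t) :=
      (measurable_noRing (W₀ + B₀ + k * (n + 1))).comp (measurable_prodMk_left (x := t))
    have h1 := lintegral_stateLaw_succ (k := k) (ρ := ρ) hτ n hg f
    have h2 := lintegral_stateLaw_succ (k := k) (ρ := ρ) hτ n (measurable_const (a := 1)) f
    simp only [one_mul, mul_one, lintegral_exp_neg_Ioi (show 0 < W₀ + B₀ + k * n by omega)] at h2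
    have hF : Measurable (pickSum k (W₀ + B₀ + k * n) ρ f) := Measurable.of_discrete
    have hF' : Measurable fun z : ℝ × Finset ℕ => pickSum k (W₀ + B₀ + k * n) ρ f z.2 :=
      hF.comp measurable_snd
    rw [h1, h2, lintegral_const_mul _ hF',
      ← lintegral_renewalProb' hk n t]
    simp only [lintegral_noRing_shift]
    clear h1 h2 hF'
    generalize pickSum k (W₀ + B₀ + k * n) ρ f = F at *
    have hm0 : ((W₀ + B₀ + k * n : ℕ) : ℝ≥0∞) ≠ 0 := by
      rw [Ne, Nat.cast_eq_zero]; omega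
    have hnr : Measurable fun p : (ℝ × Finset ℕ) × ℝ => noRing (W₀ + B₀ + k * n) p.2 p.1.1 :=
      (measurable_noRing (W₀ + B₀ + k * n)).comp
        (measurable_snd.prodMk (measurable_fst.comp measurable_fst))
    have hgs : Measurable fun p : (ℝ × Finset ℕ) × ℝ => noRing (W₀ + B₀ + k * (n + 1)) t p.2 :=
      hg.comp measurable_snd
    have hFs : Measurable fun p : (ℝ × Finset ℕ) × ℝ => F p.1.2 := hF.comp (measurable_snd.comp measurable_fst)
    calc ∫⁻ z, (∫⁻ u, noRing (W₀ + B₀ + k * (n + 1)) t u * noRing (W₀ + B₀ + k * n) u z.1) * F z.2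
          ∂(stateLaw W₀ B₀ k ρ n)
        = ∫⁻ z, (∫⁻ u, noRing (W₀ + B₀ + k * (n + 1)) t u * noRing (W₀ + B₀ + k * n) u z.1 * F z.2)
          ∂(stateLaw W₀ B₀ k ρ n) := by
          refine lintegral_congr fun z => ?_
          exact (lintegral_mul_const _ ((hgs.mul hnr).comp measurable_prodMk_left)).symm
      _ = ∫⁻ u, (∫⁻ z, noRing (W₀ + B₀ + k * (n + 1)) t u * noRing (W₀ + B₀ + k * n) u z.1 * F z.2
          ∂(stateLaw W₀ B₀ k ρ n)) :=
          lintegral_lintegral_swap ((hgs.mul hnr).mul hFs).aemeasurable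
      _ = ∫⁻ u, noRing (W₀ + B₀ + k * (n + 1)) t u *
          (((W₀ + B₀ + k * n : ℕ) : ℝ≥0∞) * renewalProb' (W₀ + B₀) k n u) *
          (((W₀ + B₀ + k * n : ℕ) : ℝ≥0∞)⁻¹ * ∫⁻ z, F z.2 ∂(stateLaw W₀ B₀ k ρ n)) := by
          refine lintegral_congr fun u => ?_
          simp only [mul_assoc]
          have hu : Measurable fun z : ℝ × Finset ℕ => noRing (W₀ + B₀ + k * n) u z.1 * F z.2 :=
            (hnr.mul hFs).comp (measurable_prodMk_right (y := u))
          rw [lintegral_const_mul _ hu, ih u F]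
          rw [mul_left_comm (renewalProb' (W₀ + B₀) k n u), ← mul_assoc (_ : ℝ≥0∞) (_)⁻¹,
            ENNReal.mul_inv_cancel hm0 (ENNReal.natCast_ne_top _), one_mul]
      _ = _ := by
          refine lintegral_mul_const _ ?_
          exact hg.mul (measurable_const.mul (measurable_renewalProb' n))

end

/-! ### Negative binomial series -/

section

lemma choose_eq_rising (y : ℝ) (n : ℕ) : Ring.choose (y + n - 1) n = rising y n / n.factorial := by
  have h := Ring.factorial_nsmul_multichoose_eq_ascPochhammer y n
  rw [Polynomial.ascPochhammer_smeval_eq_eval, Ring.multichoose_eq, nsmul_eq_mul] at h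
  rw [rising, ← h]
  field_simp

lemma hasSum_rising (y : ℝ) {z : ℝ} (hz : |z| < 1) :
    HasSum (fun n : ℕ => rising y n / n.factorial * z ^ n) ((1 - z) ^ (-y)) := by
  have h := (Real.one_div_one_sub_rpow_hasFPowerSeriesOnBall_zero y).hasSum (y := z) (by
    simpa [Metric.mem_eball, edist_dist] using hz)
  have h1 : 0 ≤ 1 - z := by linarith [(abs_lt.1 hz).2]
  simp only [zero_add, one_div, ← Real.rpow_neg h1] at h
  convert! h using 2 with n
  rw [FormalMultilinearSeries.ofScalars_apply_eq, choose_eq_rising, smul_eq_mul]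

lemma hasSum_rising_complex (y : ℝ) {z : ℂ} (hz : ‖z‖ < 1) :
    HasSum (fun n : ℕ => ((rising y n / n.factorial : ℝ) : ℂ) * z ^ n) ((1 - z) ^ (-(y : ℂ))) := by
  have h := (Complex.one_div_one_sub_cpow_hasFPowerSeriesOnBall_zero y).hasSum (y := z) (by
    rwa [Metric.mem_eball, edist_zero_right, ← ofReal_norm, ENNReal.ofReal_lt_one])
  simp only [zero_add, one_div, ← Complex.cpow_neg] at h
  convert! h using 2 with n
  rw [FormalMultilinearSeries.ofScalars_apply_eq, ← choose_eq_rising, smul_eq_mul,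
    Complex.ofReal_choose]
  push_cast
  rfl

lemma rising_add (y : ℝ) (n r : ℕ) : rising y (n + r) = rising y n * rising (y + n) r := by
  induction r with
  | zero => simp
  | succ r ih => rw [← add_assoc, rising_succ, rising_succ, ih]; push_cast; ring

variable {τ k : ℕ}

lemma one_sub_exp_mem (k : ℕ) {t : ℝ} (ht : 0 ≤ t) :
    0 ≤ 1 - Real.exp (-(k * t)) ∧ 1 - Real.exp (-(k * t)) < 1 := by
  constructor
  · rw [sub_nonneg, Real.exp_le_one_iff]; nlinarith [Nat.cast_nonneg (α := ℝ) k]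
  · linarith [Real.exp_pos (-(k * t))]

/-- Ratios of rising factorials average to pure exponentials under the law of the number of
renewals. -/
lemma hasSum_renewalProb_rising (hτ : 0 < τ) (hk : 0 < k) {t : ℝ} (ht : 0 ≤ t) (σ : ℝ) (r : ℕ) :
    HasSum (fun n => renewalProb τ k n t *
      (rising (τ / k + σ) n / rising (τ / k) n * rising (τ / k + σ + n) r))
      (rising (τ / k + σ) r * Real.exp (k * (σ + r) * t)) := by
  have hk' : (0 : ℝ) < k := Nat.cast_pos.2 hk
  have hx : (0 : ℝ) < τ / k := div_pos (Nat.cast_pos.2 hτ) hk'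
  obtain ⟨h0, h1⟩ := one_sub_exp_mem k ht
  have h := (hasSum_rising (τ / k + σ + r) (z := 1 - Real.exp (-(k * t)))
    (by rwa [abs_of_nonneg h0])).mul_left (rising (τ / k + σ) r * Real.exp (-(τ * t)))
  convert! h using 1
  · funext n
    have e : rising (τ / k + σ) n * rising (τ / k + σ + n) r =
        rising (τ / k + σ) r * rising (τ / k + σ + r) n := by
      rw [← rising_add, ← rising_add, add_comm n r]
    have hne := (rising_pos hx n).ne'
    rw [renewalProb, div_mul_eq_mul_div (rising (τ / k + σ) n), e]
    field_simp
  · rw [sub_sub_cancel, ← Real.exp_mul, mul_assoc (rising _ _), ← Real.exp_add]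
    congr 2
    field_simp
    ring

lemma hasSum_renewalProb (hτ : 0 < τ) (hk : 0 < k) {t : ℝ} (ht : 0 ≤ t) :
    HasSum (fun n => renewalProb τ k n t) 1 := by
  have h := hasSum_renewalProb_rising hτ hk ht 0 0
  have hx : (0 : ℝ) < τ / k := div_pos (Nat.cast_pos.2 hτ) (Nat.cast_pos.2 hk)
  simpa [fun n => div_self (rising_pos hx n).ne'] using h

end

/-! ### The urn at a fixed time -/

section

lemma time_urn_succ (W₀ B₀ k : ℕ) (ξ : ℕ → ℕ → ℝ) (𝒲 𝒵 : ℕ → ℕ) (n : ℕ) :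
    (urn W₀ B₀ k ξ 𝒲 𝒵 (n + 1)).time = (urn W₀ B₀ k ξ 𝒲 𝒵 n).time +
      (urn W₀ B₀ k ξ 𝒲 𝒵 n).clock (ringIdx (W₀ + B₀ + k * n) (urn W₀ B₀ k ξ 𝒲 𝒵 n).clock) := by
  rw [← balls_urn W₀ B₀ k ξ 𝒲 𝒵 n]
  rfl

lemma renewals_eq {W₀ B₀ k : ℕ} {ξ : ℕ → ℕ → ℝ} {𝒲 𝒵 : ℕ → ℕ}
    (hmono : ∀ n, (urn W₀ B₀ k ξ 𝒲 𝒵 n).time < (urn W₀ B₀ k ξ 𝒲 𝒵 (n + 1)).time)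
    {n : ℕ} {t : ℝ} (h1 : (urn W₀ B₀ k ξ 𝒲 𝒵 n).time ≤ t)
    (h2 : t < (urn W₀ B₀ k ξ 𝒲 𝒵 (n + 1)).time) : renewals W₀ B₀ k ξ 𝒲 𝒵 t = n := by
  have hm : StrictMono fun n => (urn W₀ B₀ k ξ 𝒲 𝒵 n).time := strictMono_nat_of_lt_succ hmono
  have : {i : ℕ | (urn W₀ B₀ k ξ 𝒲 𝒵 (i + 1)).time ≤ t} = (Finset.range n : Set ℕ) := by
    ext i
    simp only [Set.mem_ofPred_eq, Finset.coe_range, Set.mem_Iio]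
    constructor
    · intro hi
      have := hm.lt_iff_lt.1 (hi.trans_lt h2)
      omega
    · intro hi
      exact (hm.monotone (show i + 1 ≤ n by omega)).trans h1
  rw [renewals, this, Set.ncard_coe_finset, Finset.card_range]

section

variable {Ω : Type*} [MeasurableSpace Ω] {P : Measure Ω} {W₀ B₀ k : ℕ}
  {ρ : Measure (ℕ × ℕ)} {ξ : ℕ → ℕ → Ω → ℝ} {𝒲 𝒵 : ℕ → Ω → ℕ}

/-- The time of the `n`-th renewal. -/
def renewalTime (W₀ B₀ k : ℕ) (ξ : ℕ → ℕ → Ω → ℝ) (𝒲 𝒵 : ℕ → Ω → ℕ) (n : ℕ) (ω : Ω) : ℝ :=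
  (urn W₀ B₀ k (fun n m => ξ n m ω) (fun n => 𝒲 n ω) (fun n => 𝒵 n ω) n).time

/-- The labels of the white balls after the `n`-th renewal. -/
def whiteBalls (W₀ B₀ k : ℕ) (ξ : ℕ → ℕ → Ω → ℝ) (𝒲 𝒵 : ℕ → Ω → ℕ) (n : ℕ) (ω : Ω) : Finset ℕ :=
  (urn W₀ B₀ k (fun n m => ξ n m ω) (fun n => 𝒲 n ω) (fun n => 𝒵 n ω) n).white

/-- The number of renewals up to time `t`, as a random variable. -/
def renewalCount (W₀ B₀ k : ℕ) (ξ : ℕ → ℕ → Ω → ℝ) (𝒲 𝒵 : ℕ → Ω → ℕ) (t : ℝ) (ω : Ω) : ℕ :=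
  renewals W₀ B₀ k (fun n m => ξ n m ω) (fun n => 𝒲 n ω) (fun n => 𝒵 n ω) t

namespace IsDriving

variable (h : IsDriving ρ ξ 𝒲 𝒵 P)

include h

lemma measurable_renewalTime (n : ℕ) : Measurable (renewalTime W₀ B₀ k ξ 𝒲 𝒵 n) :=
  measurable_fst.comp (measurable_fst.comp (h.measurable_stateOf n))

lemma measurable_whiteBalls (n : ℕ) : Measurable (whiteBalls W₀ B₀ k ξ 𝒲 𝒵 n) :=
  measurable_snd.comp (measurable_fst.comp (h.measurable_stateOf n))

lemma measurable_renewalCount (t : ℝ) : Measurable (renewalCount W₀ B₀ k ξ 𝒲 𝒵 t) := by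
  have h1 : Measurable fun ω => {n : ℕ | renewalTime W₀ B₀ k ξ 𝒲 𝒵 (n + 1) ω ≤ t} := by
    rw [measurable_set_iff]
    intro n
    exact measurableSet_setOfPred.1 (measurableSet_le (h.measurable_renewalTime (n + 1)) measurable_const)
  exact measurable_ncard.comp h1

lemma measurable_whiteBalls_renewalCount (t : ℝ) : Measurable fun ω =>
    (renewalCount W₀ B₀ k ξ 𝒲 𝒵 t ω,
      whiteBalls W₀ B₀ k ξ 𝒲 𝒵 (renewalCount W₀ B₀ k ξ 𝒲 𝒵 t ω) ω) := by
  have hc := h.measurable_renewalCount (W₀ := W₀) (B₀ := B₀) (k := k) t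
  have h1 : Measurable fun p : ℕ × Ω => whiteBalls W₀ B₀ k ξ 𝒲 𝒵 p.1 p.2 :=
    measurable_from_prod_countable_right fun n => h.measurable_whiteBalls n
  exact hc.prodMk (h1.comp (hc.prodMk measurable_id))

variable [IsProbabilityMeasure P] [IsProbabilityMeasure ρ]

lemma map_state (hτ : 0 < W₀ + B₀) (n : ℕ) :
    P.map (fun ω => (renewalTime W₀ B₀ k ξ 𝒲 𝒵 n ω, whiteBalls W₀ B₀ k ξ 𝒲 𝒵 n ω)) =
      stateLaw W₀ B₀ k ρ n := by
  have := isProbabilityMeasure_stateLaw (k := k) hτ ρ n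
  have h1 := congrArg (Measure.map Prod.fst) (h.map_stateOf (k := k) hτ n)
  rw [Measure.map_map measurable_fst (h.measurable_stateOf n), Measure.map_fst_prod, measure_univ,
    one_smul] at h1
  exact h1

lemma lintegral_whiteBalls (hτ : 0 < W₀ + B₀) (n : ℕ) (f : Finset ℕ → ℝ≥0∞) :
    ∫⁻ ω, f (whiteBalls W₀ B₀ k ξ 𝒲 𝒵 n ω) ∂P = ∫⁻ z, f z.2 ∂(stateLaw W₀ B₀ k ρ n) := by
  have hf : Measurable fun z : ℝ × Finset ℕ => f z.2 :=
    (Measurable.of_discrete (f := f)).comp measurable_snd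
  rw [← h.map_state hτ n, lintegral_map hf
    ((h.measurable_renewalTime n).prodMk (h.measurable_whiteBalls n))]

/-- The waiting times are almost surely positive. -/
lemma ae_renewalTime_lt (hτ : 0 < W₀ + B₀) (n : ℕ) : ∀ᵐ ω ∂P,
    renewalTime W₀ B₀ k ξ 𝒲 𝒵 n ω < renewalTime W₀ B₀ k ξ 𝒲 𝒵 (n + 1) ω := by
  have := isProbabilityMeasure_stateLaw (k := k) hτ ρ n
  have hpos : ∀ᵐ c ∂clockLaw, 0 < c (ringIdx (W₀ + B₀ + k * n) c) := by
    have hm := measurable_clock_ringIdx (W₀ + B₀ + k * n)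
    have h1 := clockLaw_waiting (m := W₀ + B₀ + k * n) (by omega) le_rfl
    simp only [mul_zero, neg_zero, Real.exp_zero, ENNReal.ofReal_one] at h1
    exact (prob_compl_eq_zero_iff (measurableSet_lt measurable_const hm)).2 h1
  have h2 : ∀ᵐ p ∂((stateLaw W₀ B₀ k ρ n).prod clockLaw),
      0 < p.2 (ringIdx (W₀ + B₀ + k * n) p.2) :=
    Measure.quasiMeasurePreserving_snd.ae hpos
  rw [← h.map_stateOf hτ n] at h2
  have h3 := ae_of_ae_map (h.measurable_stateOf n).aemeasurable h2
  filter_upwards [h3] with ω hω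
  rw [renewalTime, renewalTime, time_urn_succ]
  exact lt_add_of_pos_right _ hω

/-- The event of exactly `n` renewals up to time `t` is independent of the white balls after `n`
renewals. -/
lemma lintegral_renewalTime (hk : 0 < k) (hτ : 0 < W₀ + B₀) (n : ℕ) (t : ℝ)
    (f : Finset ℕ → ℝ≥0∞) :
    ∫⁻ ω in {ω | renewalTime W₀ B₀ k ξ 𝒲 𝒵 n ω ≤ t ∧ t < renewalTime W₀ B₀ k ξ 𝒲 𝒵 (n + 1) ω},
        f (whiteBalls W₀ B₀ k ξ 𝒲 𝒵 n ω) ∂P =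
      renewalProb' (W₀ + B₀) k n t * ∫⁻ ω, f (whiteBalls W₀ B₀ k ξ 𝒲 𝒵 n ω) ∂P := by
  have := isProbabilityMeasure_stateLaw (k := k) hτ ρ n
  set m := W₀ + B₀ + k * n with hm
  have hmc := measurable_clock_ringIdx m
  have hS : MeasurableSet {ω | renewalTime W₀ B₀ k ξ 𝒲 𝒵 n ω ≤ t ∧
      t < renewalTime W₀ B₀ k ξ 𝒲 𝒵 (n + 1) ω} :=
    (measurableSet_le (h.measurable_renewalTime n) measurable_const).inter
      (measurableSet_lt measurable_const (h.measurable_renewalTime (n + 1)))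
  rw [h.lintegral_whiteBalls hτ n f, ← lintegral_noRing_stateLaw hk hτ n t f,
    ← lintegral_indicator hS]
  let E : Set ((ℝ × Finset ℕ) × (ℕ → ℝ)) :=
    {p | p.1.1 ≤ t ∧ t < p.1.1 + p.2 (ringIdx m p.2)}
  have hE : MeasurableSet E := by
    have h1 : Measurable fun p : (ℝ × Finset ℕ) × (ℕ → ℝ) => p.1.1 :=
      measurable_fst.comp measurable_fst
    have h2 : Measurable fun p : (ℝ × Finset ℕ) × (ℕ → ℝ) => p.1.1 + p.2 (ringIdx m p.2) :=
      h1.add (hmc.comp measurable_snd)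
    exact (measurableSet_le h1 measurable_const).inter (measurableSet_lt measurable_const h2)
  have hf : Measurable fun p : (ℝ × Finset ℕ) × (ℕ → ℝ) => f p.1.2 :=
    (Measurable.of_discrete (f := f)).comp (measurable_snd.comp measurable_fst)
  have hG := hf.indicator hE
  have e : ∀ ω, ({ω | renewalTime W₀ B₀ k ξ 𝒲 𝒵 n ω ≤ t ∧
      t < renewalTime W₀ B₀ k ξ 𝒲 𝒵 (n + 1) ω}).indicator
        (fun ω => f (whiteBalls W₀ B₀ k ξ 𝒲 𝒵 n ω)) ω =
      E.indicator (fun p => f p.1.2) (stateOf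
        (urn W₀ B₀ k (fun n m => ξ n m ω) (fun n => 𝒲 n ω) (fun n => 𝒵 n ω) n)) := by
    intro ω
    simp only [Set.indicator_apply, E, renewalTime, time_urn_succ, Set.mem_ofPred_eq]
    rfl
  refine (lintegral_congr e).trans ?_
  rw [← lintegral_map hG (h.measurable_stateOf n), h.map_stateOf hτ n,
    lintegral_prod _ hG.aemeasurable]
  refine lintegral_congr fun z => ?_
  by_cases hz : z.1 ≤ t
  · have hset : MeasurableSet {c : ℕ → ℝ | t - z.1 < c (ringIdx m c)} :=
      measurableSet_lt measurable_const hmc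
    have : ∀ c : ℕ → ℝ, E.indicator (fun p => f p.1.2) (z, c) =
        {c : ℕ → ℝ | t - z.1 < c (ringIdx m c)}.indicator (fun _ => f z.2) c := by
      intro c
      simp only [Set.indicator_apply, E, Set.mem_ofPred_eq, hz, true_and, sub_lt_iff_lt_add']
    simp only [this]
    rw [lintegral_indicator_const hset, clockLaw_waiting (by omega) (sub_nonneg.2 hz), noRing,
      if_pos hz, mul_comm]
  · have : ∀ c : ℕ → ℝ, E.indicator (fun p => f p.1.2) (z, c) = 0 := by
      intro c
      simp only [Set.indicator_apply, E, Set.mem_ofPred_eq, hz, false_and, if_false]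
    simp only [this, lintegral_zero, noRing, hz, if_false, zero_mul]

/-- Almost surely the urn is not explosive, and the number of renewals up to time `t` is the
index of the last renewal before `t`. -/
lemma ae_renewalCount (hk : 0 < k) (hτ : 0 < W₀ + B₀) {t : ℝ} (ht : 0 ≤ t) : ∀ᵐ ω ∂P, ∀ n,
    renewalCount W₀ B₀ k ξ 𝒲 𝒵 t ω = n ↔
      renewalTime W₀ B₀ k ξ 𝒲 𝒵 n ω ≤ t ∧ t < renewalTime W₀ B₀ k ξ 𝒲 𝒵 (n + 1) ω := by
  let T := renewalTime W₀ B₀ k ξ 𝒲 𝒵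
  let E : ℕ → Set Ω := fun n => {ω | T n ω ≤ t ∧ t < T (n + 1) ω}
  have hEm : ∀ n, MeasurableSet (E n) := fun n =>
    (measurableSet_le (h.measurable_renewalTime n) measurable_const).inter
      (measurableSet_lt measurable_const (h.measurable_renewalTime (n + 1)))
  have hmono : ∀ᵐ ω ∂P, ∀ n, T n ω < T (n + 1) ω := ae_all_iff.2 fun n => h.ae_renewalTime_lt hτ n
  have hPE : ∀ n, P (E n) = ENNReal.ofReal (renewalProb (W₀ + B₀) k n t) := by
    intro n
    have := h.lintegral_renewalTime hk hτ n t fun _ => 1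
    simpa [renewalProb', ht] using this
  have hdisj : Pairwise (Function.onFun (AEDisjoint P) E) := by
    intro i j hij
    have hnull : P {ω | ¬ ∀ n, T n ω < T (n + 1) ω} = 0 := hmono
    refine measure_mono_null (fun ω hω => ?_) hnull
    intro hm
    have h1 := renewals_eq hm hω.1.1 hω.1.2
    have h2 := renewals_eq hm hω.2.1 hω.2.2
    exact hij (h1.symm.trans h2)
  -- the probabilities of the disjoint events `E n` sum to one
  have hU : P (⋃ n, E n) = 1 := by
    rw [measure_iUnion₀ hdisj fun n => (hEm n).nullMeasurableSet]
    simp only [hPE]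
    rw [← ENNReal.ofReal_tsum_of_nonneg (fun n => renewalProb_nonneg n ht)
      (hasSum_renewalProb hτ hk ht).summable, (hasSum_renewalProb hτ hk ht).tsum_eq,
      ENNReal.ofReal_one]
  have hex : ∀ᵐ ω ∂P, ω ∈ ⋃ n, E n :=
    (prob_compl_eq_zero_iff (MeasurableSet.iUnion hEm)).2 hU
  filter_upwards [hmono, hex] with ω hm hω n
  obtain ⟨i, hi⟩ := Set.mem_iUnion.1 hω
  have h1 : renewalCount W₀ B₀ k ξ 𝒲 𝒵 t ω = i := renewals_eq hm hi.1 hi.2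
  constructor
  · intro hn
    rw [← hn, h1]
    exact hi
  · intro hn
    exact renewals_eq hm hn.1 hn.2

lemma lintegral_renewalCount (hk : 0 < k) (hτ : 0 < W₀ + B₀) {t : ℝ} (ht : 0 ≤ t)
    (F : ℕ × Finset ℕ → ℝ≥0∞) :
    ∫⁻ ω, F (renewalCount W₀ B₀ k ξ 𝒲 𝒵 t ω,
        whiteBalls W₀ B₀ k ξ 𝒲 𝒵 (renewalCount W₀ B₀ k ξ 𝒲 𝒵 t ω) ω) ∂P =
      ∑' n, ENNReal.ofReal (renewalProb (W₀ + B₀) k n t) *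
        ∫⁻ ω, F (n, whiteBalls W₀ B₀ k ξ 𝒲 𝒵 n ω) ∂P := by
  have hc := h.measurable_renewalCount (W₀ := W₀) (B₀ := B₀) (k := k) t
  have hm : ∀ n, MeasurableSet (renewalCount W₀ B₀ k ξ 𝒲 𝒵 t ⁻¹' {n}) := fun n =>
    hc (measurableSet_singleton n)
  have huniv : ⋃ n, renewalCount W₀ B₀ k ξ 𝒲 𝒵 t ⁻¹' {n} = Set.univ := by
    ext ω; simp
  rw [← setLIntegral_univ, ← huniv, lintegral_iUnion hm (fun i j hij => by
    rw [Function.onFun, Set.disjoint_left]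
    rintro ω rfl h2
    exact hij h2)]
  refine tsum_congr fun n => ?_
  have h1 := h.lintegral_renewalTime hk hτ n t fun A => F (n, A)
  rw [renewalProb', if_pos ht] at h1
  rw [← h1]
  have hset : (renewalCount W₀ B₀ k ξ 𝒲 𝒵 t ⁻¹' {n} : Set Ω) =ᵐ[P]
      {ω | renewalTime W₀ B₀ k ξ 𝒲 𝒵 n ω ≤ t ∧ t < renewalTime W₀ B₀ k ξ 𝒲 𝒵 (n + 1) ω} := by
    filter_upwards [h.ae_renewalCount hk hτ ht] with ω hω
    exact propext (hω n)
  rw [← setLIntegral_congr hset]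
  refine setLIntegral_congr_fun (hm n) fun ω hω => ?_
  rw [Set.mem_preimage, Set.mem_singleton_iff] at hω
  simp only [hω]

/-- The joint law of the number of renewals up to time `t` and of the white balls at time `t`. -/
theorem map_renewalCount (hk : 0 < k) (hτ : 0 < W₀ + B₀) {t : ℝ} (ht : 0 ≤ t) :
    P.map (fun ω => (renewalCount W₀ B₀ k ξ 𝒲 𝒵 t ω,
        whiteBalls W₀ B₀ k ξ 𝒲 𝒵 (renewalCount W₀ B₀ k ξ 𝒲 𝒵 t ω) ω)) =
      Measure.sum fun n => ENNReal.ofReal (renewalProb (W₀ + B₀) k n t) •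
        P.map fun ω => (n, whiteBalls W₀ B₀ k ξ 𝒲 𝒵 n ω) := by
  refine Measure.ext_of_lintegral _ fun F hF => ?_
  rw [lintegral_map hF (h.measurable_whiteBalls_renewalCount t), h.lintegral_renewalCount hk hτ ht,
    lintegral_sum_measure]
  refine tsum_congr fun n => ?_
  rw [lintegral_smul_measure, lintegral_map hF (measurable_const.prodMk (h.measurable_whiteBalls n))]
  rfl

/-- Expectations of functions of the urn at time `t`. -/
theorem hasSum_integral_renewalCount {E : Type*} [NormedAddCommGroup E] [NormedSpace ℝ E]
    (hk : 0 < k) (hτ : 0 < W₀ + B₀) {t : ℝ} (ht : 0 ≤ t)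
    {F : ℕ × Finset ℕ → E} {g : ℕ → ℝ}
    (hF : ∀ n, ∀ᵐ ω ∂P, ‖F (n, whiteBalls W₀ B₀ k ξ 𝒲 𝒵 n ω)‖ ≤ g n)
    (hg : Summable fun n => renewalProb (W₀ + B₀) k n t * g n) :
    Integrable (fun ω => F (renewalCount W₀ B₀ k ξ 𝒲 𝒵 t ω,
        whiteBalls W₀ B₀ k ξ 𝒲 𝒵 (renewalCount W₀ B₀ k ξ 𝒲 𝒵 t ω) ω)) P ∧
      HasSum (fun n => renewalProb (W₀ + B₀) k n t •
          ∫ ω, F (n, whiteBalls W₀ B₀ k ξ 𝒲 𝒵 n ω) ∂P)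
        (∫ ω, F (renewalCount W₀ B₀ k ξ 𝒲 𝒵 t ω,
          whiteBalls W₀ B₀ k ξ 𝒲 𝒵 (renewalCount W₀ B₀ k ξ 𝒲 𝒵 t ω) ω) ∂P) := by
  have hm := h.measurable_whiteBalls_renewalCount (W₀ := W₀) (B₀ := B₀) (k := k) t
  have hFm : StronglyMeasurable F := StronglyMeasurable.of_discrete
  have hint : Integrable (fun ω => F (renewalCount W₀ B₀ k ξ 𝒲 𝒵 t ω,
        whiteBalls W₀ B₀ k ξ 𝒲 𝒵 (renewalCount W₀ B₀ k ξ 𝒲 𝒵 t ω) ω)) P := by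
    refine ⟨(hFm.comp_measurable hm).aestronglyMeasurable, ?_⟩
    rw [HasFiniteIntegral, h.lintegral_renewalCount hk hτ ht fun p => ‖F p‖ₑ]
    have hle : ∀ n, ENNReal.ofReal (renewalProb (W₀ + B₀) k n t) *
        ∫⁻ ω, ‖F (n, whiteBalls W₀ B₀ k ξ 𝒲 𝒵 n ω)‖ₑ ∂P ≤
        ENNReal.ofReal (renewalProb (W₀ + B₀) k n t * g n) := by
      intro n
      rw [ENNReal.ofReal_mul (renewalProb_nonneg n ht)]
      gcongr
      calc ∫⁻ ω, ‖F (n, whiteBalls W₀ B₀ k ξ 𝒲 𝒵 n ω)‖ₑ ∂P ≤ ∫⁻ ω, ENNReal.ofReal (g n) ∂P := by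
            refine lintegral_mono_ae ?_
            filter_upwards [hF n] with ω hω
            rw [← ofReal_norm]
            exact ENNReal.ofReal_le_ofReal hω
        _ = ENNReal.ofReal (g n) := by simp
    refine (ENNReal.tsum_le_tsum hle).trans_lt ?_
    have hg0 : ∀ n, 0 ≤ g n := fun n => by
      obtain ⟨ω, hω⟩ := (hF n).exists
      exact (norm_nonneg _).trans hω
    rw [← ENNReal.ofReal_tsum_of_nonneg
      (fun n => mul_nonneg (renewalProb_nonneg n ht) (hg0 n)) hg]
    exact ENNReal.ofReal_lt_top
  refine ⟨hint, ?_⟩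
  have hint' : Integrable F (P.map (fun ω => (renewalCount W₀ B₀ k ξ 𝒲 𝒵 t ω,
        whiteBalls W₀ B₀ k ξ 𝒲 𝒵 (renewalCount W₀ B₀ k ξ 𝒲 𝒵 t ω) ω))) :=
    (integrable_map_measure hFm.aestronglyMeasurable hm.aemeasurable).2 hint
  have hmap := integral_map hm.aemeasurable
    (hFm.aestronglyMeasurable (μ := P.map (fun ω => (renewalCount W₀ B₀ k ξ 𝒲 𝒵 t ω,
        whiteBalls W₀ B₀ k ξ 𝒲 𝒵 (renewalCount W₀ B₀ k ξ 𝒲 𝒵 t ω) ω))))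
  rw [h.map_renewalCount hk hτ ht] at hint' hmap
  have := hasSum_integral_measure hint'
  rw [hmap] at this
  convert this using 2 with n
  rw [integral_smul_measure, ENNReal.toReal_ofReal (renewalProb_nonneg n ht),
    integral_map (measurable_const.prodMk (h.measurable_whiteBalls n)).aemeasurable
      hFm.aestronglyMeasurable]

end IsDriving

end

end

/-! ### The moments of the colours after `n` renewals -/

section

/-- The picked ball is uniformly distributed. -/
lemma integral_ringLaw_fst {m : ℕ} (hm : 0 < m) (G : ℕ → ℝ) :
    ∫ q, G q.1 ∂(ringLaw m) = 1 / m * ∑ j ∈ Finset.range m, G j := by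
  have hfin : IsFiniteMeasure (expDens m) := ⟨by rw [expDens_univ hm]; exact ENNReal.ofReal_lt_top⟩
  have hG : Measurable fun q : ℕ × ℝ => G q.1 := (Measurable.of_discrete (f := G)).comp measurable_fst
  rw [ringLaw, integral_finsetSum_measure]
  · rw [Finset.mul_sum]
    refine Finset.sum_congr rfl fun j _ => ?_
    rw [integral_map measurable_prodMk_left.aemeasurable hG.aestronglyMeasurable]
    simp only [integral_const, Measure.real, expDens_univ hm, smul_eq_mul]
    rw [ENNReal.toReal_ofReal (by positivity)]
  · intro j _
    rw [integrable_map_measure hG.aestronglyMeasurable measurable_prodMk_left.aemeasurable]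
    exact integrable_const (G j)

lemma card_addWhite {k m : ℕ} {A : Finset ℕ} (hA : A ⊆ Finset.range m) (e : ℕ × ℕ) (j : ℕ) :
    (addWhite k m A e j).card = A.card + if j ∈ A then e.1 else k - e.2 := by
  rw [addWhite, Finset.card_union_of_disjoint, Nat.card_Ico, Nat.add_sub_cancel_left]
  rw [Finset.disjoint_left]
  intro i hi hi'
  have h1 := Finset.mem_range.1 (hA hi)
  have h2 := (Finset.mem_Ico.1 hi').1
  omega

lemma sum_card_addWhite {k m : ℕ} {A : Finset ℕ} (hA : A ⊆ Finset.range m) (e : ℕ × ℕ)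
    (G : ℕ → ℝ) : ∑ j ∈ Finset.range m, G (addWhite k m A e j).card =
      A.card * G (A.card + e.1) + (m - A.card) * G (A.card + (k - e.2)) := by
  have h1 : ∀ j, G (addWhite k m A e j).card =
      if j ∈ A then G (A.card + e.1) else G (A.card + (k - e.2)) := by
    intro j
    rw [card_addWhite hA]
    split_ifs <;> rfl
  have h2 : (Finset.range m).filter (· ∈ A) = A := by
    ext i; simpa using fun hi => Finset.mem_range.1 (hA hi)
  have h3 : ((Finset.range m).filter (· ∉ A)).card = m - A.card := by
    have := Finset.card_filter_add_card_filter_not (s := Finset.range m) (· ∈ A)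
    rw [h2, Finset.card_range] at this
    omega
  have h4 : A.card ≤ m := by simpa using Finset.card_le_card hA
  rw [Finset.sum_congr rfl fun j _ => h1 j, Finset.sum_ite, h2, Finset.sum_const, Finset.sum_const,
    h3, nsmul_eq_mul, nsmul_eq_mul, Nat.cast_sub h4]

section

variable {Ω : Type*} [MeasurableSpace Ω] {P : Measure Ω} {W₀ B₀ k : ℕ}
  {ρ : Measure (ℕ × ℕ)} {ξ : ℕ → ℕ → Ω → ℝ} {𝒲 𝒵 : ℕ → Ω → ℕ}

namespace IsDriving

variable (h : IsDriving ρ ξ 𝒲 𝒵 P)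

include h

/-- The labels of the white balls are those of balls in the urn. This needs `𝒲 ≤ k`: otherwise
`addWhite` would use labels of balls that are not there. -/
lemma ae_whiteBalls_subset (hρ : ∀ᵐ p ∂ρ, p.1 ≤ k ∧ p.2 ≤ k) : ∀ᵐ ω ∂P, ∀ n,
    whiteBalls W₀ B₀ k ξ 𝒲 𝒵 n ω ⊆ Finset.range (W₀ + B₀ + k * n) := by
  have h1 : ∀ᵐ ω ∂P, ∀ n, 𝒲 n ω ≤ k := ae_all_iff.2 fun n => by
    have h2 := hρ
    rw [← (h.law_entries n).map_eq] at h2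
    filter_upwards [ae_of_ae_map (h.measurable_entries n).aemeasurable h2] with ω hω using hω.1
  filter_upwards [h1] with ω hω n
  induction n with
  | zero =>
    intro i hi
    have hi' : i ∈ Finset.range W₀ := hi
    simp only [Finset.mem_range] at hi' ⊢
    omega
  | succ n ih =>
    have e : whiteBalls W₀ B₀ k ξ 𝒲 𝒵 (n + 1) ω = addWhite k (W₀ + B₀ + k * n)
        (whiteBalls W₀ B₀ k ξ 𝒲 𝒵 n ω) (𝒲 n ω, 𝒵 n ω)
        (ringIdx (W₀ + B₀ + k * n)
          (urn W₀ B₀ k (fun n m => ξ n m ω) (fun n => 𝒲 n ω) (fun n => 𝒵 n ω) n).clock) :=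
      congrArg (fun s => s.1.2) (stateOf_urn_succ (W₀ := W₀) (B₀ := B₀) (k := k)
        (fun n m => ξ n m ω) (fun n => 𝒲 n ω) (fun n => 𝒵 n ω) n)
    rw [e]
    intro i hi
    rw [addWhite, Finset.mem_union, Finset.mem_Ico] at hi
    rw [Finset.mem_range, mul_add, mul_one]
    have hWn := hω n
    rcases hi with hi | ⟨_, hi⟩
    · have := Finset.mem_range.1 (ih hi)
      omega
    · have : (if ringIdx (W₀ + B₀ + k * n)
          (urn W₀ B₀ k (fun n m => ξ n m ω) (fun n => 𝒲 n ω) (fun n => 𝒵 n ω) n).clock ∈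
            whiteBalls W₀ B₀ k ξ 𝒲 𝒵 n ω then 𝒲 n ω else k - 𝒵 n ω) ≤ k := by
        split_ifs <;> omega
      simp only at hi
      omega

variable [IsProbabilityMeasure P] [IsProbabilityMeasure ρ]

/-- One step of the chain of the colours. -/
lemma integral_whiteBalls_succ (hτ : 0 < W₀ + B₀) (n : ℕ) {F : Finset ℕ → ℝ}
    (hF : Integrable (fun ω => F (whiteBalls W₀ B₀ k ξ 𝒲 𝒵 (n + 1) ω)) P) :
    Integrable (fun ω => ∫ e, 1 / (W₀ + B₀ + k * n : ℕ) * ∑ j ∈ Finset.range (W₀ + B₀ + k * n),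
        F (addWhite k (W₀ + B₀ + k * n) (whiteBalls W₀ B₀ k ξ 𝒲 𝒵 n ω) e j) ∂ρ) P ∧
      ∫ ω, F (whiteBalls W₀ B₀ k ξ 𝒲 𝒵 (n + 1) ω) ∂P =
        ∫ ω, (∫ e, 1 / (W₀ + B₀ + k * n : ℕ) * ∑ j ∈ Finset.range (W₀ + B₀ + k * n),
          F (addWhite k (W₀ + B₀ + k * n) (whiteBalls W₀ B₀ k ξ 𝒲 𝒵 n ω) e j) ∂ρ) ∂P := by
  have := isProbabilityMeasure_stateLaw (k := k) hτ ρ n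
  set m := W₀ + B₀ + k * n with hm
  have hm0 : 0 < m := by omega
  have := isProbabilityMeasure_ringLaw hm0
  have hst : ∀ n, Measurable fun ω =>
      (renewalTime W₀ B₀ k ξ 𝒲 𝒵 n ω, whiteBalls W₀ B₀ k ξ 𝒲 𝒵 n ω) := fun n =>
    (h.measurable_renewalTime n).prodMk (h.measurable_whiteBalls n)
  have hFm : Measurable fun z : ℝ × Finset ℕ => F z.2 :=
    (Measurable.of_discrete (f := F)).comp measurable_snd
  have hF1 : Integrable (fun z : ℝ × Finset ℕ => F z.2) (stateLaw W₀ B₀ k ρ (n + 1)) := by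
    rw [← h.map_state hτ (n + 1), integrable_map_measure hFm.aestronglyMeasurable
      (hst (n + 1)).aemeasurable]
    exact hF
  have e1 : ∫ ω, F (whiteBalls W₀ B₀ k ξ 𝒲 𝒵 (n + 1) ω) ∂P =
      ∫ z, F z.2 ∂(stateLaw W₀ B₀ k ρ (n + 1)) := by
    rw [← h.map_state hτ (n + 1), integral_map (hst (n + 1)).aemeasurable hFm.aestronglyMeasurable]
  rw [stateLaw, ← hm] at hF1 e1
  rw [integrable_map_measure hFm.aestronglyMeasurable (measurable_nextState k m).aemeasurable] at hF1
  rw [integral_map (measurable_nextState k m).aemeasurable hFm.aestronglyMeasurable] at e1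
  have hin : ∀ x : (ℝ × Finset ℕ) × (ℕ × ℕ),
      ∫ q, F (Function.uncurry (nextState k m) (x, q)).2 ∂(ringLaw m) =
        1 / m * ∑ j ∈ Finset.range m, F (addWhite k m x.1.2 x.2 j) := fun x =>
    integral_ringLaw_fst hm0 fun j => F (addWhite k m x.1.2 x.2 j)
  have hF2 : Integrable (fun x : (ℝ × Finset ℕ) × (ℕ × ℕ) =>
      1 / m * ∑ j ∈ Finset.range m, F (addWhite k m x.1.2 x.2 j))
      ((stateLaw W₀ B₀ k ρ n).prod ρ) := by
    have := hF1.integral_prod_left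
    refine this.congr (Eventually.of_forall fun x => hin x)
  have e2 : ∫ ω, F (whiteBalls W₀ B₀ k ξ 𝒲 𝒵 (n + 1) ω) ∂P =
      ∫ x, 1 / m * ∑ j ∈ Finset.range m, F (addWhite k m x.1.2 x.2 j)
        ∂((stateLaw W₀ B₀ k ρ n).prod ρ) :=
    e1.trans ((integral_prod _ hF1).trans (integral_congr_ae (Eventually.of_forall hin)))
  have hF3 := hF2.integral_prod_left
  rw [integral_prod _ hF2] at e2
  have hIm : Measurable fun z : ℝ × Finset ℕ =>
      ∫ e, 1 / m * ∑ j ∈ Finset.range m, F (addWhite k m z.2 e j) ∂ρ :=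
    (Measurable.of_discrete (f := fun A : Finset ℕ =>
      ∫ e, 1 / (m : ℝ) * ∑ j ∈ Finset.range m, F (addWhite k m A e j) ∂ρ)).comp measurable_snd
  rw [← h.map_state hτ n] at hF3 e2
  rw [integrable_map_measure hIm.aestronglyMeasurable (hst n).aemeasurable] at hF3
  rw [integral_map (hst n).aemeasurable hIm.aestronglyMeasurable] at e2
  exact ⟨hF3, e2⟩

end IsDriving

/-- The coordinate `(k - μ_𝒲) w - (k - μ_𝒵) b` of an urn with `w` white and `b = m - w` blue balls,
an eigenfunction of the mean replacement matrix for the eigenvalue `μ_𝒲 + μ_𝒵 - k`, written in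
terms of `m` and `w`. -/
def eigenCoord (k : ℕ) (ρ : Measure (ℕ × ℕ)) (m w : ℕ) : ℝ :=
  (2 * k - meanW ρ - meanZ ρ) * w - (k - meanZ ρ) * m

section Means

variable [IsProbabilityMeasure ρ]

lemma integrable_fst (hρ : ∀ᵐ p ∂ρ, p.1 ≤ k ∧ p.2 ≤ k) : Integrable (fun p => (p.1 : ℝ)) ρ := by
  refine Integrable.of_bound (Measurable.of_discrete.aestronglyMeasurable) k ?_
  filter_upwards [hρ] with p hp
  simpa using hp.1

lemma integrable_snd (hρ : ∀ᵐ p ∂ρ, p.1 ≤ k ∧ p.2 ≤ k) : Integrable (fun p => (p.2 : ℝ)) ρ := by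
  refine Integrable.of_bound (Measurable.of_discrete.aestronglyMeasurable) k ?_
  filter_upwards [hρ] with p hp
  simpa using hp.2

lemma meanW_le (hρ : ∀ᵐ p ∂ρ, p.1 ≤ k ∧ p.2 ≤ k) : meanW ρ ≤ k := by
  have := integral_mono_ae (integrable_fst hρ) (integrable_const (k : ℝ)) (by
    filter_upwards [hρ] with p hp
    exact_mod_cast hp.1)
  simpa [meanW] using this

lemma meanZ_le (hρ : ∀ᵐ p ∂ρ, p.1 ≤ k ∧ p.2 ≤ k) : meanZ ρ ≤ k := by
  have := integral_mono_ae (integrable_snd hρ) (integrable_const (k : ℝ)) (by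
    filter_upwards [hρ] with p hp
    exact_mod_cast hp.2)
  simpa [meanZ] using this

lemma abs_eigenCoord_le (hρ : ∀ᵐ p ∂ρ, p.1 ≤ k ∧ p.2 ≤ k) {m w : ℕ} (hw : w ≤ m) :
    |eigenCoord k ρ m w| ≤ (2 * k - meanW ρ - meanZ ρ) * m := by
  have h1 := meanW_le hρ
  have h2 := meanZ_le hρ
  have h3 : (w : ℝ) ≤ m := Nat.cast_le.2 hw
  have h4 : (0 : ℝ) ≤ w := Nat.cast_nonneg w
  rw [eigenCoord, abs_le]
  constructor <;> nlinarith

end Means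

/-- The second-order expansion of the square of the eigenvector coordinate over one renewal;
`m` and `w` are the numbers of balls and of white balls, `x` and `y` the entries. -/
lemma sq_drift_le {m w k c Δ x y : ℝ} (hm0 : 0 < m) (hw0 : 0 ≤ w) (hw' : w ≤ m) (hc0 : 0 ≤ c)
    (hk0 : 0 ≤ k) (hc : c ≤ Δ) (hx0 : 0 ≤ x) (hx : x ≤ k) (hy0 : 0 ≤ y) (hy : y ≤ k) :
    1 / m * (w * (Δ * (w + x) - c * (m + k)) ^ 2 +
      (m - w) * (Δ * (w + (k - y)) - c * (m + k)) ^ 2) ≤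
      ((Δ * w - c * m) ^ 2 + 2 * (Δ * w - c * m) * (-c * k + (m - w) / m * Δ * k) + (k * Δ) ^ 2) +
        (2 * (Δ * w - c * m) * (w / m * Δ) * x - 2 * (Δ * w - c * m) * ((m - w) / m * Δ) * y) := by
  have d1 : (Δ * x - c * k) ^ 2 ≤ (k * Δ) ^ 2 := by
    apply sq_le_sq' <;> nlinarith
  have d2 : (Δ * (k - y) - c * k) ^ 2 ≤ (k * Δ) ^ 2 := by
    apply sq_le_sq' <;> nlinarith
  have key : 1 / m * (w * (Δ * (w + x) - c * (m + k)) ^ 2 +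
      (m - w) * (Δ * (w + (k - y)) - c * (m + k)) ^ 2) =
      ((Δ * w - c * m) ^ 2 + 2 * (Δ * w - c * m) * (-c * k + (m - w) / m * Δ * k)) +
      (2 * (Δ * w - c * m) * (w / m * Δ) * x - 2 * (Δ * w - c * m) * ((m - w) / m * Δ) * y) +
      1 / m * (w * (Δ * x - c * k) ^ 2 + (m - w) * (Δ * (k - y) - c * k) ^ 2) := by
    field_simp
    ring
  have key2 : 1 / m * (w * (Δ * x - c * k) ^ 2 + (m - w) * (Δ * (k - y) - c * k) ^ 2) ≤
      (k * Δ) ^ 2 := by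
    rw [one_div, inv_mul_le_iff₀ hm0]
    nlinarith [mul_le_mul_of_nonneg_left d1 hw0, mul_le_mul_of_nonneg_left d2 (sub_nonneg.2 hw')]
  rw [key]
  linarith

namespace IsDriving

variable (h : IsDriving ρ ξ 𝒲 𝒵 P) [IsProbabilityMeasure P]

include h

lemma integrable_comp_card (hρ : ∀ᵐ p ∂ρ, p.1 ≤ k ∧ p.2 ≤ k) (n : ℕ) (G : ℕ → ℝ) :
    Integrable (fun ω => G (whiteBalls W₀ B₀ k ξ 𝒲 𝒵 n ω).card) P := by
  have hm : Measurable fun ω => G (whiteBalls W₀ B₀ k ξ 𝒲 𝒵 n ω).card :=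
    (Measurable.of_discrete (f := fun A : Finset ℕ => G A.card)).comp (h.measurable_whiteBalls n)
  refine Integrable.of_bound hm.aestronglyMeasurable
    (∑ i ∈ Finset.range (W₀ + B₀ + k * n + 1), |G i|) ?_
  filter_upwards [h.ae_whiteBalls_subset (W₀ := W₀) (B₀ := B₀) hρ] with ω hω
  have h1 := Finset.card_le_card (hω n)
  rw [Finset.card_range] at h1
  exact Finset.single_le_sum (f := fun i => |G i|) (fun _ _ => abs_nonneg _)
    (Finset.mem_range.2 (Nat.lt_succ_of_le h1))

variable [IsProbabilityMeasure ρ]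

/-- The drift of a function of the number of white balls. -/
lemma integral_card_succ (hτ : 0 < W₀ + B₀) (hρ : ∀ᵐ p ∂ρ, p.1 ≤ k ∧ p.2 ≤ k) (n : ℕ)
    (G : ℕ → ℝ) :
    Integrable (fun ω => ∫ e, 1 / (W₀ + B₀ + k * n : ℕ) *
        ((whiteBalls W₀ B₀ k ξ 𝒲 𝒵 n ω).card * G ((whiteBalls W₀ B₀ k ξ 𝒲 𝒵 n ω).card + e.1) +
          ((W₀ + B₀ + k * n : ℕ) - (whiteBalls W₀ B₀ k ξ 𝒲 𝒵 n ω).card) *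
            G ((whiteBalls W₀ B₀ k ξ 𝒲 𝒵 n ω).card + (k - e.2))) ∂ρ) P ∧
    ∫ ω, G (whiteBalls W₀ B₀ k ξ 𝒲 𝒵 (n + 1) ω).card ∂P =
      ∫ ω, (∫ e, 1 / (W₀ + B₀ + k * n : ℕ) *
        ((whiteBalls W₀ B₀ k ξ 𝒲 𝒵 n ω).card * G ((whiteBalls W₀ B₀ k ξ 𝒲 𝒵 n ω).card + e.1) +
          ((W₀ + B₀ + k * n : ℕ) - (whiteBalls W₀ B₀ k ξ 𝒲 𝒵 n ω).card) *
            G ((whiteBalls W₀ B₀ k ξ 𝒲 𝒵 n ω).card + (k - e.2))) ∂ρ) ∂P := by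
  obtain ⟨h1, h2⟩ := h.integral_whiteBalls_succ (F := fun A => G A.card) hτ n
    (h.integrable_comp_card hρ (n + 1) G)
  have h3 := h.ae_whiteBalls_subset (W₀ := W₀) (B₀ := B₀) hρ
  refine ⟨h1.congr ?_, h2.trans (integral_congr_ae ?_)⟩ <;>
  · filter_upwards [h3] with ω hω
    exact integral_congr_ae (μ := ρ) (Eventually.of_forall fun e =>
      congrArg (fun x => 1 / ((W₀ + B₀ + k * n : ℕ) : ℝ) * x) (sum_card_addWhite (hω n) e G))

/-- The eigenfunction is multiplied by a constant factor on average. -/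
lemma integral_eigenCoord_succ (hτ : 0 < W₀ + B₀) (hρ : ∀ᵐ p ∂ρ, p.1 ≤ k ∧ p.2 ≤ k) (n : ℕ) :
    ∫ ω, eigenCoord k ρ (W₀ + B₀ + k * (n + 1)) (whiteBalls W₀ B₀ k ξ 𝒲 𝒵 (n + 1) ω).card ∂P =
      (1 + (k - (2 * k - meanW ρ - meanZ ρ)) / (W₀ + B₀ + k * n : ℕ)) *
        ∫ ω, eigenCoord k ρ (W₀ + B₀ + k * n) (whiteBalls W₀ B₀ k ξ 𝒲 𝒵 n ω).card ∂P := by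
  obtain ⟨-, h2⟩ := h.integral_card_succ (W₀ := W₀) (B₀ := B₀) hτ hρ n
    (eigenCoord k ρ (W₀ + B₀ + k * (n + 1)))
  rw [h2, ← integral_const_mul]
  refine integral_congr_ae (Eventually.of_forall fun ω => ?_)
  simp only
  generalize (whiteBalls W₀ B₀ k ξ 𝒲 𝒵 n ω).card = w
  have hm0 : ((W₀ + B₀ + k * n : ℕ) : ℝ) ≠ 0 := by rw [Ne, Nat.cast_eq_zero]; omega
  have e1 : ((W₀ + B₀ + k * (n + 1) : ℕ) : ℝ) = (W₀ + B₀ + k * n : ℕ) + k := by push_cast; ring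
  unfold eigenCoord
  rw [e1]
  generalize ((W₀ + B₀ + k * n : ℕ) : ℝ) = m at *
  set Δ := 2 * k - meanW ρ - meanZ ρ with hΔ
  have hint : ∀ᵐ e ∂ρ, 1 / m * (w * (Δ * (w + e.1 : ℕ) - (k - meanZ ρ) * (m + k)) +
      (m - w) * (Δ * (w + (k - e.2) : ℕ) - (k - meanZ ρ) * (m + k))) =
      (Δ * w - (k - meanZ ρ) * m + (-(k - meanZ ρ) * k + (m - w) / m * Δ * k)) +
        (w / m * Δ * e.1 - (m - w) / m * Δ * e.2) := by
    filter_upwards [hρ] with e he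
    rw [Nat.cast_add, Nat.cast_add, Nat.cast_sub he.2]
    field_simp
    ring
  have i1 := (integrable_fst hρ).const_mul (w / m * Δ)
  have i2 := (integrable_snd hρ).const_mul ((m - w) / m * Δ)
  have i3 : Integrable (fun e : ℕ × ℕ => w / m * Δ * (e.1 : ℝ) - (m - w) / m * Δ * (e.2 : ℝ)) ρ :=
    i1.sub i2
  rw [integral_congr_ae hint, integral_add (integrable_const _) i3, integral_sub i1 i2,
    integral_const_mul, integral_const_mul, integral_const]
  simp only [probReal_univ, one_smul]
  change _ + (w / m * Δ * meanW ρ - (m - w) / m * Δ * meanZ ρ) = _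
  rw [hΔ]
  field_simp
  ring

/-- The second moment of the eigenfunction; one renewal changes it by at most `k Δ`, whence the
last term. -/
lemma integral_eigenCoord_sq_succ (hτ : 0 < W₀ + B₀) (hρ : ∀ᵐ p ∂ρ, p.1 ≤ k ∧ p.2 ≤ k) (n : ℕ) :
    ∫ ω, eigenCoord k ρ (W₀ + B₀ + k * (n + 1)) (whiteBalls W₀ B₀ k ξ 𝒲 𝒵 (n + 1) ω).card ^ 2 ∂P ≤
      (1 + 2 * (k - (2 * k - meanW ρ - meanZ ρ)) / (W₀ + B₀ + k * n : ℕ)) *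
        ∫ ω, eigenCoord k ρ (W₀ + B₀ + k * n) (whiteBalls W₀ B₀ k ξ 𝒲 𝒵 n ω).card ^ 2 ∂P +
      (k * (2 * k - meanW ρ - meanZ ρ)) ^ 2 := by
  obtain ⟨h1, h2⟩ := h.integral_card_succ (W₀ := W₀) (B₀ := B₀) hτ hρ n
    (fun w => eigenCoord k ρ (W₀ + B₀ + k * (n + 1)) w ^ 2)
  have i0 := h.integrable_comp_card (W₀ := W₀) (B₀ := B₀) hρ n
    (fun w => eigenCoord k ρ (W₀ + B₀ + k * n) w ^ 2)
  rw [h2, ← integral_const_mul]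
  have hc : (k * (2 * k - meanW ρ - meanZ ρ)) ^ 2 =
      ∫ _ω, (k * (2 * k - meanW ρ - meanZ ρ)) ^ 2 ∂P := by simp
  rw [hc, ← integral_add (i0.const_mul _) (integrable_const _)]
  refine integral_mono_ae h1 ((i0.const_mul _).add (integrable_const _)) ?_
  filter_upwards [h.ae_whiteBalls_subset (W₀ := W₀) (B₀ := B₀) hρ] with ω hω
  have hw := Finset.card_le_card (hω n)
  rw [Finset.card_range] at hw
  generalize (whiteBalls W₀ B₀ k ξ 𝒲 𝒵 n ω).card = w at *
  have hm0 : (0 : ℝ) < (W₀ + B₀ + k * n : ℕ) := by rw [Nat.cast_pos]; omega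
  have hw' : (w : ℝ) ≤ (W₀ + B₀ + k * n : ℕ) := Nat.cast_le.2 hw
  have e1 : ((W₀ + B₀ + k * (n + 1) : ℕ) : ℝ) = (W₀ + B₀ + k * n : ℕ) + k := by push_cast; ring
  unfold eigenCoord
  rw [e1]
  generalize ((W₀ + B₀ + k * n : ℕ) : ℝ) = m at *
  have hW := meanW_le hρ
  have hZ := meanZ_le hρ
  set Δ := 2 * k - meanW ρ - meanZ ρ with hΔ
  set v := Δ * w - (k - meanZ ρ) * m with hv
  have hw0 : (0 : ℝ) ≤ w := Nat.cast_nonneg w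
  have hk0 : (0 : ℝ) ≤ k := Nat.cast_nonneg k
  have hle : ∀ᵐ e ∂ρ, 1 / m * (w * (Δ * (w + e.1 : ℕ) - (k - meanZ ρ) * (m + k)) ^ 2 +
      (m - w) * (Δ * (w + (k - e.2) : ℕ) - (k - meanZ ρ) * (m + k)) ^ 2) ≤
      (v ^ 2 + 2 * v * (-(k - meanZ ρ) * k + (m - w) / m * Δ * k) + (k * Δ) ^ 2) +
        (2 * v * (w / m * Δ) * e.1 - 2 * v * ((m - w) / m * Δ) * e.2) := by
    filter_upwards [hρ] with e he
    have he1 : (e.1 : ℝ) ≤ k := Nat.cast_le.2 he.1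
    have he2 : (e.2 : ℝ) ≤ k := Nat.cast_le.2 he.2
    have he1' : (0 : ℝ) ≤ e.1 := Nat.cast_nonneg _
    have he2' : (0 : ℝ) ≤ e.2 := Nat.cast_nonneg _
    rw [Nat.cast_add, Nat.cast_add, Nat.cast_sub he.2]
    exact sq_drift_le hm0 hw0 hw' (by linarith) (by linarith) (by rw [hΔ]; linarith) he1' he1 he2' he2
  have i1 := (integrable_fst hρ).const_mul (2 * v * (w / m * Δ))
  have i2 := (integrable_snd hρ).const_mul (2 * v * ((m - w) / m * Δ))
  have i4 : Integrable (fun e : ℕ × ℕ => 2 * v * (w / m * Δ) * (e.1 : ℝ) -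
      2 * v * ((m - w) / m * Δ) * (e.2 : ℝ)) ρ := i1.sub i2
  have i3 := (integrable_const (μ := ρ) (v ^ 2 + 2 * v * (-(k - meanZ ρ) * k + (m - w) / m * Δ * k) +
    (k * Δ) ^ 2)).add i4
  have hval : ∫ e, ((v ^ 2 + 2 * v * (-(k - meanZ ρ) * k + (m - w) / m * Δ * k) + (k * Δ) ^ 2) +
        (2 * v * (w / m * Δ) * e.1 - 2 * v * ((m - w) / m * Δ) * e.2)) ∂ρ =
      (1 + 2 * (k - Δ) / m) * v ^ 2 + (k * Δ) ^ 2 := by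
    rw [integral_add (integrable_const _) i4, integral_sub i1 i2,
      integral_const_mul, integral_const_mul, integral_const]
    simp only [probReal_univ, one_smul]
    change _ + (2 * v * (w / m * Δ) * meanW ρ - 2 * v * ((m - w) / m * Δ) * meanZ ρ) = _
    have hv2 : 2 * (k - Δ) / m * v ^ 2 = 2 * v * ((k - Δ) / m * v) := by ring
    rw [add_mul, one_mul, hv2]
    have hv3 : (k - Δ) / m * v = (-(k - meanZ ρ) * k + (m - w) / m * Δ * k) +
        (w / m * Δ * meanW ρ - (m - w) / m * Δ * meanZ ρ) := by
      rw [hv, hΔ]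
      field_simp
      ring
    rw [hv3]
    ring
  refine le_trans (integral_mono_of_nonneg (Eventually.of_forall fun e => ?_) i3 hle) hval.le
  simp only [Pi.zero_apply]
  have := sub_nonneg.2 hw'
  positivity

end IsDriving

end

end

/-! ### Averages over the number of renewals -/

section

/-- Powers expand into shifted rising factorials, with leading coefficient one. -/
lemma exists_pow_eq_sum_rising (s : ℝ) (p : ℕ) : ∃ d : ℕ → ℝ, d p = 1 ∧
    ∀ X : ℝ, X ^ p = ∑ r ∈ Finset.range (p + 1), d r * rising (X + s) r := by
  induction p with
  | zero => exact ⟨fun _ => 1, rfl, fun X => by simp⟩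
  | succ p ih =>
    obtain ⟨d, hd, h⟩ := ih
    refine ⟨fun r => (if r = 0 then 0 else d (r - 1)) - if r ≤ p then d r * (s + r) else 0,
      by simp [hd], fun X => ?_⟩
    have h1 : ∑ r ∈ Finset.range (p + 1 + 1), (if r = 0 then 0 else d (r - 1)) * rising (X + s) r =
        ∑ r ∈ Finset.range (p + 1), d r * rising (X + s) (r + 1) := by
      rw [Finset.sum_range_succ']
      simp
    have h2 : ∑ r ∈ Finset.range (p + 1 + 1), (if r ≤ p then d r * (s + r) else 0) *
        rising (X + s) r = ∑ r ∈ Finset.range (p + 1), d r * (s + r) * rising (X + s) r := by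
      rw [Finset.sum_range_succ, if_neg (by omega), zero_mul, add_zero]
      refine Finset.sum_congr rfl fun r hr => ?_
      rw [if_pos (Nat.lt_succ_iff.1 (Finset.mem_range.1 hr))]
    -- `X rising (X + s) r = rising (X + s) (r + 1) - (s + r) rising (X + s) r`
    simp only [sub_mul]
    rw [Finset.sum_sub_distrib, h1, h2, ← Finset.sum_sub_distrib, pow_succ, h, Finset.sum_mul]
    refine Finset.sum_congr rfl fun r _ => ?_
    rw [rising_succ]
    ring

/-- The ratio of the rising factorials of `τ / k + s` and of `τ / k`; as a function of `n` it is
multiplied by `1 + k s / (τ + k n)` in each step. -/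
def risingRatio (τ k : ℕ) (s : ℝ) (n : ℕ) : ℝ := rising (τ / k + s) n / rising (τ / k) n

variable {τ k : ℕ}

lemma cast_div_add (hk : 0 < k) (n : ℕ) : (τ : ℝ) / k + n = (τ + k * n : ℕ) / k := by
  have : (k : ℝ) ≠ 0 := (Nat.cast_pos.2 hk).ne'
  push_cast
  field_simp

lemma risingRatio_succ (hτ : 0 < τ) (hk : 0 < k) (s : ℝ) (n : ℕ) :
    risingRatio τ k s (n + 1) = (1 + k * s / (τ + k * n : ℕ)) * risingRatio τ k s n := by
  have hk' : (0 : ℝ) < k := Nat.cast_pos.2 hk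
  have hx : (0 : ℝ) < τ / k := div_pos (Nat.cast_pos.2 hτ) hk'
  have hm : ((τ + k * n : ℕ) : ℝ) ≠ 0 := by rw [Ne, Nat.cast_eq_zero]; omega
  have h1 := (rising_pos hx n).ne'
  have h2 : (τ : ℝ) / k + s + n = (τ + k * n : ℕ) / k + s := by
    rw [← cast_div_add hk]; ring
  rw [risingRatio, risingRatio, rising_succ, rising_succ, cast_div_add hk, h2]
  field_simp

@[simp] lemma risingRatio_zero (s : ℝ) : risingRatio τ k s 0 = 1 := by simp [risingRatio]

lemma risingRatio_zero_right (hτ : 0 < τ) (hk : 0 < k) (n : ℕ) : risingRatio τ k 0 n = 1 := by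
  have hx : (0 : ℝ) < τ / k := div_pos (Nat.cast_pos.2 hτ) (Nat.cast_pos.2 hk)
  rw [risingRatio, add_zero, div_self (rising_pos hx n).ne']

/-- The averages of powers of the number of balls, weighted by a ratio of rising factorials. -/
lemma exists_tsum_risingRatio_pow (hτ : 0 < τ) (hk : 0 < k) (s : ℝ) (p : ℕ) :
    ∃ C : ℝ, 0 ≤ C ∧ ∀ t : ℝ, 0 ≤ t →
      Summable (fun n => renewalProb τ k n t * (risingRatio τ k s n * (τ + k * n : ℕ) ^ p)) ∧
      |∑' n, renewalProb τ k n t * (risingRatio τ k s n * (τ + k * n : ℕ) ^ p) -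
        k ^ p * rising (τ / k + s) p * Real.exp (k * (s + p) * t)| ≤
          C * Real.exp (k * (s + p - 1) * t) := by
  obtain ⟨d, hd, h⟩ := exists_pow_eq_sum_rising s p
  have hk' : (0 : ℝ) < k := Nat.cast_pos.2 hk
  refine ⟨k ^ p * ∑ r ∈ Finset.range p, |d r * rising (τ / k + s) r|, by positivity,
    fun t ht => ?_⟩
  have hs := (hasSum_sum fun r (_ : r ∈ Finset.range (p + 1)) =>
    (hasSum_renewalProb_rising hτ hk ht s r).mul_left (d r)).mul_left ((k : ℝ) ^ p)
  have e : ∀ n, (k : ℝ) ^ p * ∑ r ∈ Finset.range (p + 1), d r * (renewalProb τ k n t *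
      (rising (τ / k + s) n / rising (τ / k) n * rising (τ / k + s + n) r)) =
      renewalProb τ k n t * (risingRatio τ k s n * (τ + k * n : ℕ) ^ p) := by
    intro n
    have h1 : ((τ + k * n : ℕ) : ℝ) = k * (τ / k + n) := by
      rw [cast_div_add hk]; field_simp
    rw [h1, mul_pow, h (τ / k + n), risingRatio, ← add_right_comm, Finset.mul_sum, Finset.mul_sum,
      Finset.mul_sum, Finset.mul_sum]
    refine Finset.sum_congr rfl fun r _ => ?_
    ring
  simp only [e] at hs
  refine ⟨hs.summable, ?_⟩
  rw [hs.tsum_eq, Finset.sum_range_succ, hd, one_mul, mul_add, ← mul_assoc, add_sub_cancel_right,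
    abs_mul, abs_of_pos (pow_pos hk' p), mul_assoc]
  refine mul_le_mul_of_nonneg_left ?_ (by positivity)
  rw [Finset.sum_mul]
  refine (Finset.abs_sum_le_sum_abs _ _).trans (Finset.sum_le_sum fun r hr => ?_)
  rw [← mul_assoc, abs_mul, Real.abs_exp]
  refine mul_le_mul_of_nonneg_left (Real.exp_le_exp.2 ?_) (abs_nonneg _)
  have h2 : (r : ℝ) + 1 ≤ p := by exact_mod_cast Finset.mem_range.1 hr
  have h3 : (0 : ℝ) ≤ k * t := by positivity
  nlinarith [mul_le_mul_of_nonneg_left h2 h3]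

lemma exists_abs_tsum_le (hτ : 0 < τ) (hk : 0 < k) (s : ℝ) (p : ℕ) :
    ∃ C : ℝ, 0 ≤ C ∧ ∀ t : ℝ, 0 ≤ t →
      |∑' n, renewalProb τ k n t * (risingRatio τ k s n * (τ + k * n : ℕ) ^ p)| ≤
          C * Real.exp (k * (s + p) * t) := by
  obtain ⟨C, hC, h⟩ := exists_tsum_risingRatio_pow hτ hk s p
  refine ⟨|k ^ p * rising (τ / k + s) p| + C, add_nonneg (abs_nonneg _) hC, fun t ht => ?_⟩
  have h1 := (h t ht).2
  have h2 : Real.exp (k * (s + p - 1) * t) ≤ Real.exp (k * (s + p) * t) := by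
    refine Real.exp_le_exp.2 ?_
    have : (0 : ℝ) ≤ k * t := by positivity
    nlinarith
  have h3 := abs_sub_abs_le_abs_sub
    (∑' n, renewalProb τ k n t * (risingRatio τ k s n * (τ + k * n : ℕ) ^ p))
    (k ^ p * rising (τ / k + s) p * Real.exp (k * (s + p) * t))
  rw [abs_mul _ (Real.exp _), Real.abs_exp] at h3
  nlinarith [mul_le_mul_of_nonneg_left h2 hC]

/-! ### Two linear recursions -/

lemma eq_mul_risingRatio (hτ : 0 < τ) (hk : 0 < k) {l : ℝ} {V : ℕ → ℝ}
    (hV : ∀ n, V (n + 1) = (1 + l / (τ + k * n : ℕ)) * V n) (n : ℕ) :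
    V n = V 0 * risingRatio τ k (l / k) n := by
  have hk' : (k : ℝ) ≠ 0 := (Nat.cast_pos.2 hk).ne'
  induction n with
  | zero => simp
  | succ n ih => rw [hV, risingRatio_succ hτ hk, ih, mul_div_cancel₀ _ hk']; ring

lemma div_le_risingRatio (hτ : 0 < τ) (hk : 0 < k) {l : ℝ} (hl : 0 ≤ l) (n : ℕ) :
    (τ + k * n : ℕ) / τ ≤ risingRatio τ k (1 + l / k) n := by
  have hk' : (0 : ℝ) < k := Nat.cast_pos.2 hk
  have hτ' : (0 : ℝ) < τ := Nat.cast_pos.2 hτ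
  induction n with
  | zero => simp [div_self hτ'.ne']
  | succ n ih =>
    have hm : (0 : ℝ) < (τ + k * n : ℕ) := by rw [Nat.cast_pos]; omega
    rw [risingRatio_succ hτ hk]
    have e : k * (1 + l / k) = k + l := by field_simp
    rw [e]
    calc ((τ + k * (n + 1) : ℕ) : ℝ) / τ = (1 + k / (τ + k * n : ℕ)) * ((τ + k * n : ℕ) / τ) := by
          field_simp
          push_cast
          ring
      _ ≤ _ := by
          gcongr
          linarith

/-- A linear recursion with a constant source grows at most like the homogeneous recursion
with the faster rate `k + l`, because `2 l < k + l`. -/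
lemma exists_le_mul_risingRatio (hτ : 0 < τ) (hk : 0 < k) {l c₀ : ℝ} (hl : 0 ≤ l) (hlk : l < k)
    (hc₀ : 0 ≤ c₀) {V : ℕ → ℝ} (hV0 : 0 ≤ V 0)
    (hV : ∀ n, V (n + 1) ≤ (1 + 2 * l / (τ + k * n : ℕ)) * V n + c₀) :
    ∃ C, 0 ≤ C ∧ ∀ n, V n ≤ C * risingRatio τ k (1 + l / k) n := by
  have hk' : (0 : ℝ) < k := Nat.cast_pos.2 hk
  have hτ' : (0 : ℝ) < τ := Nat.cast_pos.2 hτ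
  have hd : 0 < k - l := by linarith
  have hC0 : 0 ≤ c₀ * τ / (k - l) := by positivity
  refine ⟨V 0 + c₀ * τ / (k - l), by positivity, fun n => ?_⟩
  set C := V 0 + c₀ * τ / (k - l) with hC
  induction n with
  | zero => rw [risingRatio_zero, mul_one]; linarith
  | succ n ih =>
    have hm : (0 : ℝ) < (τ + k * n : ℕ) := by rw [Nat.cast_pos]; omega
    have h1 := div_le_risingRatio hτ hk hl n
    rw [risingRatio_succ hτ hk]
    have e : k * (1 + l / k) = 2 * l + (k - l) := by field_simp; ring
    rw [e]
    refine (hV n).trans ?_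
    generalize ((τ + k * n : ℕ) : ℝ) = m at *
    generalize risingRatio τ k (1 + l / k) n = u at *
    have h2 : c₀ ≤ C * ((k - l) / m * u) := by
      calc c₀ = c₀ * τ / (k - l) * ((k - l) / m * (m / τ)) := by field_simp
        _ ≤ C * ((k - l) / m * u) := by
          gcongr
          linarith
    have h3 : (1 + 2 * l / m) * V n ≤ (1 + 2 * l / m) * (C * u) :=
      mul_le_mul_of_nonneg_left ih (by positivity)
    calc (1 + 2 * l / m) * V n + c₀ ≤ (1 + 2 * l / m) * (C * u) + C * ((k - l) / m * u) :=
          add_le_add h3 h2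
      _ = C * ((1 + (2 * l + (k - l)) / m) * u) := by ring

/-! ### The expansion of the mixed powers -/

/-- A homogeneous polynomial of degree `i + j` in `τ` and `v`, expanded in `v` up to order two.
The exponents `i + j - 1` and `i + j - 2` are truncated at `0`, but then the coefficients `g` and
`C` vanish. -/
lemma exists_mixed_expansion (a c K : ℝ) (hK : 0 ≤ K) (i j : ℕ) : ∃ g C : ℝ, 0 ≤ C ∧
    (i + j = 0 → g = 0) ∧ (i + j ≤ 1 → C = 0) ∧ ∀ τ v : ℝ, 0 ≤ τ → |v| ≤ K * τ →
      |(c * τ + v) ^ i * (a * τ - v) ^ j - c ^ i * a ^ j * τ ^ (i + j) -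
        g * (τ ^ (i + j - 1) * v)| ≤ C * (τ ^ (i + j - 2) * v ^ 2) := by
  -- multiplication by a linear form preserves the property
  have step : ∀ (N : ℕ) (f : ℝ → ℝ → ℝ) (g₀ α β : ℝ),
      (∃ g C : ℝ, 0 ≤ C ∧ (N = 0 → g = 0) ∧ (N ≤ 1 → C = 0) ∧ ∀ τ v : ℝ, 0 ≤ τ → |v| ≤ K * τ →
        |f τ v - g₀ * τ ^ N - g * (τ ^ (N - 1) * v)| ≤ C * (τ ^ (N - 2) * v ^ 2)) →
      ∃ g C : ℝ, 0 ≤ C ∧ (N + 1 = 0 → g = 0) ∧ (N + 1 ≤ 1 → C = 0) ∧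
        ∀ τ v : ℝ, 0 ≤ τ → |v| ≤ K * τ →
        |f τ v * (α * τ + β * v) - g₀ * α * τ ^ (N + 1) - g * (τ ^ (N + 1 - 1) * v)| ≤
          C * (τ ^ (N + 1 - 2) * v ^ 2) := by
    rintro N f g₀ α β ⟨g, C, hC, hg0, hC0, h⟩
    refine ⟨α * g + β * g₀, (|α| + |β| * K) * C + |β| * |g|, by positivity, by simp, fun hN => ?_,
      fun τ v hτ hv => ?_⟩
    · simp [hg0 (by omega), hC0 (by omega)]
    · have e1 : α * g * (τ * τ ^ (N - 1)) = α * g * τ ^ N := by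
        rcases N with _ | N
        · simp [hg0 rfl]
        · rw [Nat.add_sub_cancel, pow_succ']
      have e2 : C * (τ * τ ^ (N - 2)) = C * τ ^ (N - 1) := by
        rcases N with _ | _ | N
        · simp [hC0 (by omega)]
        · simp [hC0 (by omega)]
        · change C * (τ * τ ^ N) = C * τ ^ (N + 1)
          rw [pow_succ']
      have e : f τ v * (α * τ + β * v) - g₀ * α * τ ^ (N + 1) -
          (α * g + β * g₀) * (τ ^ (N + 1 - 1) * v) =
          (α * τ + β * v) * (f τ v - g₀ * τ ^ N - g * (τ ^ (N - 1) * v)) +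
            β * g * (τ ^ (N - 1) * v ^ 2) := by
        rw [Nat.add_sub_cancel]
        linear_combination v * e1
      have hlin : |α * τ + β * v| ≤ (|α| + |β| * K) * τ := by
        refine (abs_add_le _ _).trans ?_
        rw [abs_mul, abs_mul, abs_of_nonneg hτ]
        nlinarith [mul_le_mul_of_nonneg_left hv (abs_nonneg β)]
      rw [e, show N + 1 - 2 = N - 1 by omega]
      refine (abs_add_le _ _).trans ?_
      have hpow : 0 ≤ τ ^ (N - 1) * v ^ 2 := by positivity
      rw [abs_mul, abs_mul (β * g), abs_mul β, abs_of_nonneg hpow]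
      have h1 := mul_le_mul hlin (h τ v hτ hv) (abs_nonneg _) (by positivity)
      have h2 : (|α| + |β| * K) * τ * (C * (τ ^ (N - 2) * v ^ 2)) =
          (|α| + |β| * K) * C * (τ ^ (N - 1) * v ^ 2) := by
        linear_combination (|α| + |β| * K) * v ^ 2 * e2
      linarith
  have hi : ∀ i : ℕ, ∃ g C : ℝ, 0 ≤ C ∧ (i = 0 → g = 0) ∧ (i ≤ 1 → C = 0) ∧
      ∀ τ v : ℝ, 0 ≤ τ → |v| ≤ K * τ →
        |(c * τ + v) ^ i - c ^ i * τ ^ i - g * (τ ^ (i - 1) * v)| ≤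
          C * (τ ^ (i - 2) * v ^ 2) := by
    intro i
    induction i with
    | zero => exact ⟨0, 0, le_rfl, fun _ => rfl, fun _ => rfl, fun τ v _ _ => by simp⟩
    | succ i ih =>
      obtain ⟨g, C, h1, h2, h3, h4⟩ := step i (fun τ v => (c * τ + v) ^ i) (c ^ i) c 1 ih
      refine ⟨g, C, h1, h2, h3, fun τ v hτ hv => ?_⟩
      simpa only [one_mul, pow_succ] using h4 τ v hτ hv
  induction j with
  | zero => simpa using hi i
  | succ j ih =>
    obtain ⟨g, C, h1, h2, h3, h4⟩ := step (i + j)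
      (fun τ v => (c * τ + v) ^ i * (a * τ - v) ^ j) (c ^ i * a ^ j) a (-1) ih
    refine ⟨g, C, h1, h2, h3, fun τ v hτ hv => ?_⟩
    have := h4 τ v hτ hv
    rw [show i + (j + 1) = i + j + 1 by ring, pow_succ (a * τ - v), pow_succ a, ← mul_assoc,
      ← mul_assoc]
    rwa [neg_one_mul, ← sub_eq_add_neg] at this

end

/-! ### The mixed moments -/

section

section

variable {τ k : ℕ}

/-- If a sequence `E` is, up to the factor `Δ ^ N`, the power `τ_n ^ N` of the number of balls
after `n` renewals plus corrections of the sizes of the first and second moments `V₁`, `V₂` of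
the eigenvector coordinate, then its average over the number of renewals is an exponential up to
the two stated errors. -/
lemma exists_abs_average_sub_le (hτ : 0 < τ) (hk : 0 < k) {Δ l κ g C C₂ : ℝ} {N : ℕ}
    {E V₁ V₂ : ℕ → ℝ} (hΔ : 0 < Δ) (hl : l = max (k - Δ) 0) (hC : 0 ≤ C) (hC₂ : 0 ≤ C₂)
    (hg0 : N = 0 → g = 0) (hC0 : N ≤ 1 → C = 0)
    (hV₁ : ∀ n, V₁ n = V₁ 0 * risingRatio τ k ((k - Δ) / k) n)
    (hV₂ : ∀ n, V₂ n ≤ C₂ * risingRatio τ k (1 + l / k) n)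
    (hE : ∀ n, |Δ ^ N * E n - κ * (τ + k * n : ℕ) ^ N - g * ((τ + k * n : ℕ) ^ (N - 1) * V₁ n)| ≤
      C * ((τ + k * n : ℕ) ^ (N - 2) * V₂ n)) :
    ∃ C' : ℝ, ∀ t : ℝ, 0 ≤ t → ∀ S, HasSum (fun n => renewalProb τ k n t * E n) S →
      |S - κ / Δ ^ N * k ^ N * rising (τ / k) N * Real.exp (k * N * t)| ≤
        C' * (Real.exp ((k * N - Δ) * t) + Real.exp (k * (N - 1) * t)) := by
  have hk' : (0 : ℝ) < k := Nat.cast_pos.2 hk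
  obtain ⟨C₃, hC₃, h3⟩ := exists_tsum_risingRatio_pow hτ hk 0 N
  have h4s := exists_tsum_risingRatio_pow hτ hk ((k - Δ) / k) (N - 1)
  obtain ⟨C₄, hC₄, h4⟩ := exists_abs_tsum_le hτ hk ((k - Δ) / k) (N - 1)
  have h5s := exists_tsum_risingRatio_pow hτ hk (1 + l / k) (N - 2)
  obtain ⟨C₅, hC₅, h5⟩ := exists_abs_tsum_le hτ hk (1 + l / k) (N - 2)
  obtain ⟨_, _, h4s⟩ := h4s
  obtain ⟨_, _, h5s⟩ := h5s
  have hΔN : 0 < Δ ^ N := pow_pos hΔ N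
  refine ⟨(|κ| * C₃ + |g * V₁ 0| * C₄ + C * C₂ * C₅) / Δ ^ N, fun t ht S hS => ?_⟩
  set e₁ := Real.exp ((k * N - Δ) * t) with he₁
  set e₂ := Real.exp (k * (N - 1) * t) with he₂
  have he₁0 : 0 < e₁ := Real.exp_pos _
  have he₂0 : 0 < e₂ := Real.exp_pos _
  obtain ⟨s3, b3⟩ := h3 t ht
  have s4 := (h4s t ht).1
  have s5 := (h5s t ht).1
  have b4 := h4 t ht
  have b5 := h5 t ht
  simp only [risingRatio_zero_right hτ hk, one_mul, add_zero, zero_add] at s3 b3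
  set T₃ := ∑' n, renewalProb τ k n t * ((τ + k * n : ℕ) : ℝ) ^ N with hT₃
  set T₄ := ∑' n, renewalProb τ k n t *
    (risingRatio τ k ((k - Δ) / k) n * ((τ + k * n : ℕ) : ℝ) ^ (N - 1)) with hT₄
  set T₅ := ∑' n, renewalProb τ k n t *
    (risingRatio τ k (1 + l / k) n * ((τ + k * n : ℕ) : ℝ) ^ (N - 2)) with hT₅
  have hR : HasSum (fun n => renewalProb τ k n t * (Δ ^ N * E n - κ * (τ + k * n : ℕ) ^ N -
      g * ((τ + k * n : ℕ) ^ (N - 1) * V₁ n))) (Δ ^ N * S - κ * T₃ - g * V₁ 0 * T₄) := by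
    have := ((hS.mul_left (Δ ^ N)).sub (s3.hasSum.mul_left κ)).sub (s4.hasSum.mul_left (g * V₁ 0))
    convert! this using 1
    funext n
    rw [hV₁ n]
    ring
  have hRb : |Δ ^ N * S - κ * T₃ - g * V₁ 0 * T₄| ≤ C * C₂ * T₅ := by
    rw [← hR.tsum_eq, ← Real.norm_eq_abs]
    refine tsum_of_norm_bounded (s5.hasSum.mul_left (C * C₂)) fun n => ?_
    rw [Real.norm_eq_abs, abs_mul, abs_of_nonneg (renewalProb_nonneg n ht)]
    have h6 := mul_le_mul_of_nonneg_left (hE n) (renewalProb_nonneg (τ := τ) (k := k) n ht)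
    refine h6.trans ?_
    have h7 : C * ((τ + k * n : ℕ) ^ (N - 2) * V₂ n) ≤
        C * ((τ + k * n : ℕ) ^ (N - 2) * (C₂ * risingRatio τ k (1 + l / k) n)) := by
      gcongr
      exact hV₂ n
    refine (mul_le_mul_of_nonneg_left h7 (renewalProb_nonneg n ht)).trans_eq ?_
    ring
  -- the exponents of the three averages are compared with those of `e₁` and `e₂`
  have x3 : |T₃ - k ^ N * rising (τ / k) N * Real.exp (k * N * t)| ≤ C₃ * (e₁ + e₂) := by
    refine b3.trans ?_
    nlinarith
  have x4 : |g * V₁ 0 * T₄| ≤ |g * V₁ 0| * C₄ * (e₁ + e₂) := by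
    rcases Nat.eq_zero_or_pos N with hN | hN
    · simp [hg0 hN]
    · rw [abs_mul, mul_assoc]
      refine mul_le_mul_of_nonneg_left (b4.trans ?_) (abs_nonneg _)
      have : Real.exp (k * ((k - Δ) / k + (N - 1 : ℕ)) * t) = e₁ := by
        rw [he₁, Nat.cast_sub hN]
        congr 2
        field_simp
        push_cast
        ring
      rw [this]
      nlinarith
  have x5 : C * C₂ * T₅ ≤ C * C₂ * C₅ * (e₁ + e₂) := by
    rcases Nat.lt_or_ge 1 N with hN | hN
    · rw [mul_assoc (C * C₂)]
      refine mul_le_mul_of_nonneg_left (((le_abs_self _).trans b5).trans ?_) (by positivity)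
      have : k * (1 + l / k + (N - 2 : ℕ)) = k * (N - 1) + l := by
        rw [Nat.cast_sub hN]
        field_simp
        push_cast
        ring
      rw [this]
      refine mul_le_mul_of_nonneg_left ?_ hC₅
      rcases max_cases ((k : ℝ) - Δ) 0 with ⟨h8, -⟩ | ⟨h8, -⟩
      · have : k * ((N : ℝ) - 1) + l = k * N - Δ := by rw [hl, h8]; ring
        rw [this]
        linarith
      · rw [hl, h8, add_zero]
        linarith
    · simp [hC0 hN]
  have key : S - κ / Δ ^ N * k ^ N * rising (τ / k) N * Real.exp (k * N * t) =
      (κ * (T₃ - k ^ N * rising (τ / k) N * Real.exp (k * N * t)) + g * V₁ 0 * T₄ +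
        (Δ ^ N * S - κ * T₃ - g * V₁ 0 * T₄)) / Δ ^ N := by
    field_simp
    ring
  rw [key, abs_div, abs_of_pos hΔN, div_mul_eq_mul_div]
  refine div_le_div_of_nonneg_right ?_ hΔN.le
  refine (abs_add_le _ _).trans ?_
  have h9 := abs_add_le (κ * (T₃ - k ^ N * rising (τ / k) N * Real.exp (k * N * t))) (g * V₁ 0 * T₄)
  rw [abs_mul κ] at h9
  have h10 := mul_le_mul_of_nonneg_left x3 (abs_nonneg κ)
  linarith

end

section

variable {Ω : Type*} {W₀ B₀ k : ℕ} {ρ : Measure (ℕ × ℕ)} {ξ : ℕ → ℕ → Ω → ℝ} {𝒲 𝒵 : ℕ → Ω → ℕ}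

lemma W_eq (t : ℝ) (ω : Ω) : W W₀ B₀ k ξ 𝒲 𝒵 t ω =
    (whiteBalls W₀ B₀ k ξ 𝒲 𝒵 (renewalCount W₀ B₀ k ξ 𝒲 𝒵 t ω) ω).card := rfl

lemma B_eq (t : ℝ) (ω : Ω) : B W₀ B₀ k ξ 𝒲 𝒵 t ω =
    (Finset.range (W₀ + B₀ + k * renewalCount W₀ B₀ k ξ 𝒲 𝒵 t ω) \
      whiteBalls W₀ B₀ k ξ 𝒲 𝒵 (renewalCount W₀ B₀ k ξ 𝒲 𝒵 t ω) ω).card := by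
  rw [B, urnAt, UrnState.blueCount, balls_urn]
  rfl

lemma eigenCoord_add (m w : ℕ) : (k - meanZ ρ) * m + eigenCoord k ρ m w =
    (2 * k - meanW ρ - meanZ ρ) * w := by
  rw [eigenCoord]; ring

lemma sub_eigenCoord {m : ℕ} {A : Finset ℕ} (hA : A ⊆ Finset.range m) :
    (k - meanW ρ) * m - eigenCoord k ρ m A.card =
      (2 * k - meanW ρ - meanZ ρ) * (Finset.range m \ A).card := by
  have h4 : A.card ≤ m := by simpa using Finset.card_le_card hA
  rw [eigenCoord, Finset.card_sdiff_of_subset hA, Finset.card_range, Nat.cast_sub h4]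
  ring

variable [MeasurableSpace Ω] {P : Measure Ω}

namespace IsDriving

variable (h : IsDriving ρ ξ 𝒲 𝒵 P) [IsProbabilityMeasure P]

include h

/-- The mixed moments of the numbers of balls after `n` renewals. -/
lemma exists_abs_integral_pow_sub_le (hρ : ∀ᵐ p ∂ρ, p.1 ≤ k ∧ p.2 ≤ k) [IsProbabilityMeasure ρ]
    (i j : ℕ) : ∃ g C : ℝ, 0 ≤ C ∧ (i + j = 0 → g = 0) ∧ (i + j ≤ 1 → C = 0) ∧ ∀ n,
      |(2 * k - meanW ρ - meanZ ρ) ^ (i + j) *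
          ∫ ω, ((whiteBalls W₀ B₀ k ξ 𝒲 𝒵 n ω).card : ℝ) ^ i *
            ((Finset.range (W₀ + B₀ + k * n) \ whiteBalls W₀ B₀ k ξ 𝒲 𝒵 n ω).card : ℝ) ^ j ∂P -
        (k - meanZ ρ) ^ i * (k - meanW ρ) ^ j * (W₀ + B₀ + k * n : ℕ) ^ (i + j) -
        g * ((W₀ + B₀ + k * n : ℕ) ^ (i + j - 1) *
          ∫ ω, eigenCoord k ρ (W₀ + B₀ + k * n) (whiteBalls W₀ B₀ k ξ 𝒲 𝒵 n ω).card ∂P)| ≤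
      C * ((W₀ + B₀ + k * n : ℕ) ^ (i + j - 2) *
        ∫ ω, eigenCoord k ρ (W₀ + B₀ + k * n) (whiteBalls W₀ B₀ k ξ 𝒲 𝒵 n ω).card ^ 2 ∂P) := by
  have hW := meanW_le hρ
  have hZ := meanZ_le hρ
  have hΔ : 0 ≤ 2 * (k : ℝ) - meanW ρ - meanZ ρ := by linarith
  obtain ⟨g, C, h1, h2, h3, h4⟩ := exists_mixed_expansion (k - meanW ρ) (k - meanZ ρ)
    (2 * k - meanW ρ - meanZ ρ) hΔ i j
  refine ⟨g, C, h1, h2, h3, fun n => ?_⟩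
  set m := W₀ + B₀ + k * n with hm
  set Δ := 2 * (k : ℝ) - meanW ρ - meanZ ρ with hΔ'
  have hsub := h.ae_whiteBalls_subset (W₀ := W₀) (B₀ := B₀) hρ
  have e1 : ∀ᵐ ω ∂P, Δ ^ (i + j) * (((whiteBalls W₀ B₀ k ξ 𝒲 𝒵 n ω).card : ℝ) ^ i *
      ((Finset.range m \ whiteBalls W₀ B₀ k ξ 𝒲 𝒵 n ω).card : ℝ) ^ j) =
      ((k - meanZ ρ) * m + eigenCoord k ρ m (whiteBalls W₀ B₀ k ξ 𝒲 𝒵 n ω).card) ^ i *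
        ((k - meanW ρ) * m - eigenCoord k ρ m (whiteBalls W₀ B₀ k ξ 𝒲 𝒵 n ω).card) ^ j := by
    filter_upwards [hsub] with ω hω
    rw [eigenCoord_add, sub_eigenCoord (hω n), mul_pow, mul_pow, pow_add]
    ring
  rw [← integral_const_mul, integral_congr_ae e1]
  have i1 : Integrable (fun ω => ((k - meanZ ρ) * m +
      eigenCoord k ρ m (whiteBalls W₀ B₀ k ξ 𝒲 𝒵 n ω).card) ^ i *
        ((k - meanW ρ) * m - eigenCoord k ρ m (whiteBalls W₀ B₀ k ξ 𝒲 𝒵 n ω).card) ^ j) P :=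
    h.integrable_comp_card hρ n fun w => ((k - meanZ ρ) * m + eigenCoord k ρ m w) ^ i *
        ((k - meanW ρ) * m - eigenCoord k ρ m w) ^ j
  have i2 : Integrable (fun ω => eigenCoord k ρ m (whiteBalls W₀ B₀ k ξ 𝒲 𝒵 n ω).card) P :=
    h.integrable_comp_card hρ n (eigenCoord k ρ m)
  have i3 : Integrable (fun ω => eigenCoord k ρ m (whiteBalls W₀ B₀ k ξ 𝒲 𝒵 n ω).card ^ 2) P :=
    h.integrable_comp_card hρ n fun w => eigenCoord k ρ m w ^ 2
  have ec : (k - meanZ ρ) ^ i * (k - meanW ρ) ^ j * (m : ℝ) ^ (i + j) =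
      ∫ _ω, (k - meanZ ρ) ^ i * (k - meanW ρ) ^ j * (m : ℝ) ^ (i + j) ∂P := by simp
  have i4 := (i2.const_mul ((m : ℝ) ^ (i + j - 1))).const_mul g
  have i5 : Integrable (fun ω => ((k - meanZ ρ) * m +
      eigenCoord k ρ m (whiteBalls W₀ B₀ k ξ 𝒲 𝒵 n ω).card) ^ i *
        ((k - meanW ρ) * m - eigenCoord k ρ m (whiteBalls W₀ B₀ k ξ 𝒲 𝒵 n ω).card) ^ j -
        (k - meanZ ρ) ^ i * (k - meanW ρ) ^ j * (m : ℝ) ^ (i + j)) P := i1.sub (integrable_const _)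
  rw [ec, ← integral_const_mul, ← integral_const_mul, ← integral_const_mul, ← integral_const_mul,
    ← integral_sub i1 (integrable_const _), ← integral_sub i5 i4, ← Real.norm_eq_abs]
  refine norm_integral_le_of_norm_le ((i3.const_mul _).const_mul C) ?_
  filter_upwards [hsub] with ω hω
  have hw : (whiteBalls W₀ B₀ k ξ 𝒲 𝒵 n ω).card ≤ m := by
    simpa using Finset.card_le_card (hω n)
  exact h4 m _ (Nat.cast_nonneg m) (abs_eigenCoord_le hρ hw)

variable [IsProbabilityMeasure ρ]

/-- The second moment of the eigenvector coordinate. -/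
lemma exists_integral_eigenCoord_sq_le (hk : 0 < k) (hτ : 0 < W₀ + B₀)
    (hρ : ∀ᵐ p ∂ρ, p.1 ≤ k ∧ p.2 ≤ k) (hΔ : 0 < 2 * (k : ℝ) - meanW ρ - meanZ ρ) :
    ∃ C, 0 ≤ C ∧ ∀ n,
      ∫ ω, eigenCoord k ρ (W₀ + B₀ + k * n) (whiteBalls W₀ B₀ k ξ 𝒲 𝒵 n ω).card ^ 2 ∂P ≤
        C * risingRatio (W₀ + B₀) k
          (1 + max (k - (2 * (k : ℝ) - meanW ρ - meanZ ρ)) 0 / k) n := by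
  have hk' : (0 : ℝ) < k := Nat.cast_pos.2 hk
  have h0 : ∀ n, 0 ≤
      ∫ ω, eigenCoord k ρ (W₀ + B₀ + k * n) (whiteBalls W₀ B₀ k ξ 𝒲 𝒵 n ω).card ^ 2 ∂P :=
    fun n => integral_nonneg fun ω => sq_nonneg
      (eigenCoord k ρ (W₀ + B₀ + k * n) (whiteBalls W₀ B₀ k ξ 𝒲 𝒵 n ω).card)
  refine exists_le_mul_risingRatio hτ hk (V := fun n =>
      ∫ ω, eigenCoord k ρ (W₀ + B₀ + k * n) (whiteBalls W₀ B₀ k ξ 𝒲 𝒵 n ω).card ^ 2 ∂P)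
    (le_max_right _ _) (max_lt (by linarith) hk')
    (sq_nonneg (k * (2 * (k : ℝ) - meanW ρ - meanZ ρ))) (h0 0) fun n => ?_
  refine (h.integral_eigenCoord_sq_succ hτ hρ n).trans ?_
  gcongr
  exact le_max_left _ _

/-- The mixed moments at time `t` are averages of those after `n` renewals. -/
lemma hasSum_integral_pow (hk : 0 < k) (hτ : 0 < W₀ + B₀) (hρ : ∀ᵐ p ∂ρ, p.1 ≤ k ∧ p.2 ≤ k)
    {t : ℝ} (ht : 0 ≤ t) (i j : ℕ) :
    Integrable (fun ω => W W₀ B₀ k ξ 𝒲 𝒵 t ω ^ i * B W₀ B₀ k ξ 𝒲 𝒵 t ω ^ j) P ∧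
      HasSum (fun n => renewalProb (W₀ + B₀) k n t *
        ∫ ω, ((whiteBalls W₀ B₀ k ξ 𝒲 𝒵 n ω).card : ℝ) ^ i *
            ((Finset.range (W₀ + B₀ + k * n) \ whiteBalls W₀ B₀ k ξ 𝒲 𝒵 n ω).card : ℝ) ^ j ∂P)
        (∫ ω, W W₀ B₀ k ξ 𝒲 𝒵 t ω ^ i * B W₀ B₀ k ξ 𝒲 𝒵 t ω ^ j ∂P) := by
  obtain ⟨_, _, hs⟩ := exists_tsum_risingRatio_pow hτ hk 0 (i + j)
  have hs := (hs t ht).1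
  simp only [risingRatio_zero_right hτ hk, one_mul] at hs
  have := h.hasSum_integral_renewalCount hk hτ ht (F := fun p : ℕ × Finset ℕ =>
    (p.2.card : ℝ) ^ i * ((Finset.range (W₀ + B₀ + k * p.1) \ p.2).card : ℝ) ^ j)
    (g := fun n => ((W₀ + B₀ + k * n : ℕ) : ℝ) ^ (i + j)) (fun n => ?_) hs
  · simp only [W_eq, B_eq]
    exact this
  · filter_upwards [h.ae_whiteBalls_subset (W₀ := W₀) (B₀ := B₀) hρ] with ω hω
    have h1 : (whiteBalls W₀ B₀ k ξ 𝒲 𝒵 n ω).card ≤ W₀ + B₀ + k * n := by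
      simpa using Finset.card_le_card (hω n)
    have h2 : (Finset.range (W₀ + B₀ + k * n) \ whiteBalls W₀ B₀ k ξ 𝒲 𝒵 n ω).card ≤
        W₀ + B₀ + k * n := by
      simpa using Finset.card_le_card (Finset.sdiff_subset (s := Finset.range (W₀ + B₀ + k * n))
        (t := whiteBalls W₀ B₀ k ξ 𝒲 𝒵 n ω))
    rw [Real.norm_of_nonneg (by positivity), pow_add]
    gcongr

theorem exists_abs_moment_sub_le (hk : 0 < k) (hτ : 0 < W₀ + B₀)
    (hρ : ∀ᵐ p ∂ρ, p.1 ≤ k ∧ p.2 ≤ k) (hΔ : 0 < 2 * (k : ℝ) - meanW ρ - meanZ ρ) (i j : ℕ) :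
    ∃ C : ℝ, ∀ t : ℝ, 0 ≤ t →
      |∫ ω, W W₀ B₀ k ξ 𝒲 𝒵 t ω ^ i * B W₀ B₀ k ξ 𝒲 𝒵 t ω ^ j ∂P -
        momentCoeff (W₀ + B₀) k (meanW ρ) (meanZ ρ) i j * Real.exp (k * (i + j : ℝ) * t)| ≤
      C * (Real.exp ((k * (i + j : ℝ) - (2 * k - meanW ρ - meanZ ρ)) * t) +
        Real.exp (k * (i + j - 1 : ℝ) * t)) := by
  obtain ⟨g, C, h1, h2, h3, h4⟩ :=
    h.exists_abs_integral_pow_sub_le (W₀ := W₀) (B₀ := B₀) hρ i j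
  obtain ⟨C₂, hC₂, h5⟩ := h.exists_integral_eigenCoord_sq_le hk hτ hρ hΔ
  have h6 := eq_mul_risingRatio (V := fun n =>
      ∫ ω, eigenCoord k ρ (W₀ + B₀ + k * n) (whiteBalls W₀ B₀ k ξ 𝒲 𝒵 n ω).card ∂P) hτ hk
    (h.integral_eigenCoord_succ hτ hρ)
  obtain ⟨C', h7⟩ := exists_abs_average_sub_le hτ hk hΔ rfl h1 hC₂ h2 h3 h6 h5 h4
  refine ⟨C', fun t ht => ?_⟩
  have h8 := h7 t ht _ (h.hasSum_integral_pow hk hτ hρ ht i j).2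
  have e : momentCoeff (W₀ + B₀) k (meanW ρ) (meanZ ρ) i j =
      (k - meanZ ρ) ^ i * (k - meanW ρ) ^ j / (2 * k - meanW ρ - meanZ ρ) ^ (i + j) *
        k ^ (i + j) * rising ((W₀ + B₀ : ℕ) / k) (i + j) := by
    rw [momentCoeff, rising, mul_comm ((k - meanW ρ) ^ j)]
  rw [e]
  rw [Nat.cast_add i j] at h8
  exact h8

/-- The asymptotics of the mixed moments. -/
theorem moments (hk : 0 < k) (hτ : 0 < W₀ + B₀)
    (hρ : ∀ᵐ p ∂ρ, p.1 ≤ k ∧ p.2 ≤ k) (hΔ : 0 < 2 * (k : ℝ) - meanW ρ - meanZ ρ) (i j : ℕ) :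
    (∀ t : ℝ, 0 ≤ t → Integrable
      (fun ω => W W₀ B₀ k ξ 𝒲 𝒵 t ω ^ i * B W₀ B₀ k ξ 𝒲 𝒵 t ω ^ j) P) ∧
    (fun t : ℝ => ∫ ω, W W₀ B₀ k ξ 𝒲 𝒵 t ω ^ i * B W₀ B₀ k ξ 𝒲 𝒵 t ω ^ j ∂P -
        momentCoeff (W₀ + B₀) k (meanW ρ) (meanZ ρ) i j * Real.exp (k * (i + j : ℝ) * t))
      =O[atTop] (fun t : ℝ =>
        Real.exp ((k * (i + j : ℝ) - (2 * k - meanW ρ - meanZ ρ)) * t) +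
          Real.exp (k * (i + j - 1 : ℝ) * t)) ∧
    Tendsto (fun t : ℝ =>
      (∫ ω, W W₀ B₀ k ξ 𝒲 𝒵 t ω ^ i * B W₀ B₀ k ξ 𝒲 𝒵 t ω ^ j ∂P) /
        Real.exp (k * (i + j : ℝ) * t)) atTop
      (𝓝 (momentCoeff (W₀ + B₀) k (meanW ρ) (meanZ ρ) i j)) := by
  have hk' : (0 : ℝ) < k := Nat.cast_pos.2 hk
  obtain ⟨C, hC⟩ := h.exists_abs_moment_sub_le hk hτ hρ hΔ i j
  refine ⟨fun t ht => (h.hasSum_integral_pow hk hτ hρ ht i j).1, ?_, ?_⟩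
  · refine IsBigO.of_bound C ?_
    filter_upwards [eventually_ge_atTop 0] with t ht
    rw [Real.norm_eq_abs, Real.norm_of_nonneg (by positivity)]
    exact hC t ht
  · rw [tendsto_iff_norm_sub_tendsto_zero]
    have hlim : Tendsto (fun t : ℝ => C * (Real.exp (-((2 * k - meanW ρ - meanZ ρ) * t)) +
        Real.exp (-(k * t)))) atTop (𝓝 0) := by
      have h1 := Real.tendsto_exp_neg_atTop_nhds_zero.comp (tendsto_id.const_mul_atTop hΔ)
      have h2 := Real.tendsto_exp_neg_atTop_nhds_zero.comp (tendsto_id.const_mul_atTop hk')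
      simpa using (h1.add h2).const_mul C
    refine squeeze_zero' (Eventually.of_forall fun t => norm_nonneg _) ?_ hlim
    filter_upwards [eventually_ge_atTop 0] with t ht
    have he := Real.exp_pos (k * (i + j : ℝ) * t)
    have hmul : |(∫ ω, W W₀ B₀ k ξ 𝒲 𝒵 t ω ^ i * B W₀ B₀ k ξ 𝒲 𝒵 t ω ^ j ∂P) /
        Real.exp (k * (i + j : ℝ) * t) - momentCoeff (W₀ + B₀) k (meanW ρ) (meanZ ρ) i j| *
          Real.exp (k * (i + j : ℝ) * t) =
        |∫ ω, W W₀ B₀ k ξ 𝒲 𝒵 t ω ^ i * B W₀ B₀ k ξ 𝒲 𝒵 t ω ^ j ∂P -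
          momentCoeff (W₀ + B₀) k (meanW ρ) (meanZ ρ) i j * Real.exp (k * (i + j : ℝ) * t)| := by
      conv_lhs => rw [← Real.abs_exp (k * (i + j : ℝ) * t)]
      rw [← abs_mul, Real.abs_exp, sub_mul, div_mul_cancel₀ _ he.ne']
    rw [Real.norm_eq_abs, ← mul_le_mul_iff_left₀ he, hmul]
    refine (hC t ht).trans_eq ?_
    rw [mul_assoc C, add_mul, ← Real.exp_add, ← Real.exp_add]
    congr 3 <;> ring

end IsDriving

end

end

/-! ### The characteristic function of the gamma distribution -/

section

section Gamma

variable {a r : ℝ}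

lemma integral_gammaMeasure (ha : 0 < a) (hr : 0 < r) (f : ℝ → ℝ) :
    ∫ x, f x ∂(gammaMeasure a r) =
      ∫ x in Set.Ioi 0, r ^ a / Real.Gamma a * x ^ (a - 1) * Real.exp (-(r * x)) * f x := by
  have hm : Measurable (gammaPDF a r) := (measurable_gammaPDFReal a r).ennreal_ofReal
  rw [gammaMeasure, integral_withDensity_eq_integral_toReal_smul hm
    (Eventually.of_forall fun x => ENNReal.ofReal_lt_top), ← integral_Ici_eq_integral_Ioi,
    ← setIntegral_eq_integral_of_forall_compl_eq_zero (s := Set.Ici 0)]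
  · refine setIntegral_congr_fun measurableSet_Ici fun x (hx : 0 ≤ x) => ?_
    have hG := Real.Gamma_pos_of_pos ha
    simp only [gammaPDF_of_nonneg hx, smul_eq_mul]
    rw [ENNReal.toReal_ofReal (by positivity)]
  · intro x hx
    rw [gammaPDF_of_neg (not_le.1 hx)]
    simp

lemma mgf_gammaMeasure (ha : 0 < a) (hr : 0 < r) {s : ℝ} (hs : s < r) :
    mgf id (gammaMeasure a r) s = (1 - s / r) ^ (-a) := by
  have hG := (Real.Gamma_pos_of_pos ha).ne'
  have hrs : 0 < r - s := sub_pos.2 hs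
  have e : ∀ x : ℝ, r ^ a / Real.Gamma a * x ^ (a - 1) * Real.exp (-(r * x)) * Real.exp (s * x) =
      r ^ a / Real.Gamma a * (x ^ (a - 1) * Real.exp (-((r - s) * x))) := by
    intro x
    rw [mul_assoc, ← Real.exp_add, mul_assoc]
    congr 3
    ring
  simp only [mgf, id, integral_gammaMeasure ha hr, e]
  rw [integral_const_mul, Real.integral_rpow_mul_exp_neg_mul_Ioi ha hrs,
    show 1 - s / r = ((r - s) / r) by field_simp, Real.rpow_neg (by positivity),
    Real.div_rpow hrs.le hr.le, Real.div_rpow zero_le_one hrs.le, Real.one_rpow]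
  have h1 := (Real.rpow_pos_of_pos hrs a).ne'
  have h2 := (Real.rpow_pos_of_pos hr a).ne'
  field_simp

/-- The characteristic function of the gamma distribution with shape `a` and rate `r`, by
analytic continuation of its moment generating function. -/
theorem charFun_gammaMeasure (ha : 0 < a) (hr : 0 < r) (u : ℝ) :
    charFun (gammaMeasure a r) u = (1 - u * Complex.I / r) ^ (-(a : ℂ)) := by
  have hpos : ∀ s < r, 0 < 1 - s / r := fun s hs => by
    rw [sub_pos, div_lt_one hr]; exact hs
  have hsub : Set.Iio r ⊆ integrableExpSet id (gammaMeasure a r) := by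
    intro s hs
    by_contra hn
    -- the integral of a non-integrable function would be the junk value `0`
    have h1 : mgf id (gammaMeasure a r) s = 0 := integral_undef hn
    rw [mgf_gammaMeasure ha hr hs] at h1
    exact (Real.rpow_pos_of_pos (hpos s hs) _).ne' h1
  have hint : Set.Iio r ⊆ interior (integrableExpSet id (gammaMeasure a r)) :=
    interior_maximal hsub isOpen_Iio
  have hf : AnalyticOnNhd ℂ (complexMGF id (gammaMeasure a r)) {z | z.re < r} :=
    analyticOnNhd_complexMGF.mono fun z hz => hint hz
  have hre : ∀ z : ℂ, (1 - z / r).re = 1 - z.re / r := fun z => by simp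
  have hg : AnalyticOnNhd ℂ (fun z : ℂ => (1 - z / r) ^ (-(a : ℂ))) {z | z.re < r} := by
    intro z hz
    refine AnalyticAt.cpow (by fun_prop) analyticAt_const (Or.inl ?_)
    rw [hre]
    exact hpos _ hz
  have hpre : IsPreconnected {z : ℂ | z.re < r} := (convex_halfSpace_re_lt r).isPreconnected
  have heq := hf.eqOn_of_preconnected_of_frequently_eq hg hpre (z₀ := 0) (by simpa using hr) ?_
  · rw [← complexMGF_id_mul_I]
    exact heq (by simpa using hr)
  · have ht : Tendsto (fun s : ℝ => (s : ℂ)) (𝓝[≠] 0) (𝓝[≠] 0) := by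
      refine tendsto_nhdsWithin_of_tendsto_nhds_of_eventually_within _ ?_ ?_
      · exact (Complex.continuous_ofReal.tendsto' 0 0 rfl).mono_left nhdsWithin_le_nhds
      · filter_upwards [self_mem_nhdsWithin] with s hs
        simpa using hs
    refine ht.frequently (Eventually.frequently ?_)
    filter_upwards [mem_nhdsWithin_of_mem_nhds (Iio_mem_nhds hr)] with s hs
    rw [complexMGF_ofReal, mgf_gammaMeasure ha hr hs, Complex.ofReal_cpow (hpos s hs).le]
    push_cast
    rfl

end Gamma

/-! ### The limit law of the number of balls -/

/-- For `ε > 0` the principal branches of the powers of `ε` and of `w` are compatible. -/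
lemma ofReal_cpow_mul_cpow (x : ℝ) {ε : ℝ} (hε : 0 < ε) {w : ℂ} (hw : w ≠ 0) :
    ((ε ^ x : ℝ) : ℂ) * (ε * w) ^ (-(x : ℂ)) = w ^ (-(x : ℂ)) := by
  have hε' : (ε : ℂ) ≠ 0 := Complex.ofReal_ne_zero.2 hε.ne'
  rw [Complex.cpow_def_of_ne_zero (mul_ne_zero hε' hw), Complex.cpow_def_of_ne_zero hw,
    Complex.log_ofReal_mul hε hw, Complex.ofReal_cpow hε.le, Complex.cpow_def_of_ne_zero hε',
    ← Complex.exp_add, Complex.ofReal_log hε.le]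
  congr 1
  ring

/-- The quotient `(1 - (1 - ε) q) / ε` with `q = exp (i u k ε)`. With `ε = exp (-k t)`, the
characteristic function of `ε` times the number of balls at time `t` is a negative power of it, up
to the phase of the initial balls. -/
def charBase (k : ℕ) (u ε : ℝ) : ℂ :=
  Complex.exp (u * k * ε * Complex.I) - (Complex.exp (u * k * ε * Complex.I) - 1) / ε

lemma tendsto_charBase (k : ℕ) (u : ℝ) :
    Tendsto (charBase k u) (𝓝[>] 0) (𝓝 (1 - u * k * Complex.I)) := by
  have h1 : Tendsto (fun ε : ℝ => Complex.exp (u * k * ε * Complex.I)) (𝓝[>] 0) (𝓝 1) := by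
    refine Tendsto.mono_left ?_ nhdsWithin_le_nhds
    refine Continuous.tendsto' (by fun_prop) _ _ (by simp)
  have h2 : HasDerivAt (fun ε : ℝ => Complex.exp (u * k * ε * Complex.I)) (u * k * Complex.I) 0 := by
    have h3 : HasDerivAt (fun z : ℂ => Complex.exp (u * k * z * Complex.I))
        (u * k * Complex.I) ((0 : ℝ) : ℂ) := by
      have := (((hasDerivAt_id (((0 : ℝ)) : ℂ)).const_mul ((u : ℂ) * k)).mul_const Complex.I).cexp
      simpa using this
    exact h3.comp_ofReal
  have h4 := (hasDerivAt_iff_tendsto_slope.1 h2).mono_left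
    (nhdsWithin_mono 0 fun x (hx : 0 < x) => hx.ne')
  refine (h1.sub h4).congr fun ε => ?_
  simp only [slope, charBase, sub_zero, vsub_eq_sub, Complex.ofReal_zero, mul_zero, zero_mul,
    Complex.exp_zero, Complex.real_smul, Complex.ofReal_inv]
  ring

section

variable {τ k : ℕ}

/-- The characteristic function of the scaled negative binomial law, by the binomial series. -/
lemma hasSum_renewalProb_cexp (hτ : 0 < τ) (hk : 0 < k) {t : ℝ} (ht : 0 ≤ t) (u : ℝ)
    (hne : charBase k u (Real.exp (-(k * t))) ≠ 0) :
    HasSum (fun n => renewalProb τ k n t •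
        Complex.exp (u * (Real.exp (-(k * t)) * (τ + k * n : ℕ) : ℝ) * Complex.I))
      (Complex.exp (u * Real.exp (-(k * t)) * τ * Complex.I) *
        charBase k u (Real.exp (-(k * t))) ^ (-((τ / k : ℝ) : ℂ))) := by
  have hk' : (0 : ℝ) < k := Nat.cast_pos.2 hk
  obtain ⟨h0, h1⟩ := one_sub_exp_mem k ht
  have hετ : Real.exp (-(τ * t)) = Real.exp (-(k * t)) ^ ((τ : ℝ) / k) := by
    rw [← Real.exp_mul]
    congr 1
    field_simp
  have hε := Real.exp_pos (-(k * t))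
  simp only [renewalProb, hετ]
  generalize Real.exp (-(k * t)) = ε at *
  have hε' : (ε : ℂ) ≠ 0 := Complex.ofReal_ne_zero.2 hε.ne'
  set q := Complex.exp (u * k * ε * Complex.I) with hq
  have hqn : ‖q‖ = 1 := by
    rw [hq, show (u * k * ε * Complex.I : ℂ) = ((u * k * ε : ℝ) : ℂ) * Complex.I by push_cast; rfl,
      Complex.norm_exp_ofReal_mul_I]
  have hz : ‖((1 - ε : ℝ) : ℂ) * q‖ < 1 := by
    rw [norm_mul, hqn, mul_one, Complex.norm_real, Real.norm_of_nonneg h0]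
    exact h1
  have h := ((hasSum_rising_complex (τ / k) hz).mul_left ((ε ^ ((τ : ℝ) / k) : ℝ) : ℂ)).mul_left
    (Complex.exp (u * ε * τ * Complex.I))
  have hbase : 1 - ((1 - ε : ℝ) : ℂ) * q = ε * charBase k u ε := by
    rw [charBase, ← hq]
    field_simp
    push_cast
    ring
  rw [hbase, ofReal_cpow_mul_cpow _ hε hne] at h
  convert! h using 2 with n
  have e1 : Complex.exp (u * (ε * (τ + k * n : ℕ) : ℝ) * Complex.I) =
      Complex.exp (u * ε * τ * Complex.I) * q ^ n := by
    rw [hq, ← Complex.exp_nat_mul, ← Complex.exp_add]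
    congr 1
    push_cast
    ring
  rw [e1, mul_pow, Complex.real_smul]
  push_cast
  ring

end

/-- Convergence of the characteristic functions implies convergence in distribution also along a
real parameter. -/
lemma tendstoInDistribution_of_charFun {Ω : Type*} [MeasurableSpace Ω] {P : Measure Ω}
    [IsProbabilityMeasure P] {X : ℝ → Ω → ℝ} (hX : ∀ t, Measurable (X t)) {μ : Measure ℝ}
    [IsProbabilityMeasure μ]
    (h : ∀ u, Tendsto (fun t => charFun (P.map (X t)) u) atTop (𝓝 (charFun μ u))) :
    TendstoInDistribution X atTop id (fun _ => P) μ where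
  forall_aemeasurable t := (hX t).aemeasurable
  aemeasurable_limit := aemeasurable_id
  tendsto := by
    refine tendsto_of_seq_tendsto fun s hs => ?_
    refine ProbabilityMeasure.tendsto_iff_tendsto_charFun.2 fun u => ?_
    simp only [ProbabilityMeasure.coe_mk, Measure.map_id]
    exact (h u).comp hs

namespace IsDriving

variable {Ω : Type*} [MeasurableSpace Ω] {P : Measure Ω} {W₀ B₀ k : ℕ}
  {ρ : Measure (ℕ × ℕ)} {ξ : ℕ → ℕ → Ω → ℝ} {𝒲 𝒵 : ℕ → Ω → ℕ}
  (h : IsDriving ρ ξ 𝒲 𝒵 P)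

include h

lemma measurable_ballCount (t c : ℝ) : Measurable fun ω =>
    c * ((W₀ + B₀ + k * renewalCount W₀ B₀ k ξ 𝒲 𝒵 t ω : ℕ) : ℝ) :=
  (Measurable.of_discrete (f := fun n : ℕ => c * ((W₀ + B₀ + k * n : ℕ) : ℝ))).comp
    (h.measurable_renewalCount t)

lemma measurable_eigenCoord (t c : ℝ) : Measurable fun ω =>
    c * eigenCoord k ρ (W₀ + B₀ + k * renewalCount W₀ B₀ k ξ 𝒲 𝒵 t ω)
      (whiteBalls W₀ B₀ k ξ 𝒲 𝒵 (renewalCount W₀ B₀ k ξ 𝒲 𝒵 t ω) ω).card := by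
  have h1 : Measurable fun p : ℕ × Finset ℕ => c * eigenCoord k ρ (W₀ + B₀ + k * p.1) p.2.card :=
    Measurable.of_discrete
  have h2 := h.measurable_whiteBalls_renewalCount (W₀ := W₀) (B₀ := B₀) (k := k) t
  have h3 := h1.comp h2
  simpa only [Function.comp_def] using h3

variable [IsProbabilityMeasure P] [IsProbabilityMeasure ρ]

lemma charFun_ballCount (hk : 0 < k) (hτ : 0 < W₀ + B₀) {t : ℝ} (ht : 0 ≤ t) (u : ℝ)
    (hne : charBase k u (Real.exp (-(k * t))) ≠ 0) :
    charFun (P.map fun ω => Real.exp (-(k * t)) *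
        ((W₀ + B₀ + k * renewalCount W₀ B₀ k ξ 𝒲 𝒵 t ω : ℕ) : ℝ)) u =
      Complex.exp (u * Real.exp (-(k * t)) * (W₀ + B₀ : ℕ) * Complex.I) *
        charBase k u (Real.exp (-(k * t))) ^ (-(((W₀ + B₀ : ℕ) / k : ℝ) : ℂ)) := by
  have h1 := (h.hasSum_integral_renewalCount hk hτ ht (F := fun p : ℕ × Finset ℕ =>
    Complex.exp (u * (Real.exp (-(k * t)) * (W₀ + B₀ + k * p.1 : ℕ) : ℝ) * Complex.I))
    (g := fun _ => 1) (fun n => Eventually.of_forall fun ω => by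
      rw [← Complex.ofReal_mul, Complex.norm_exp_ofReal_mul_I])
    (by simpa using (hasSum_renewalProb hτ hk ht).summable)).2
  simp only [integral_const, probReal_univ, one_smul] at h1
  rw [charFun_apply_real, integral_map (h.measurable_ballCount t _).aemeasurable
    (by fun_prop), h1.unique (hasSum_renewalProb_cexp hτ hk ht u hne)]

/-- The scaled number of balls converges to the gamma distribution. -/
theorem tendstoInDistribution_ballCount (hk : 0 < k) (hτ : 0 < W₀ + B₀)
    [IsProbabilityMeasure (gammaMeasure ((W₀ + B₀ : ℕ) / k) (k : ℝ)⁻¹)] :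
    TendstoInDistribution (fun (t : ℝ) ω => Real.exp (-(k * t)) *
      ((W₀ + B₀ + k * renewalCount W₀ B₀ k ξ 𝒲 𝒵 t ω : ℕ) : ℝ)) atTop id (fun _ => P)
      (gammaMeasure ((W₀ + B₀ : ℕ) / k) (k : ℝ)⁻¹) := by
  have hk' : (0 : ℝ) < k := Nat.cast_pos.2 hk
  refine tendstoInDistribution_of_charFun (fun t => h.measurable_ballCount t _) fun u => ?_
  have hε : Tendsto (fun t : ℝ => Real.exp (-(k * t))) atTop (𝓝[>] 0) := by
    refine tendsto_nhdsWithin_of_tendsto_nhds_of_eventually_within _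
      (Real.tendsto_exp_neg_atTop_nhds_zero.comp (tendsto_id.const_mul_atTop hk'))
      (Eventually.of_forall fun t => Real.exp_pos _)
  have hb := (tendsto_charBase k u).comp hε
  have hlim : (1 - u * k * Complex.I : ℂ) ∈ Complex.slitPlane := Or.inl (by simp)
  have hne : ∀ᶠ t : ℝ in atTop, charBase k u (Real.exp (-(k * t))) ≠ 0 :=
    hb.eventually_ne (Complex.slitPlane_ne_zero hlim)
  have hx : (0 : ℝ) < (W₀ + B₀ : ℕ) / k := div_pos (Nat.cast_pos.2 hτ) hk'
  rw [charFun_gammaMeasure hx (inv_pos.2 hk')]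
  have h1 : Tendsto (fun t : ℝ => Complex.exp (u * Real.exp (-(k * t)) * (W₀ + B₀ : ℕ) *
      Complex.I)) atTop (𝓝 1) := by
    have : Tendsto (fun ε : ℝ => Complex.exp (u * ε * (W₀ + B₀ : ℕ) * Complex.I)) (𝓝[>] 0)
        (𝓝 1) := by
      refine Tendsto.mono_left ?_ nhdsWithin_le_nhds
      refine Continuous.tendsto' (by fun_prop) _ _ (by simp)
    exact this.comp hε
  have h2 := hb.cpow (tendsto_const_nhds (x := -(((W₀ + B₀ : ℕ) / k : ℝ) : ℂ))) hlim
  have h3 := h1.mul h2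
  rw [one_mul] at h3
  have e : (1 - u * Complex.I / ((k : ℝ)⁻¹ : ℝ) : ℂ) = 1 - u * k * Complex.I := by
    push_cast
    rw [div_inv_eq_mul]
    ring
  rw [e]
  refine h3.congr' ?_
  filter_upwards [eventually_ge_atTop 0, hne] with t ht hnt
  exact (h.charFun_ballCount hk hτ ht u hnt).symm

/-- The scaled eigenvector coordinate vanishes in the limit, by its second moment. -/
theorem tendstoInMeasure_eigenCoord (hk : 0 < k) (hτ : 0 < W₀ + B₀)
    (hρ : ∀ᵐ p ∂ρ, p.1 ≤ k ∧ p.2 ≤ k) (hΔ : 0 < 2 * (k : ℝ) - meanW ρ - meanZ ρ) :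
    TendstoInMeasure P (fun (t : ℝ) ω => Real.exp (-(k * t)) *
      eigenCoord k ρ (W₀ + B₀ + k * renewalCount W₀ B₀ k ξ 𝒲 𝒵 t ω)
        (whiteBalls W₀ B₀ k ξ 𝒲 𝒵 (renewalCount W₀ B₀ k ξ 𝒲 𝒵 t ω) ω).card) atTop
      (fun _ => 0) := by
  have hk' : (0 : ℝ) < k := Nat.cast_pos.2 hk
  obtain ⟨C₂, hC₂, h2⟩ := h.exists_integral_eigenCoord_sq_le hk hτ hρ hΔ
  set l := max (k - (2 * (k : ℝ) - meanW ρ - meanZ ρ)) 0 with hl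
  have hlk : l < k := max_lt (by linarith) hk'
  have hs := exists_tsum_risingRatio_pow hτ hk (1 + l / k) 0
  obtain ⟨_, _, hs⟩ := hs
  obtain ⟨C, hC, hb⟩ := exists_abs_tsum_le hτ hk (1 + l / k) 0
  obtain ⟨_, _, hsq⟩ := exists_tsum_risingRatio_pow hτ hk 0 2
  have hmom : ∀ t : ℝ, 0 ≤ t →
      Integrable (fun ω => eigenCoord k ρ (W₀ + B₀ + k * renewalCount W₀ B₀ k ξ 𝒲 𝒵 t ω)
        (whiteBalls W₀ B₀ k ξ 𝒲 𝒵 (renewalCount W₀ B₀ k ξ 𝒲 𝒵 t ω) ω).card ^ 2) P ∧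
      ∫ ω, eigenCoord k ρ (W₀ + B₀ + k * renewalCount W₀ B₀ k ξ 𝒲 𝒵 t ω)
        (whiteBalls W₀ B₀ k ξ 𝒲 𝒵 (renewalCount W₀ B₀ k ξ 𝒲 𝒵 t ω) ω).card ^ 2 ∂P ≤
      C₂ * (C * Real.exp ((k + l) * t)) := by
    intro t ht
    have hsq := (hsq t ht).1
    simp only [risingRatio_zero_right hτ hk, one_mul] at hsq
    have hg : Summable fun n => renewalProb (W₀ + B₀) k n t *
        ((2 * (k : ℝ) - meanW ρ - meanZ ρ) ^ 2 * ((W₀ + B₀ + k * n : ℕ) : ℝ) ^ 2) := by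
      refine (hsq.mul_left ((2 * (k : ℝ) - meanW ρ - meanZ ρ) ^ 2)).congr fun n => ?_
      ring
    obtain ⟨h3, h4⟩ := h.hasSum_integral_renewalCount hk hτ ht (F := fun p : ℕ × Finset ℕ =>
      eigenCoord k ρ (W₀ + B₀ + k * p.1) p.2.card ^ 2) (fun n => by
        filter_upwards [h.ae_whiteBalls_subset (W₀ := W₀) (B₀ := B₀) hρ] with ω hω
        have hw : (whiteBalls W₀ B₀ k ξ 𝒲 𝒵 n ω).card ≤ W₀ + B₀ + k * n := by
          simpa using Finset.card_le_card (hω n)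
        rw [norm_pow, Real.norm_eq_abs, ← mul_pow]
        exact pow_le_pow_left₀ (abs_nonneg _) (abs_eigenCoord_le hρ hw) 2) hg
    refine ⟨h3, ?_⟩
    have hs := (hs t ht).1
    have hb := (le_abs_self _).trans (hb t ht)
    simp only [pow_zero, mul_one, Nat.cast_zero, add_zero] at hs hb
    have e : k * (1 + l / k) = k + l := by field_simp
    rw [e] at hb
    refine (hasSum_le (fun n => ?_) h4 (hs.hasSum.mul_left C₂)).trans
      (mul_le_mul_of_nonneg_left hb hC₂)
    rw [smul_eq_mul, mul_left_comm]
    exact mul_le_mul_of_nonneg_left (h2 n) (renewalProb_nonneg n ht)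
  rw [tendstoInMeasure_iff_measureReal_norm]
  intro δ hδ
  have hlim : Tendsto (fun t : ℝ => C₂ * C / δ ^ 2 * Real.exp (-((k - l) * t))) atTop (𝓝 0) := by
    have := (Real.tendsto_exp_neg_atTop_nhds_zero.comp
      (tendsto_id.const_mul_atTop (sub_pos.2 hlk))).const_mul (C₂ * C / δ ^ 2)
    simpa using this
  refine squeeze_zero' (Eventually.of_forall fun t => measureReal_nonneg) ?_ hlim
  filter_upwards [eventually_ge_atTop 0] with t ht
  obtain ⟨h3, h4⟩ := hmom t ht
  have h5 := mul_meas_ge_le_integral_of_nonneg (Eventually.of_forall fun ω => sq_nonneg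
    (eigenCoord k ρ (W₀ + B₀ + k * renewalCount W₀ B₀ k ξ 𝒲 𝒵 t ω)
      (whiteBalls W₀ B₀ k ξ 𝒲 𝒵 (renewalCount W₀ B₀ k ξ 𝒲 𝒵 t ω) ω).card)) h3
    ((δ * Real.exp (k * t)) ^ 2)
  have he := Real.exp_pos (k * t)
  have hset : {ω | δ ≤ ‖Real.exp (-(k * t)) *
      eigenCoord k ρ (W₀ + B₀ + k * renewalCount W₀ B₀ k ξ 𝒲 𝒵 t ω)
        (whiteBalls W₀ B₀ k ξ 𝒲 𝒵 (renewalCount W₀ B₀ k ξ 𝒲 𝒵 t ω) ω).card - 0‖} =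
      {ω | (δ * Real.exp (k * t)) ^ 2 ≤
        eigenCoord k ρ (W₀ + B₀ + k * renewalCount W₀ B₀ k ξ 𝒲 𝒵 t ω)
        (whiteBalls W₀ B₀ k ξ 𝒲 𝒵 (renewalCount W₀ B₀ k ξ 𝒲 𝒵 t ω) ω).card ^ 2} := by
    ext ω
    rw [Set.mem_ofPred_eq, Set.mem_ofPred_eq, sub_zero, norm_mul, Real.norm_eq_abs, Real.abs_exp,
      Real.norm_eq_abs, Real.exp_neg, ← sq_abs (eigenCoord _ _ _ _),
      sq_le_sq₀ (by positivity) (abs_nonneg _), le_inv_mul_iff₀ he, mul_comm δ]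
  rw [hset]
  have h6 := h5.trans h4
  generalize P.real _ = x at h6 ⊢
  have e2 : Real.exp ((k + l) * t) = Real.exp (k * t) ^ 2 * Real.exp (-((k - l) * t)) := by
    rw [← Real.exp_nat_mul, ← Real.exp_add]
    congr 1
    push_cast
    ring
  rw [e2, mul_pow, mul_assoc] at h6
  rw [div_mul_eq_mul_div, le_div_iff₀ (by positivity)]
  have h7 : 0 < Real.exp (k * t) ^ 2 := by positivity
  rw [← mul_le_mul_iff_right₀ h7]
  linarith

/-- The limit law of the urn: the numbers of white and blue balls are linear functions of the
number of balls, which has a gamma limit, and of the eigenvector coordinate, which vanishes. -/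
theorem tendstoInDistribution_urn (hk : 0 < k) (hτ : 0 < W₀ + B₀)
    (hρ : ∀ᵐ p ∂ρ, p.1 ≤ k ∧ p.2 ≤ k) (hΔ : 0 < 2 * (k : ℝ) - meanW ρ - meanZ ρ)
    [IsProbabilityMeasure (gammaMeasure ((W₀ + B₀ : ℕ) / k) (k : ℝ)⁻¹)] :
    TendstoInDistribution
      (fun (t : ℝ) ω => (Real.exp (-(k * t)) * W W₀ B₀ k ξ 𝒲 𝒵 t ω,
        Real.exp (-(k * t)) * B W₀ B₀ k ξ 𝒲 𝒵 t ω))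
      atTop
      (fun g : ℝ => (g * ((k - meanZ ρ) / (2 * k - meanW ρ - meanZ ρ)),
        g * ((k - meanW ρ) / (2 * k - meanW ρ - meanZ ρ))))
      (fun _ => P) (gammaMeasure ((W₀ + B₀ : ℕ) / k) (k : ℝ)⁻¹) := by
  set Δ := 2 * (k : ℝ) - meanW ρ - meanZ ρ with hΔ'
  have hg : Continuous fun z : ℝ × ℝ => (z.1 * ((k - meanZ ρ) / Δ) + z.2 / Δ,
      z.1 * ((k - meanW ρ) / Δ) - z.2 / Δ) := by fun_prop
  have h1 := (h.tendstoInDistribution_ballCount hk hτ).continuous_comp_prodMk_of_tendstoInMeasure_const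
    hg (h.tendstoInMeasure_eigenCoord hk hτ hρ hΔ) fun t => (h.measurable_eigenCoord t _).aemeasurable
  refine TendstoInDistribution.congr (fun t => ?_) (Eventually.of_forall fun g => ?_) h1
  · filter_upwards [h.ae_whiteBalls_subset (W₀ := W₀) (B₀ := B₀) hρ] with ω hω
    have e1 := eigenCoord_add (k := k) (ρ := ρ)
      (W₀ + B₀ + k * renewalCount W₀ B₀ k ξ 𝒲 𝒵 t ω)
      (whiteBalls W₀ B₀ k ξ 𝒲 𝒵 (renewalCount W₀ B₀ k ξ 𝒲 𝒵 t ω) ω).card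
    have e2 := sub_eigenCoord (k := k) (ρ := ρ) (hω (renewalCount W₀ B₀ k ξ 𝒲 𝒵 t ω))
    rw [← W_eq, ← hΔ'] at e1
    rw [← B_eq, ← hΔ'] at e2
    refine Prod.ext ?_ ?_
    · simp only
      field_simp
      linear_combination e1
    · simp only
      field_simp
      linear_combination e2
  · simp

end IsDriving

end

/-! ### Bernoulli entries -/

section

lemma ae_le_one_of_map_eq_bernoulli {ρ : Measure (ℕ × ℕ)} {f : ℕ × ℕ → ℕ} {p : unitInterval}
    (hf : ρ.map f = bernoulliMeasure 1 0 p) : ∀ᵐ x ∂ρ, f x ≤ 1 := by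
  have h1 : ∀ᵐ n ∂(bernoulliMeasure 1 0 p), n ≤ 1 := by
    rw [ae_iff, bernoulliMeasure_apply_of_notMem_of_notMem] <;> simp
  rw [← hf] at h1
  exact ae_of_ae_map (Measurable.of_discrete (f := f)).aemeasurable h1

lemma integral_of_map_eq_bernoulli {ρ : Measure (ℕ × ℕ)} {f : ℕ × ℕ → ℕ} {p : unitInterval}
    (hf : ρ.map f = bernoulliMeasure 1 0 p) : ∫ x, (f x : ℝ) ∂ρ = p := by
  have h1 := integral_map (μ := ρ) (Measurable.of_discrete (f := f)).aemeasurable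
    (f := fun n : ℕ => (n : ℝ)) (Measurable.of_discrete.aestronglyMeasurable)
  rw [← h1, hf, integral_bernoulliMeasure]
  simp

end

end Polya

end

theorem mainTheorem2 {Ω : Type*} [MeasurableSpace Ω] {P : Measure Ω} [IsProbabilityMeasure P]
    {ρ : Measure (ℕ × ℕ)} [IsProbabilityMeasure ρ]
    {ξ : ℕ → ℕ → Ω → ℝ} {𝒲 𝒵 : ℕ → Ω → ℕ} (h : Polya.IsDriving ρ ξ 𝒲 𝒵 P)
    (W₀ B₀ : ℕ) (hτ : 0 < W₀ + B₀) :
    -- a general random replacement matrix with balance factor `k`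
    (∀ (k : ℕ) (hk : 0 < k), (∀ᵐ p ∂ρ, p.1 ≤ k ∧ p.2 ≤ k) →
      0 < 2 * (k : ℝ) - Polya.meanW ρ - Polya.meanZ ρ →
      -- the mixed moments
      (∀ i j : ℕ,
        (∀ t : ℝ, 0 ≤ t → Integrable
          (fun ω => Polya.W W₀ B₀ k ξ 𝒲 𝒵 t ω ^ i * Polya.B W₀ B₀ k ξ 𝒲 𝒵 t ω ^ j) P) ∧
        (fun t : ℝ =>
          ∫ ω, Polya.W W₀ B₀ k ξ 𝒲 𝒵 t ω ^ i * Polya.B W₀ B₀ k ξ 𝒲 𝒵 t ω ^ j ∂P -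
            Polya.momentCoeff (W₀ + B₀) k (Polya.meanW ρ) (Polya.meanZ ρ) i j *
              Real.exp (k * (i + j : ℝ) * t))
          =O[atTop] (fun t : ℝ =>
            Real.exp ((k * (i + j : ℝ) - (2 * k - Polya.meanW ρ - Polya.meanZ ρ)) * t) +
              Real.exp (k * (i + j - 1 : ℝ) * t)) ∧
        Tendsto (fun t : ℝ =>
          (∫ ω, Polya.W W₀ B₀ k ξ 𝒲 𝒵 t ω ^ i * Polya.B W₀ B₀ k ξ 𝒲 𝒵 t ω ^ j ∂P) /
            Real.exp (k * (i + j : ℝ) * t)) atTop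
          (𝓝 (Polya.momentCoeff (W₀ + B₀) k (Polya.meanW ρ) (Polya.meanZ ρ) i j))) ∧
      -- the limit law
      TendstoInDistribution
        (fun (t : ℝ) ω => (Real.exp (-(k * t)) * Polya.W W₀ B₀ k ξ 𝒲 𝒵 t ω,
          Real.exp (-(k * t)) * Polya.B W₀ B₀ k ξ 𝒲 𝒵 t ω))
        atTop
        (fun g : ℝ =>
          (g * ((k - Polya.meanZ ρ) / (2 * k - Polya.meanW ρ - Polya.meanZ ρ)),
            g * ((k - Polya.meanW ρ) / (2 * k - Polya.meanW ρ - Polya.meanZ ρ))))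
        (fun _ => P)
        (Polya.gammaLaw (((W₀ + B₀ : ℕ) : ℝ) / k) k
          (div_pos (Nat.cast_pos.2 hτ) (Nat.cast_pos.2 hk)) (Nat.cast_pos.2 hk) : Measure ℝ)) ∧
    -- the randomized Play-the-Winner scheme
    (∀ p₁ p₂ : unitInterval,
      ρ.map Prod.fst = bernoulliMeasure 1 0 p₁ → ρ.map Prod.snd = bernoulliMeasure 1 0 p₂ →
      ∀ q₁ q₂ : ℝ, q₁ = 1 - (p₁ : ℝ) → q₂ = 1 - (p₂ : ℝ) → 0 < q₁ + q₂ →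
      TendstoInDistribution
        (fun (t : ℝ) ω => (Real.exp (-t) * Polya.W W₀ B₀ 1 ξ 𝒲 𝒵 t ω,
          Real.exp (-t) * Polya.B W₀ B₀ 1 ξ 𝒲 𝒵 t ω))
        atTop
        (fun g : ℝ => (g * (q₂ / (q₁ + q₂)), g * (q₁ / (q₁ + q₂))))
        (fun _ => P)
        (Polya.gammaLaw ((W₀ + B₀ : ℕ) : ℝ) 1 (Nat.cast_pos.2 hτ) one_pos : Measure ℝ)) := by
  have hτ' : (0 : ℝ) < (W₀ + B₀ : ℕ) := Nat.cast_pos.2 hτ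
  refine ⟨fun k hk hρ hΔ => ⟨fun i j => h.moments hk hτ hρ hΔ i j, ?_⟩, ?_⟩
  · have hk' : (0 : ℝ) < k := Nat.cast_pos.2 hk
    have := isProbabilityMeasure_gammaMeasure (div_pos hτ' hk') (inv_pos.2 hk')
    exact h.tendstoInDistribution_urn hk hτ hρ hΔ
  · intro p₁ p₂ h₁ h₂ q₁ q₂ hq₁ hq₂ hq
    have m₁ : Polya.meanW ρ = p₁ := Polya.integral_of_map_eq_bernoulli h₁
    have m₂ : Polya.meanZ ρ = p₂ := Polya.integral_of_map_eq_bernoulli h₂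
    have hρ : ∀ᵐ p ∂ρ, p.1 ≤ 1 ∧ p.2 ≤ 1 :=
      (Polya.ae_le_one_of_map_eq_bernoulli h₁).and (Polya.ae_le_one_of_map_eq_bernoulli h₂)
    have hΔ : 2 * ((1 : ℕ) : ℝ) - Polya.meanW ρ - Polya.meanZ ρ = q₁ + q₂ := by
      rw [m₁, m₂, hq₁, hq₂, Nat.cast_one]
      ring
    have := isProbabilityMeasure_gammaMeasure hτ' (inv_pos.2 one_pos)
    have e : gammaMeasure (((W₀ + B₀ : ℕ) : ℝ) / (1 : ℕ)) ((1 : ℕ) : ℝ)⁻¹ =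
        gammaMeasure ((W₀ + B₀ : ℕ) : ℝ) 1⁻¹ := by
      rw [Nat.cast_one, div_one]
    have : IsProbabilityMeasure (gammaMeasure (((W₀ + B₀ : ℕ) : ℝ) / (1 : ℕ)) ((1 : ℕ) : ℝ)⁻¹) :=
      e ▸ this
    have h3 := h.tendstoInDistribution_urn one_pos hτ hρ (hΔ ▸ hq)
    rw [hΔ, m₁, m₂] at h3
    simp only [Nat.cast_one, one_mul, div_one, ← hq₁, ← hq₂] at h3
    exact h3
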